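/- Let $(M,g)$ be a compact smooth Riemannian manifold without boundary, of dimension $N\ge 2$, with Riemannian volume measure $dv_g$, and write $|A|$ for the Riemannian volume of a measurable set $A\subseteq M$. The perimeter of $A$ is $$P(A)=\sup\Big\{\int_A \operatorname{div}_g(\xi)\,dv_g \;:\; \xi \text{ a } C^1 \text{ vector field on } M,\ |\xi|_g\le 1\Big\}\in[0,\infty].$$ For an open set $\Omega\subseteq M$ the Cheeger constant is $h(\Omega)=\inf_A P(A)/|A|$, where $A$ ranges over the measurable subsets of $\Omega$ with finite perimeter and $|A|>0$; a set $A$ of this kind with $P(A)/|A|=h(\Omega)$ is called a Cheeger set in $\Omega$. The set $\Omega$ is called uniquely self-Cheeger if $\Omega$ is a Cheeger set in $\Omega$ and every Cheeger set in $\Omega$ agrees with $\Omega$ up to a set of volume zero. **Theorem.** Let $\Omega\subseteq M$ be a smooth domain, that is, a nonempty connected open set which near each point $p\in\partial\Omega$ has the form $\{\rho<0\}$ for a smooth function $\rho$ with $d\rho_p\neq 0$, and let $\eta$ be the unit outer normal of $\partial\Omega$. Assume that there are a constant $\lambda>0$ and a function $u\in C^2(\overline\Omega)$ such that $$-\Delta_g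 u=1 \ \text{ in } \Omega,\qquad u=0 \ \text{ on } \partial\Omega,\qquad g(\nabla u,\eta)=-\lambda \ \text{ on } \partial\Omega,$$ where $\Delta_g=\operatorname{div}_g\nabla$ is the Laplace–Beltrami operator. If $$\operatorname{Ric}_g(\nabla u,\nabla u)>-\frac1N \quad\text{in } \Omega,$$ then $\Omega$ is uniquely self-Cheeger, and $h(\Omega)=1/\lambda$. -/

import Mathlib

open scoped Manifold ContDiff Topology ENNReal
open MeasureTheory Bundle

noncomputable section

/-! `M` is a smooth manifold without boundary, modelled on `ℝᴺ`, with a smooth Riemannian metric.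
Local expressions at a point are computed in the preferred chart there; all the notions below are
classically independent of the chart. -/

/-- Smooth (`C^∞`) Riemannian metrics on the `N`-dimensional manifold `M`. -/
abbrev SmoothMetric (N : ℕ) (M : Type*) [TopologicalSpace M]
    [ChartedSpace (EuclideanSpace ℝ (Fin N)) M] [IsManifold (𝓡 N) ∞ M] :=
  ContMDiffRiemannianMetric (𝓡 N) ∞ (EuclideanSpace ℝ (Fin N))
    (fun x : M => TangentSpace (𝓡 N) x)

/-- The partial derivative `∂ᵢ f` of a function on `ℝᴺ`. -/
def partialDeriv {N : ℕ} (i : Fin N) (f : EuclideanSpace ℝ (Fin N) → ℝ)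
    (y : EuclideanSpace ℝ (Fin N)) : ℝ :=
  fderiv ℝ f y (EuclideanSpace.single i 1)

namespace SmoothMetric

variable {N : ℕ} {M : Type*} [TopologicalSpace M]
  [ChartedSpace (EuclideanSpace ℝ (Fin N)) M] [IsManifold (𝓡 N) ∞ M]

section Coordinates

/-- The coordinate vector field `∂ᵢ` of the chart at `c`, at the point with coordinates `y`. -/
def coordVec (c : M) (i : Fin N) (y : EuclideanSpace ℝ (Fin N)) :
    TangentSpace (𝓡 N) ((extChartAt (𝓡 N) c).symm y) :=
  mfderiv (𝓡 N) (𝓡 N) (extChartAt (𝓡 N) c).symm y (EuclideanSpace.single i (1 : ℝ))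

/-- The component `Xⁱ` of a vector field in the chart at `c`, as a function of the coordinates. -/
def coordComp (c : M) (X : ∀ x : M, TangentSpace (𝓡 N) x) (i : Fin N)
    (y : EuclideanSpace ℝ (Fin N)) : ℝ :=
  EuclideanSpace.proj (𝕜 := ℝ) i
    (mfderiv (𝓡 N) (𝓡 N) (extChartAt (𝓡 N) c) ((extChartAt (𝓡 N) c).symm y)
      (X ((extChartAt (𝓡 N) c).symm y)) : EuclideanSpace ℝ (Fin N))

/-- The Gram matrix `g_{ij} = g(∂ᵢ, ∂ⱼ)` in the chart at `c`. -/
def gram (g : SmoothMetric N M) (c : M) (y : EuclideanSpace ℝ (Fin N)) :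
    Matrix (Fin N) (Fin N) ℝ :=
  Matrix.of fun i j => g.inner ((extChartAt (𝓡 N) c).symm y) (coordVec c i y) (coordVec c j y)

/-- The density `√(det g_{ij})` of the Riemannian volume in the chart at `c`. -/
def volDensity (g : SmoothMetric N M) (c : M) (y : EuclideanSpace ℝ (Fin N)) : ℝ :=
  Real.sqrt (gram g c y).det

/-- The Christoffel symbols
`Γᵏ_{ij} = ½ ∑ₗ gᵏˡ (∂ᵢ g_{jl} + ∂ⱼ g_{il} - ∂ₗ g_{ij})` in the chart at `c`. -/
def christoffel (g : SmoothMetric N M) (c : M) (k i j : Fin N)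
    (y : EuclideanSpace ℝ (Fin N)) : ℝ :=
  (1 / 2) * ∑ l, (gram g c y)⁻¹ k l *
    (partialDeriv i (fun z => gram g c z j l) y + partialDeriv j (fun z => gram g c z i l) y
      - partialDeriv l (fun z => gram g c z i j) y)

/-- The components of the Ricci tensor in the chart at `c`:
`R_{ij} = ∑ₖ (∂ₖ Γᵏ_{ij} - ∂ⱼ Γᵏ_{ik}) + ∑ₖₗ (Γᵏ_{kl} Γˡ_{ij} - Γᵏ_{jl} Γˡ_{ik})`. -/
def ricciCoord (g : SmoothMetric N M) (c : M) (i j : Fin N)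
    (y : EuclideanSpace ℝ (Fin N)) : ℝ :=
  (∑ k, (partialDeriv k (christoffel g c k i j) y - partialDeriv j (christoffel g c k i k) y)) +
    ∑ k, ∑ l, (christoffel g c k k l y * christoffel g c l i j y
      - christoffel g c k j l y * christoffel g c l i k y)

end Coordinates

/-- The quadratic form `x ↦ Ric_g(X, X)` of the Ricci curvature on a vector field `X`. -/
def ricci (g : SmoothMetric N M) (X : ∀ x : M, TangentSpace (𝓡 N) x) (x : M) : ℝ :=
  ∑ i, ∑ j, ricciCoord g x i j (extChartAt (𝓡 N) x x) *
    coordComp x X i (extChartAt (𝓡 N) x x) * coordComp x X j (extChartAt (𝓡 N) x x)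

/-- The divergence of a vector field, `div X = (√det g)⁻¹ ∑ᵢ ∂ᵢ (√det g Xⁱ)`. -/
def divergence (g : SmoothMetric N M) (X : ∀ x : M, TangentSpace (𝓡 N) x) (x : M) : ℝ :=
  (volDensity g x (extChartAt (𝓡 N) x x))⁻¹ *
    ∑ i, partialDeriv i (fun y => volDensity g x y * coordComp x X i y) (extChartAt (𝓡 N) x x)

/-- The metric at `x`, as a bilinear form. -/
def bilin (g : SmoothMetric N M) (x : M) :
    LinearMap.BilinForm ℝ (EuclideanSpace ℝ (Fin N)) :=
  LinearMap.mk₂ ℝ (fun v w => g.inner x v w)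
    (fun v v' w => by
      have h := (g.inner x).map_add (v : TangentSpace (𝓡 N) x) (v' : TangentSpace (𝓡 N) x)
      exact congrArg (fun L => L w) h)
    (fun a v w => by
      have h := (g.inner x).map_smul a (v : TangentSpace (𝓡 N) x)
      exact congrArg (fun L => L w) h)
    (fun v w w' => (g.inner x v).map_add w w')
    (fun a v w => (g.inner x v).map_smul a w)

theorem bilin_nondegenerate (g : SmoothMetric N M) (x : M) : (g.bilin x).Nondegenerate := by
  have key : ∀ v : EuclideanSpace ℝ (Fin N), g.bilin x v v = 0 → v = 0 := by
    intro v hv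
    by_contra h
    exact (g.pos x v h).ne' hv
  exact ⟨fun v hv => key v (hv v), fun v hv => key v (hv v)⟩

/-- The gradient of `u` within a set `S`: the vector `v` with `g(v, w) = du(w)` for all `w`, where
`du` is the derivative of `u` within `S`. -/
def gradWithin (g : SmoothMetric N M) (S : Set M) (u : M → ℝ) (x : M) : TangentSpace (𝓡 N) x :=
  ((g.bilin x).toDual (g.bilin_nondegenerate x)).symm
    (mfderivWithin (𝓡 N) 𝓘(ℝ, ℝ) u S x : EuclideanSpace ℝ (Fin N) →L[ℝ] ℝ).toLinearMap

theorem inner_gradWithin (g : SmoothMetric N M) (S : Set M) (u : M → ℝ) (x : M)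
    (w : TangentSpace (𝓡 N) x) :
    g.inner x (g.gradWithin S u x) w = mfderivWithin (𝓡 N) 𝓘(ℝ, ℝ) u S x w :=
  LinearMap.BilinForm.apply_toDual_symm_apply (hB := g.bilin_nondegenerate x) _ _

/-- The gradient `∇u`. -/
def grad (g : SmoothMetric N M) (u : M → ℝ) (x : M) : TangentSpace (𝓡 N) x :=
  g.gradWithin Set.univ u x

/-- The Laplace–Beltrami operator `Δ_g u = div (∇u)`. -/
def laplacian (g : SmoothMetric N M) (u : M → ℝ) (x : M) : ℝ :=
  g.divergence (g.grad u) x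

section Volume

variable [MeasurableSpace M]

/-- The measure `√(det g_{ij}) dy` of the chart at `c`, carried over to the chart domain in `M`. -/
def chartVolume (g : SmoothMetric N M) (c : M) : Measure M :=
  ((volume.withDensity fun y => ENNReal.ofReal (g.volDensity c y)).restrict
    (extChartAt (𝓡 N) c).target).map (extChartAt (𝓡 N) c).symm

/-- The Riemannian volume measure: the least measure that dominates the chart measures. As these
agree on the overlaps of the chart domains, it is the measure that restricts to
`√(det g_{ij}) dy` on each of them. -/
def vol (g : SmoothMetric N M) : Measure M :=
  ⨆ c : M, g.chartVolume c

/-- The perimeter `P(A)`: the supremum of `∫_A div ξ` over the `C¹` vector fields `ξ` on `M` with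
`|ξ| ≤ 1`. The field `ξ = 0` contributes the value `0`. -/
def perimeter (g : SmoothMetric N M) (A : Set M) : ℝ≥0∞ :=
  ⨆ (ξ : ∀ x : M, TangentSpace (𝓡 N) x)
    (_ : ContMDiff (𝓡 N) (𝓡 N).tangent 1 (fun x => (⟨x, ξ x⟩ : TangentBundle (𝓡 N) M)))
    (_ : ∀ x, g.inner x (ξ x) (ξ x) ≤ 1),
    ENNReal.ofReal (∫ x in A, g.divergence ξ x ∂g.vol)

/-- The sets that compete in the Cheeger problem of `Ω`: measurable subsets of `Ω` with finite
perimeter and positive volume. -/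
structure IsCheegerCompetitor (g : SmoothMetric N M) (Ω A : Set M) : Prop where
  subset : A ⊆ Ω
  nullMeasurable : NullMeasurableSet A g.vol
  perimeter_ne_top : g.perimeter A ≠ ⊤
  vol_ne_zero : g.vol A ≠ 0

/-- The Cheeger constant `h(Ω) = inf_A P(A) / |A|`. -/
def cheegerConstant (g : SmoothMetric N M) (Ω : Set M) : ℝ≥0∞ :=
  ⨅ (A : Set M) (_ : g.IsCheegerCompetitor Ω A), g.perimeter A / g.vol A

/-- `F` is a Cheeger set in `Ω`: a competitor that attains the infimum `h(Ω)`. -/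
def IsCheegerSet (g : SmoothMetric N M) (Ω F : Set M) : Prop :=
  g.IsCheegerCompetitor Ω F ∧ g.perimeter F / g.vol F = g.cheegerConstant Ω

/-- `Ω` is uniquely self-Cheeger: it is a Cheeger set in itself, and the only one up to sets of
volume zero. -/
def IsUniquelySelfCheeger (g : SmoothMetric N M) (Ω : Set M) : Prop :=
  g.IsCheegerSet Ω Ω ∧ ∀ A : Set M, g.IsCheegerSet Ω A → A =ᵐ[g.vol] Ω

end Volume

end SmoothMetric

section Domains

variable {N : ℕ} {M : Type*} [TopologicalSpace M]
  [ChartedSpace (EuclideanSpace ℝ (Fin N)) M]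

/-- `ρ` is a smooth local defining function of `Ω` near `p`: `Ω = {ρ < 0}` near `p`, and
`dρ ≠ 0` at `p`. -/
def IsLocalDefiningFunction (Ω : Set M) (p : M) (ρ : M → ℝ) : Prop :=
  mfderiv (𝓡 N) 𝓘(ℝ, ℝ) ρ p ≠ 0 ∧
    ∃ U : Set M, IsOpen U ∧ p ∈ U ∧ ContMDiffOn (𝓡 N) 𝓘(ℝ, ℝ) ∞ ρ U ∧
      Ω ∩ U = {x ∈ U | ρ x < 0}

/-- A smooth domain: a nonempty connected open set with smooth boundary. -/
structure IsSmoothDomain (N : ℕ) {M : Type*} [TopologicalSpace M]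
    [ChartedSpace (EuclideanSpace ℝ (Fin N)) M] (Ω : Set M) : Prop where
  isOpen : IsOpen Ω
  isConnected : IsConnected Ω
  smooth_boundary : ∀ p ∈ frontier Ω, ∃ ρ : M → ℝ, IsLocalDefiningFunction (N := N) Ω p ρ

/-- `η` is the unit outer normal of `∂Ω` at `p`: `η = ∇ρ / |∇ρ|` for a local defining
function `ρ` of `Ω` near `p`. -/
def IsUnitOuterNormal [IsManifold (𝓡 N) ∞ M] (g : SmoothMetric N M) (Ω : Set M) (p : M)
    (η : TangentSpace (𝓡 N) p) : Prop :=
  ∃ ρ : M → ℝ, IsLocalDefiningFunction (N := N) Ω p ρ ∧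
    η = (Real.sqrt (g.inner p (g.grad ρ p) (g.grad ρ p)))⁻¹ • g.grad ρ p

end Domains

end

open scoped Manifold ContDiff Topology ENNReal
open MeasureTheory Bundle

noncomputable section

set_option linter.unusedSectionVars false

/-! The proof is a calibration argument with the field `-∇u/l`. Its divergence on `Ω` is the
constant `1/l`. If `|∇u| < l` in `Ω`, then testing the perimeter of `A ⊆ Ω` with this field gives
`|A|/l ≤ P(A)`. On the boundary the field is the unit outer normal, and this makes `Ω` itself an
equality case: `P(Ω) = |Ω|/l`.

The gradient bound is a maximum principle for `|∇u|²`. By Bochner, `½ Δ|∇u|² = |Hess u|² +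
Ric(∇u,∇u) + g(∇u, ∇Δu)`. The last term vanishes because `Δu = -1`, and `|Hess u|² ≥ (Δu)²/N = 1/N`.
The curvature hypothesis therefore makes `|∇u|²` strictly subharmonic in `Ω`. On `∂Ω` the gradient
is normal, because `u` is positive inside and zero on the boundary, so there the Neumann condition
says `|∇u| = l`. As `u` is only `C²`, the Bochner formula, which contains third derivatives, is used
in integrated form (`bochner_algebra`, `integral_bochner_eq_zero`) and the maximum principle in weak
form (`not_isLocalMax_of_weak_subharmonic`). Both meet in `not_isLocalMax_inner_grad`.

The second difficulty is that `-∇u/l` lives only on `closure Ω` and need not extend to an admissible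
`C¹` field on `M`. A `C¹` field `η` on `M` that is uniformly `δ`-close to it on `Ω` is glued to it
by a cutoff `χ = τ(u)` at a low level of `u`. The gluing error is at most `δ τ'(u)|∇u|`. Since
`|∇u|` is bounded below near `∂Ω`, it is controlled by `δ τ'(u)|∇u|²`, and the divergence theorem
for `χ∇u` gives `∫ τ'(u)|∇u|² = ∫ χ ≤ |Ω|`. This identity replaces any use of a boundary measure. It
yields the lower bound (`volume_div_add_integral_le`) and also `P(Ω) ≤ |Ω|/l`
(`integral_divergence_le`, `perimeter_le`).

For uniqueness, the strict inequality `|∇u| < l` on compact subsets of `Ω` leaves room to add `±tZ`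
to the calibrating field for every `C¹` field `Z` with compact support in `Ω`. If `A` is a Cheeger
set, the comparison with both signs forces `∫_A div Z = 0`. Hence the characteristic function of `A`
has zero weak derivative in `Ω`. It is locally constant almost everywhere, and connectedness of `Ω`
leaves only `A = Ω` up to a null set. -/

namespace SmoothMetric

/-! ### Coordinate expressions of vector fields and of the metric -/

variable {N : ℕ} {M : Type*} [TopologicalSpace M]
  [ChartedSpace (EuclideanSpace ℝ (Fin N)) M] [IsManifold (𝓡 N) ∞ M]

/-- The trivialization of the tangent bundle given by the chart at `c`. -/
abbrev triv (c : M) : Trivialization (EuclideanSpace ℝ (Fin N))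
    (TotalSpace.proj : TotalSpace (EuclideanSpace ℝ (Fin N)) (fun x : M => TangentSpace (𝓡 N) x) → M) :=
  trivializationAt (EuclideanSpace ℝ (Fin N)) (fun x : M => TangentSpace (𝓡 N) x) c

theorem isOpen_target (c : M) : IsOpen (extChartAt (𝓡 N) c).target :=
  isOpen_extChartAt_target c

theorem symm_mem_source {c : M} {y : EuclideanSpace ℝ (Fin N)} (hy : y ∈ (extChartAt (𝓡 N) c).target) :
    (extChartAt (𝓡 N) c).symm y ∈ (chartAt (EuclideanSpace ℝ (Fin N)) c).source := by
  rw [← extChartAt_source (I := 𝓡 N)]; exact (extChartAt (𝓡 N) c).map_target hy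

theorem coordVec_eq {c : M} {y : EuclideanSpace ℝ (Fin N)} (hy : y ∈ (extChartAt (𝓡 N) c).target)
    (i : Fin N) : coordVec c i y =
      (triv c).symmL ℝ ((extChartAt (𝓡 N) c).symm y) (EuclideanSpace.single i 1) := by
  rw [TangentBundle.symmL_trivializationAt (symm_mem_source hy), coordVec,
    (extChartAt (𝓡 N) c).right_inv hy, ModelWithCorners.range_eq_univ, mfderivWithin_univ]
  rfl

theorem coordComp_eq {c : M} {y : EuclideanSpace ℝ (Fin N)} (hy : y ∈ (extChartAt (𝓡 N) c).target)
    (X : ∀ x : M, TangentSpace (𝓡 N) x) (i : Fin N) : coordComp c X i y =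
      ((triv c).continuousLinearMapAt ℝ ((extChartAt (𝓡 N) c).symm y)
        (X ((extChartAt (𝓡 N) c).symm y))) i := by
  rw [TangentBundle.continuousLinearMapAt_trivializationAt (symm_mem_source hy), coordComp]
  rfl

theorem sum_coordComp_smul_coordVec {c : M} {y : EuclideanSpace ℝ (Fin N)}
    (hy : y ∈ (extChartAt (𝓡 N) c).target) (X : ∀ x : M, TangentSpace (𝓡 N) x) :
    ∑ i, coordComp c X i y • coordVec c i y = X ((extChartAt (𝓡 N) c).symm y) := by
  have hb : (extChartAt (𝓡 N) c).symm y ∈ (triv c).baseSet := symm_mem_source hy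
  rw [← (triv c).symmL_continuousLinearMapAt (R := ℝ) hb (X ((extChartAt (𝓡 N) c).symm y))]
  conv_rhs => rw [← (EuclideanSpace.basisFun (Fin N) ℝ).sum_repr
    ((triv c).continuousLinearMapAt ℝ ((extChartAt (𝓡 N) c).symm y)
        (X ((extChartAt (𝓡 N) c).symm y)))]
  rw [map_sum]
  refine Finset.sum_congr rfl fun i _ => ?_
  rw [coordVec_eq hy, coordComp_eq hy, map_smul]
  simp

/-- The admissible fields in the perimeter are sections of the tangent bundle, while divergence and
Ricci are coordinate formulas. This criterion passes between the two, and it allows any chart around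
the point, not only the preferred one. -/
theorem contMDiffAt_field_iff {c x : M} (hx : x ∈ (extChartAt (𝓡 N) c).source)
    (X : ∀ x : M, TangentSpace (𝓡 N) x) (n : ℕ) :
    ContMDiffAt (𝓡 N) (𝓡 N).tangent n (fun x => (⟨x, X x⟩ : TangentBundle (𝓡 N) M)) x ↔
      ∀ i, ContDiffAt ℝ n (coordComp c X i) (extChartAt (𝓡 N) c x) := by
  have hx' : x ∈ (triv (N := N) c).baseSet := by
    rw [extChartAt_source] at hx; exact hx
  have : IsManifold (𝓡 N) ((n : ℕ∞ω) + 1) M := IsManifold.of_le (n := ∞) (by exact_mod_cast le_top)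
  have : ContMDiffVectorBundle (n : ℕ∞ω) (EuclideanSpace ℝ (Fin N)) (fun x : M => TangentSpace (𝓡 N) x) (𝓡 N) :=
    TangentBundle.contMDiffVectorBundle
  refine ((triv c).contMDiffAt_section_iff (IB := 𝓡 N) (n := n) (s := X) hx').trans ?_
  have hx2 : x ∈ (chartAt (EuclideanSpace ℝ (Fin N)) c).source := hx'
  rw [contMDiffAt_iff_source_of_mem_source hx2, ModelWithCorners.range_eq_univ,
    contMDiffWithinAt_univ, contMDiffAt_iff_contDiffAt, contDiffAt_euclidean]
  refine forall_congr' fun i => ?_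
  suffices h : (fun y => ((fun x => (triv c ⟨x, X x⟩).2) ∘ (extChartAt (𝓡 N) c).symm) y i)
      =ᶠ[𝓝 (extChartAt (𝓡 N) c x)] coordComp c X i from
    ⟨fun k => k.congr_of_eventuallyEq h.symm, fun k => k.congr_of_eventuallyEq h⟩
  filter_upwards [(isOpen_target c).mem_nhds ((extChartAt (𝓡 N) c).map_source hx)] with y hy
  rw [coordComp_eq hy]
  simp only [Function.comp]
  rw [Trivialization.continuousLinearMapAt_apply, Trivialization.linearMapAt_apply, if_pos]
  exact symm_mem_source hy

/-- The field with constant coordinates `a` in the chart at `c`. -/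
def constField (c : M) (a : EuclideanSpace ℝ (Fin N)) (x : M) : TangentSpace (𝓡 N) x :=
  (triv c).symmL ℝ x a

theorem coordVec_eq_constField {c : M} {y : EuclideanSpace ℝ (Fin N)} (hy : y ∈ (extChartAt (𝓡 N) c).target)
    (i : Fin N) : coordVec c i y = constField c (EuclideanSpace.single i 1) ((extChartAt (𝓡 N) c).symm y) :=
  coordVec_eq hy i

theorem coordComp_constField {c : M} {y : EuclideanSpace ℝ (Fin N)} (hy : y ∈ (extChartAt (𝓡 N) c).target)
    (a : EuclideanSpace ℝ (Fin N)) (i : Fin N) : coordComp c (constField c a) i y = a i := by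
  rw [coordComp_eq hy, constField, (triv c).continuousLinearMapAt_symmL (R := ℝ)]
  exact symm_mem_source hy

theorem contMDiffAt_constField {c x : M} (hx : x ∈ (extChartAt (𝓡 N) c).source)
    (a : EuclideanSpace ℝ (Fin N)) (n : ℕ) :
    ContMDiffAt (𝓡 N) (𝓡 N).tangent n (fun x => (⟨x, constField c a x⟩ : TangentBundle (𝓡 N) M)) x := by
  rw [contMDiffAt_field_iff hx]
  intro i
  refine (contDiffAt_const (c := a i)).congr_of_eventuallyEq ?_
  filter_upwards [(isOpen_target c).mem_nhds ((extChartAt (𝓡 N) c).map_source hx)] with y hy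
  exact coordComp_constField hy a i

theorem contMDiffAt_inner (g : SmoothMetric N M) {X Y : ∀ x : M, TangentSpace (𝓡 N) x} {n : ℕ} {x : M}
    (hX : ContMDiffAt (𝓡 N) (𝓡 N).tangent n (fun x => (⟨x, X x⟩ : TangentBundle (𝓡 N) M)) x)
    (hY : ContMDiffAt (𝓡 N) (𝓡 N).tangent n (fun x => (⟨x, Y x⟩ : TangentBundle (𝓡 N) M)) x) :
    ContMDiffAt (𝓡 N) 𝓘(ℝ, ℝ) n (fun x => g.inner x (X x) (Y x)) x := by
  have hg := (g.contMDiff.of_le (m := (n : ℕ∞ω)) (by exact_mod_cast le_top)).contMDiffAt (x := x)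
  have : IsManifold (𝓡 N) ((n : ℕ∞ω) + 1) M := IsManifold.of_le (n := ∞) (by exact_mod_cast le_top)
  have : ContMDiffVectorBundle (n : ℕ∞ω) (EuclideanSpace ℝ (Fin N)) (fun x : M => TangentSpace (𝓡 N) x) (𝓡 N) :=
    TangentBundle.contMDiffVectorBundle
  have : ContMDiffAt (𝓡 N) ((𝓡 N).prod 𝓘(ℝ)) n
      (fun m ↦ TotalSpace.mk' ℝ (E := Bundle.Trivial M ℝ) m (g.inner m (X m) (Y m))) x :=
    ContMDiffAt.clm_bundle_apply₂ (F₁ := EuclideanSpace ℝ (Fin N)) (F₂ := EuclideanSpace ℝ (Fin N)) (b := fun x => x) hg hX hY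
  simp only [contMDiffAt_totalSpace] at this
  exact this.2

theorem contMDiffAt_iff_comp_symm {c x : M} (hx : x ∈ (extChartAt (𝓡 N) c).source)
    (f : M → ℝ) (n : ℕ) : ContMDiffAt (𝓡 N) 𝓘(ℝ, ℝ) n f x ↔
      ContDiffAt ℝ n (f ∘ (extChartAt (𝓡 N) c).symm) (extChartAt (𝓡 N) c x) := by
  have hx2 : x ∈ (chartAt (EuclideanSpace ℝ (Fin N)) c).source := by rwa [extChartAt_source] at hx
  have : IsManifold (𝓡 N) (n : ℕ∞ω) M := IsManifold.of_le (n := ∞) (by exact_mod_cast le_top)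
  rw [contMDiffAt_iff_source_of_mem_source hx2, ModelWithCorners.range_eq_univ,
    contMDiffWithinAt_univ, contMDiffAt_iff_contDiffAt]

theorem contDiffAt_gram (g : SmoothMetric N M) {c : M} {y : EuclideanSpace ℝ (Fin N)}
    (hy : y ∈ (extChartAt (𝓡 N) c).target) (i j : Fin N) (n : ℕ) :
    ContDiffAt ℝ n (fun y => gram g c y i j) y := by
  have hx := (extChartAt (𝓡 N) c).map_target hy
  have h := contMDiffAt_inner g (contMDiffAt_constField hx (EuclideanSpace.single i 1) n)
    (contMDiffAt_constField hx (EuclideanSpace.single j 1) n)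
  rw [contMDiffAt_iff_comp_symm hx, (extChartAt (𝓡 N) c).right_inv hy] at h
  refine h.congr_of_eventuallyEq ?_
  filter_upwards [(isOpen_target c).mem_nhds hy] with z hz
  simp only [gram, Matrix.of_apply, coordVec_eq_constField hz, Function.comp]

theorem inner_eq_sum (g : SmoothMetric N M) {c : M} {y : EuclideanSpace ℝ (Fin N)}
    (hy : y ∈ (extChartAt (𝓡 N) c).target) (X Y : ∀ x : M, TangentSpace (𝓡 N) x) :
    g.inner ((extChartAt (𝓡 N) c).symm y) (X ((extChartAt (𝓡 N) c).symm y))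
      (Y ((extChartAt (𝓡 N) c).symm y)) =
      ∑ i, ∑ j, gram g c y i j * coordComp c X i y * coordComp c Y j y := by
  rw [← sum_coordComp_smul_coordVec hy X, ← sum_coordComp_smul_coordVec hy Y]
  simp only [map_sum, sum_apply, map_smul, smul_apply, gram,
    Matrix.of_apply, smul_eq_mul, Finset.mul_sum]
  rw [Finset.sum_comm]
  refine Finset.sum_congr rfl fun i _ => Finset.sum_congr rfl fun j _ => ?_
  ring

theorem exists_constField_eq {c x : M} (hx : x ∈ (extChartAt (𝓡 N) c).source) (v : TangentSpace (𝓡 N) x) :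
    constField c ((triv c).continuousLinearMapAt ℝ x v) x = v := by
  rw [constField, (triv c).symmL_continuousLinearMapAt (R := ℝ)]
  rw [extChartAt_source] at hx; exact hx

theorem gram_symm (g : SmoothMetric N M) (c : M) (y : EuclideanSpace ℝ (Fin N)) (i j : Fin N) :
    gram g c y i j = gram g c y j i := g.symm _ _ _

theorem gram_posDef (g : SmoothMetric N M) {c : M} {y : EuclideanSpace ℝ (Fin N)}
    (hy : y ∈ (extChartAt (𝓡 N) c).target) : (gram g c y).PosDef := by
  refine Matrix.PosDef.of_dotProduct_mulVec_pos ?_ ?_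
  · ext i j
    simp [gram_symm g c y i j]
  · intro a ha
    set b : EuclideanSpace ℝ (Fin N) := WithLp.toLp 2 a with hb
    have h := inner_eq_sum g hy (constField c b) (constField c b)
    simp only [coordComp_constField hy] at h
    have hpos : 0 < g.inner ((extChartAt (𝓡 N) c).symm y) (constField c b ((extChartAt (𝓡 N) c).symm y))
        (constField c b ((extChartAt (𝓡 N) c).symm y)) := by
      refine g.pos _ _ fun h0 => ha ?_
      ext i
      rw [show a i = b i from rfl, ← coordComp_constField hy b i, coordComp_eq hy, h0, map_zero]
      rfl
    rw [h] at hpos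
    refine hpos.trans_eq ?_
    simp only [dotProduct, Matrix.mulVec, Finset.mul_sum, hb, Pi.star_apply, star_trivial]
    refine Finset.sum_congr rfl fun i _ => Finset.sum_congr rfl fun j _ => ?_
    ring

theorem det_gram_pos (g : SmoothMetric N M) {c : M} {y : EuclideanSpace ℝ (Fin N)}
    (hy : y ∈ (extChartAt (𝓡 N) c).target) : 0 < (gram g c y).det := (gram_posDef g hy).det_pos

theorem volDensity_pos (g : SmoothMetric N M) {c : M} {y : EuclideanSpace ℝ (Fin N)}
    (hy : y ∈ (extChartAt (𝓡 N) c).target) : 0 < volDensity g c y := Real.sqrt_pos.2 (det_gram_pos g hy)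

end SmoothMetric

/-! ### Regularity of the metric coefficients and components of gradients -/

theorem ContDiffAt.matrix_det {E : Type*} [NormedAddCommGroup E] [NormedSpace ℝ E] {ι : Type*} [Fintype ι]
    [DecidableEq ι] {A : E → Matrix ι ι ℝ} {x : E} {n : ℕ∞ω}
    (h : ∀ i j, ContDiffAt ℝ n (fun y => A y i j) x) : ContDiffAt ℝ n (fun y => (A y).det) x := by
  simp only [Matrix.det_apply]
  refine ContDiffAt.sum fun σ _ => ContDiffAt.const_smul _ ?_
  exact contDiffAt_prod fun i _ => h _ _

/-- Cramer's rule: the entries of the inverse are polynomials in the entries of the matrix, divided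
by the determinant. -/
theorem ContDiffAt.matrix_inv {E : Type*} [NormedAddCommGroup E] [NormedSpace ℝ E] {ι : Type*} [Fintype ι]
    [DecidableEq ι] {A : E → Matrix ι ι ℝ} {x : E} {n : ℕ∞ω}
    (h : ∀ i j, ContDiffAt ℝ n (fun y => A y i j) x) (hx : (A x).det ≠ 0) (i j : ι) :
    ContDiffAt ℝ n (fun y => (A y)⁻¹ i j) x := by
  simp only [Matrix.inv_def, Matrix.smul_apply, Ring.inverse_eq_inv', smul_eq_mul]
  refine ((ContDiffAt.matrix_det h).inv hx).mul ?_
  simp only [Matrix.adjugate_apply]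
  refine ContDiffAt.matrix_det fun k l => ?_
  simp only [Matrix.updateRow_apply]
  split_ifs
  · exact contDiffAt_const
  · exact h _ _

theorem ContDiffAt.partialDeriv {N : ℕ} {f : EuclideanSpace ℝ (Fin N) → ℝ} {y : EuclideanSpace ℝ (Fin N)} {n : ℕ}
    (h : ContDiffAt ℝ (n + 1 : ℕ) f y) (i : Fin N) : ContDiffAt ℝ n (partialDeriv i f) y :=
  (h.fderiv_right (m := n) (by simp)).clm_apply contDiffAt_const

namespace SmoothMetric

variable {N : ℕ} {M : Type*} [TopologicalSpace M]
  [ChartedSpace (EuclideanSpace ℝ (Fin N)) M] [IsManifold (𝓡 N) ∞ M]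

theorem contDiffAt_volDensity (g : SmoothMetric N M) {c : M} {y : EuclideanSpace ℝ (Fin N)}
    (hy : y ∈ (extChartAt (𝓡 N) c).target) (n : ℕ) : ContDiffAt ℝ n (volDensity g c) y :=
  (ContDiffAt.matrix_det fun i j => contDiffAt_gram g hy i j n).sqrt (det_gram_pos g hy).ne'

theorem contDiffAt_gram_inv (g : SmoothMetric N M) {c : M} {y : EuclideanSpace ℝ (Fin N)}
    (hy : y ∈ (extChartAt (𝓡 N) c).target) (i j : Fin N) (n : ℕ) :
    ContDiffAt ℝ n (fun y => (gram g c y)⁻¹ i j) y :=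
  ContDiffAt.matrix_inv (fun i j => contDiffAt_gram g hy i j n) (det_gram_pos g hy).ne' i j

theorem contDiffAt_christoffel (g : SmoothMetric N M) {c : M} {y : EuclideanSpace ℝ (Fin N)}
    (hy : y ∈ (extChartAt (𝓡 N) c).target) (k i j : Fin N) (n : ℕ) :
    ContDiffAt ℝ n (christoffel g c k i j) y := by
  refine contDiffAt_const.mul (ContDiffAt.sum fun l _ => (contDiffAt_gram_inv g hy k l n).mul ?_)
  exact (((contDiffAt_gram g hy j l (n + 1)).partialDeriv i).add
    ((contDiffAt_gram g hy i l (n + 1)).partialDeriv j)).sub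
    ((contDiffAt_gram g hy i j (n + 1)).partialDeriv l)

theorem christoffel_symm (g : SmoothMetric N M) (c : M) (k i j : Fin N) (y : EuclideanSpace ℝ (Fin N)) :
    christoffel g c k i j y = christoffel g c k j i y := by
  simp only [christoffel]
  congr 1
  refine Finset.sum_congr rfl fun l _ => ?_
  rw [show (fun z => gram g c z i j) = fun z => gram g c z j i from funext fun z => gram_symm g c z i j]
  ring

theorem hasMFDerivAt_extChartAt_symm {c : M} {y : EuclideanSpace ℝ (Fin N)}
    (hy : y ∈ (extChartAt (𝓡 N) c).target) :
    HasMFDerivAt (𝓡 N) (𝓡 N) (extChartAt (𝓡 N) c).symm y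
      (mfderiv (𝓡 N) (𝓡 N) (extChartAt (𝓡 N) c).symm y) := by
  have h := mdifferentiableWithinAt_extChartAt_symm (I := 𝓡 N) hy
  rw [ModelWithCorners.range_eq_univ, mdifferentiableWithinAt_univ] at h
  exact h.hasMFDerivAt

/-- The derivative of `u` within `S` in the coordinates of the chart at `c`. -/
def coordDeriv (c : M) (S : Set M) (u : M → ℝ) (y : EuclideanSpace ℝ (Fin N)) :
    EuclideanSpace ℝ (Fin N) →L[ℝ] ℝ :=
  (mfderivWithin (𝓡 N) 𝓘(ℝ, ℝ) u S ((extChartAt (𝓡 N) c).symm y)).comp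
    (mfderiv (𝓡 N) (𝓡 N) (extChartAt (𝓡 N) c).symm y)

/-- The coordinates `du(∂ₗ)`, in the chart at `c`, of the derivative of `u` within `S`. -/
def coordDiff (c : M) (S : Set M) (u : M → ℝ) (l : Fin N) (y : EuclideanSpace ℝ (Fin N)) : ℝ :=
  mfderivWithin (𝓡 N) 𝓘(ℝ, ℝ) u S ((extChartAt (𝓡 N) c).symm y) (coordVec c l y)

theorem coordDiff_eq (c : M) (S : Set M) (u : M → ℝ) (l : Fin N) (y : EuclideanSpace ℝ (Fin N)) :
    coordDiff c S u l y = coordDeriv c S u y (EuclideanSpace.single l 1) := rfl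

theorem hasFDerivWithinAt_comp_symm {c : M} {y : EuclideanSpace ℝ (Fin N)}
    (hy : y ∈ (extChartAt (𝓡 N) c).target) {S : Set M} {u : M → ℝ}
    (hu : MDifferentiableWithinAt (𝓡 N) 𝓘(ℝ, ℝ) u S ((extChartAt (𝓡 N) c).symm y)) :
    HasFDerivWithinAt (u ∘ (extChartAt (𝓡 N) c).symm) (coordDeriv c S u y)
      ((extChartAt (𝓡 N) c).symm ⁻¹' S) y := by
  have h := hu.hasMFDerivWithinAt.comp y (hasMFDerivAt_extChartAt_symm hy).hasMFDerivWithinAt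
    (Set.Subset.refl _)
  exact h.hasFDerivWithinAt

theorem sum_gram_mul_coordComp_gradWithin (g : SmoothMetric N M) {c : M} {y : EuclideanSpace ℝ (Fin N)}
    (hy : y ∈ (extChartAt (𝓡 N) c).target) (S : Set M) (u : M → ℝ) (l : Fin N) :
    ∑ k, gram g c y l k * coordComp c (g.gradWithin S u) k y =
      coordDiff c S u l y := by
  rw [coordDiff, ← g.inner_gradWithin, coordVec_eq_constField hy, inner_eq_sum g hy]
  simp only [coordComp_constField hy]
  refine Finset.sum_congr rfl fun k _ => ?_
  rw [Finset.sum_eq_single l]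
  · simp [gram_symm g c y l k]
  · intro j _ hj
    simp [hj]
  · simp

/-- Raising the index with `gⁱʲ`. The set `S` stays general because on `closure Ω` the gradient is
taken from one side at boundary points, while `S = univ` gives the ordinary gradient. -/
theorem coordComp_gradWithin (g : SmoothMetric N M) {c : M} {y : EuclideanSpace ℝ (Fin N)}
    (hy : y ∈ (extChartAt (𝓡 N) c).target) (S : Set M) (u : M → ℝ) (k : Fin N) :
    coordComp c (g.gradWithin S u) k y = ∑ l, (gram g c y)⁻¹ k l *
      coordDiff c S u l y := by
  have h := fun l => sum_gram_mul_coordComp_gradWithin g hy S u l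
  have h2 : (gram g c y).mulVec (fun k => coordComp c (g.gradWithin S u) k y) =
      fun l => coordDiff c S u l y := funext h
  have h3 := congrArg (fun w => (gram g c y)⁻¹.mulVec w) h2
  simp only [Matrix.mulVec_mulVec] at h3
  rw [Matrix.nonsing_inv_mul _ (isUnit_iff_ne_zero.2 (det_gram_pos g hy).ne'), Matrix.one_mulVec] at h3
  exact congrFun h3 k

end SmoothMetric

/-! ### Partial derivatives and the logarithmic derivative of the volume density -/

/-- Jacobi's formula. The product rule gives a sum of determinants in which one column is
differentiated, and Cramer's rule expresses each of them through the adjugate. -/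
theorem fderiv_matrix_det {E : Type*} [NormedAddCommGroup E] [NormedSpace ℝ E] {ι : Type*} [Fintype ι]
    [DecidableEq ι] {A : E → Matrix ι ι ℝ} {x : E}
    (h : ∀ i j, DifferentiableAt ℝ (fun y => A y i j) x) (v : E) :
    fderiv ℝ (fun y => (A y).det) x v =
      ∑ i, ∑ k, (A x).adjugate i k * fderiv ℝ (fun y => A y k i) x v := by
  have h1 : HasFDerivAt (fun y => (A y).det) (∑ σ : Equiv.Perm ι, (σ.sign : ℤ) •
      ∑ i, (∏ j ∈ Finset.univ.erase i, A x (σ j) j) • fderiv ℝ (fun y => A y (σ i) i) x) x := by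
    simp only [Matrix.det_apply]
    refine HasFDerivAt.fun_sum fun σ _ => ?_
    have := (HasFDerivAt.finsetProd (u := Finset.univ) (g := fun i y => A y (σ i) i)
      (fun i _ => (h (σ i) i).hasFDerivAt)).const_smul (σ.sign : ℤ)
    exact this
  rw [h1.fderiv]
  have h2 : ∀ i, ∑ k, (A x).adjugate i k * fderiv ℝ (fun y => A y k i) x v =
      ((A x).updateCol i (fun k => fderiv ℝ (fun y => A y k i) x v)).det := by
    intro i
    rw [← Matrix.cramer_apply, Matrix.cramer_eq_adjugate_mulVec]
    rfl
  simp only [h2, Matrix.det_apply]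
  rw [Finset.sum_comm]
  simp only [sum_apply, smul_apply]
  refine Finset.sum_congr rfl fun σ _ => ?_
  rw [← Finset.smul_sum]
  simp only [Units.smul_def]
  congr 1
  refine Finset.sum_congr rfl fun i _ => ?_
  rw [← Finset.mul_prod_erase _ _ (Finset.mem_univ i)]
  rw [mul_comm, smul_eq_mul]
  congr 1
  · refine Finset.prod_congr rfl fun j hj => ?_
    rw [Matrix.updateCol_ne (Finset.ne_of_mem_erase hj)]
  · simp

theorem partialDeriv_add {N : ℕ} {f h : EuclideanSpace ℝ (Fin N) → ℝ} {y : EuclideanSpace ℝ (Fin N)}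
    (hf : DifferentiableAt ℝ f y) (hh : DifferentiableAt ℝ h y) (i : Fin N) :
    partialDeriv i (fun z => f z + h z) y = partialDeriv i f y + partialDeriv i h y := by
  simp [partialDeriv, fderiv_fun_add hf hh]

theorem partialDeriv_mul {N : ℕ} {f h : EuclideanSpace ℝ (Fin N) → ℝ} {y : EuclideanSpace ℝ (Fin N)}
    (hf : DifferentiableAt ℝ f y) (hh : DifferentiableAt ℝ h y) (i : Fin N) :
    partialDeriv i (fun z => f z * h z) y = partialDeriv i f y * h y + f y * partialDeriv i h y := by
  simp [partialDeriv, fderiv_fun_mul hf hh]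
  ring

theorem partialDeriv_sum {N : ℕ} {ι : Type*} [Fintype ι] {f : ι → EuclideanSpace ℝ (Fin N) → ℝ} {y : EuclideanSpace ℝ (Fin N)}
    (hf : ∀ j, DifferentiableAt ℝ (f j) y) (i : Fin N) :
    partialDeriv i (fun z => ∑ j, f j z) y = ∑ j, partialDeriv i (f j) y := by
  simp [partialDeriv, fderiv_fun_sum fun j _ => hf j]

theorem Filter.EventuallyEq.partialDeriv_eq {N : ℕ} {f h : EuclideanSpace ℝ (Fin N) → ℝ} {y : EuclideanSpace ℝ (Fin N)}
    (hf : f =ᶠ[𝓝 y] h) (i : Fin N) : partialDeriv i f y = partialDeriv i h y := by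
  simp [partialDeriv, hf.fderiv_eq]

theorem fderiv_eq_sum_partialDeriv {N : ℕ} (f : EuclideanSpace ℝ (Fin N) → ℝ)
    (y v : EuclideanSpace ℝ (Fin N)) : fderiv ℝ f y v = ∑ i, partialDeriv i f y * v i := by
  conv_lhs => rw [← (EuclideanSpace.basisFun (Fin N) ℝ).sum_repr v]
  simp [partialDeriv, mul_comm]

theorem partialDeriv_comp {N : ℕ} {f : EuclideanSpace ℝ (Fin N) → ℝ}
    {ψ : EuclideanSpace ℝ (Fin N) → EuclideanSpace ℝ (Fin N)} {y : EuclideanSpace ℝ (Fin N)}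
    (hf : DifferentiableAt ℝ f (ψ y)) (hψ : DifferentiableAt ℝ ψ y) (i : Fin N) :
    partialDeriv i (fun z => f (ψ z)) y =
      ∑ p, partialDeriv p f (ψ y) * partialDeriv i (fun z => ψ z p) y := by
  rw [partialDeriv, show (fun z => f (ψ z)) = f ∘ ψ from rfl, fderiv_comp y hf hψ]
  rw [ContinuousLinearMap.comp_apply, fderiv_eq_sum_partialDeriv]
  refine Finset.sum_congr rfl fun p _ => ?_
  congr 1
  rw [partialDeriv]
  have := ((EuclideanSpace.proj (𝕜 := ℝ) p : EuclideanSpace ℝ (Fin N) →L[ℝ] ℝ).hasFDerivAt).comp y hψ.hasFDerivAt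
  rw [show (fun z => ψ z p) = (EuclideanSpace.proj (𝕜 := ℝ) p : EuclideanSpace ℝ (Fin N) →L[ℝ] ℝ) ∘ ψ from rfl,
    this.fderiv]
  rfl

theorem partialDeriv_comm {N : ℕ} {f : EuclideanSpace ℝ (Fin N) → ℝ} {y : EuclideanSpace ℝ (Fin N)}
    (hf : ContDiffAt ℝ 2 f y) (i j : Fin N) :
    partialDeriv i (partialDeriv j f) y = partialDeriv j (partialDeriv i f) y := by
  have hs := hf.isSymmSndFDerivAt (by simp)
  have hd : DifferentiableAt ℝ (fderiv ℝ f) y :=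
    (hf.fderiv_right (m := 1) (by norm_num)).differentiableAt one_ne_zero
  have key : ∀ i j : Fin N, partialDeriv i (partialDeriv j f) y =
      fderiv ℝ (fderiv ℝ f) y (EuclideanSpace.single i 1) (EuclideanSpace.single j 1) := by
    intro i j
    have : HasFDerivAt (partialDeriv j f) _ y := hd.hasFDerivAt.clm_apply (hasFDerivAt_const (EuclideanSpace.single j (1:ℝ)) y)
    rw [partialDeriv, this.fderiv]
    simp
  rw [key, key]
  exact hs _ _

namespace SmoothMetric

variable {N : ℕ} {M : Type*} [TopologicalSpace M]
  [ChartedSpace (EuclideanSpace ℝ (Fin N)) M] [IsManifold (𝓡 N) ∞ M]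

theorem differentiableAt_gram (g : SmoothMetric N M) {c : M} {y : EuclideanSpace ℝ (Fin N)}
    (hy : y ∈ (extChartAt (𝓡 N) c).target) (i j : Fin N) :
    DifferentiableAt ℝ (fun y => gram g c y i j) y :=
  (contDiffAt_gram g hy i j 1).differentiableAt one_ne_zero

theorem partialDeriv_volDensity (g : SmoothMetric N M) {c : M} {y : EuclideanSpace ℝ (Fin N)}
    (hy : y ∈ (extChartAt (𝓡 N) c).target) (m : Fin N) :
    partialDeriv m (volDensity g c) y = volDensity g c y * ((1 / 2) *
      ∑ i, ∑ k, (gram g c y)⁻¹ i k * partialDeriv m (fun y => gram g c y k i) y) := by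
  have hd := fderiv_matrix_det (fun i j => differentiableAt_gram g hy i j) (EuclideanSpace.single m 1)
  have hdet := det_gram_pos g hy
  have hdiff : DifferentiableAt ℝ (fun y => (gram g c y).det) y :=
    (ContDiffAt.matrix_det fun i j => contDiffAt_gram g hy i j 1).differentiableAt one_ne_zero
  have h1 := hdiff.hasFDerivAt.sqrt hdet.ne'
  have h2 : partialDeriv m (volDensity g c) y =
      1 / (2 * √(gram g c y).det) * fderiv ℝ (fun y => (gram g c y).det) y (EuclideanSpace.single m 1) := by
    rw [partialDeriv, show volDensity g c = fun y => √(gram g c y).det from rfl, h1.fderiv]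
    simp
  rw [h2, hd]
  have h3 : ∀ i k, (gram g c y).adjugate i k = (gram g c y).det * (gram g c y)⁻¹ i k := by
    intro i k
    rw [Matrix.inv_def, Ring.inverse_eq_inv', Matrix.smul_apply, smul_eq_mul, ← mul_assoc,
      mul_inv_cancel₀ hdet.ne', one_mul]
  simp only [h3, volDensity, partialDeriv, mul_assoc]
  simp only [← Finset.mul_sum]
  have hs := Real.mul_self_sqrt hdet.le
  have hs0 := (Real.sqrt_pos.2 hdet).ne'
  generalize (∑ i, ∑ k, (gram g c y)⁻¹ i k * _) = T
  nth_rewrite 2 [← hs]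
  field_simp

/-- Of the three terms of the Christoffel symbol, the first and third cancel in the contraction,
because `gⁱʲ` is symmetric and the summation indices can be exchanged. -/
theorem sum_christoffel (g : SmoothMetric N M) (c : M) (y : EuclideanSpace ℝ (Fin N)) (m : Fin N) :
    ∑ k, christoffel g c k k m y = (1 / 2) *
      ∑ i, ∑ k, (gram g c y)⁻¹ i k * partialDeriv m (fun y => gram g c y k i) y := by
  have hsym : ∀ i k, (gram g c y)⁻¹ i k = (gram g c y)⁻¹ k i := by
    intro i k
    have h : (gram g c y).transpose = gram g c y := by ext i j; exact gram_symm g c y j i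
    have := Matrix.transpose_nonsing_inv (gram g c y)
    rw [h] at this
    exact congrFun (congrFun this k) i
  simp only [christoffel, ← Finset.mul_sum, mul_add, mul_sub, Finset.sum_add_distrib, Finset.sum_sub_distrib]
  have h1 : ∑ x, ∑ i, (gram g c y)⁻¹ x i * partialDeriv x (fun z => gram g c z m i) y =
      ∑ x, ∑ i, (gram g c y)⁻¹ x i * partialDeriv i (fun z => gram g c z x m) y := by
    rw [Finset.sum_comm]
    refine Finset.sum_congr rfl fun i _ => Finset.sum_congr rfl fun j _ => ?_
    rw [hsym i j, show (fun z => gram g c z m i) = fun z => gram g c z i m from funext fun z => gram_symm g c z m i]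
  rw [h1, add_sub_cancel_left]
  congr 1
  refine Finset.sum_congr rfl fun i _ => Finset.sum_congr rfl fun j _ => ?_
  rw [show (fun z => gram g c z i j) = fun z => gram g c z j i from funext fun z => gram_symm g c z i j]

theorem partialDeriv_volDensity_eq_christoffel (g : SmoothMetric N M) {c : M} {y : EuclideanSpace ℝ (Fin N)}
    (hy : y ∈ (extChartAt (𝓡 N) c).target) (m : Fin N) :
    partialDeriv m (volDensity g c) y = volDensity g c y * ∑ k, christoffel g c k k m y := by
  rw [partialDeriv_volDensity g hy, sum_christoffel g]

end SmoothMetric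

/-! ### Independence of the divergence from the chart -/

/-- The entrywise partial derivative of a matrix-valued function. -/
def matrixDeriv {N : ℕ} (m : Fin N) (A : EuclideanSpace ℝ (Fin N) → Matrix (Fin N) (Fin N) ℝ)
    (y : EuclideanSpace ℝ (Fin N)) : Matrix (Fin N) (Fin N) ℝ :=
  Matrix.of fun i j => partialDeriv m (fun z => A z i j) y

theorem matrixDeriv_mul {N : ℕ} (m : Fin N) {A B : EuclideanSpace ℝ (Fin N) → Matrix (Fin N) (Fin N) ℝ}
    {y : EuclideanSpace ℝ (Fin N)} (hA : ∀ i j, DifferentiableAt ℝ (fun z => A z i j) y)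
    (hB : ∀ i j, DifferentiableAt ℝ (fun z => B z i j) y) :
    matrixDeriv m (fun z => A z * B z) y = matrixDeriv m A y * B y + A y * matrixDeriv m B y := by
  ext i j
  simp only [matrixDeriv, Matrix.of_apply, Matrix.mul_apply, Matrix.add_apply]
  rw [partialDeriv_sum fun k => (hA i k).fun_mul (hB k j), ← Finset.sum_add_distrib]
  exact Finset.sum_congr rfl fun k _ => partialDeriv_mul (hA i k) (hB k j) m

/-- With `K` and `D` in the role of derivatives of `J` and `G`, this is the logarithmic derivative
of `det (Jᵀ G J) = (det J)² det G`. The factors do not commute, but cyclicity of the trace is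
enough. -/
theorem trace_inv_mul_conj {N : ℕ} {J G K D : Matrix (Fin N) (Fin N) ℝ} (hJ : IsUnit J.det) (hG : IsUnit G.det) :
    ((J.transpose * G * J)⁻¹ * ((K.transpose * G + J.transpose * D) * J + J.transpose * G * K)).trace =
      2 * (J⁻¹ * K).trace + (G⁻¹ * D).trace := by
  have hJT : IsUnit J.transpose.det := by rwa [Matrix.det_transpose]
  have e : (J.transpose * G * J)⁻¹ * ((K.transpose * G + J.transpose * D) * J + J.transpose * G * K)
      = J⁻¹ * (G⁻¹ * (J.transpose⁻¹ * K.transpose) * G + G⁻¹ * (J.transpose⁻¹ * J.transpose) * D) * J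
        + J⁻¹ * (G⁻¹ * (J.transpose⁻¹ * J.transpose) * G) * K := by
    rw [Matrix.mul_inv_rev, Matrix.mul_inv_rev]
    noncomm_ring
  rw [e, Matrix.nonsing_inv_mul _ hJT, Matrix.mul_one, Matrix.nonsing_inv_mul _ hG, Matrix.mul_one,
    Matrix.trace_add, Matrix.trace_mul_cycle, Matrix.mul_nonsing_inv _ hJ, Matrix.one_mul, Matrix.trace_add,
    Matrix.trace_mul_cycle, Matrix.mul_nonsing_inv _ hG, Matrix.one_mul, ← Matrix.transpose_nonsing_inv,
    ← Matrix.transpose_mul, Matrix.trace_transpose, Matrix.trace_mul_comm K]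
  ring

namespace SmoothMetric

variable {N : ℕ} {M : Type*} [TopologicalSpace M]
  [ChartedSpace (EuclideanSpace ℝ (Fin N)) M] [IsManifold (𝓡 N) ∞ M]

/-- The Jacobian matrix of the change of coordinates from the chart at `c` to the chart at `d`. -/
def transJac (c d : M) (z : EuclideanSpace ℝ (Fin N)) : Matrix (Fin N) (Fin N) ℝ :=
  Matrix.of fun i k => partialDeriv k
    (fun z => extChartAt (𝓡 N) d ((extChartAt (𝓡 N) c).symm z) i) z

theorem contDiffAt_trans {c d : M} {z : EuclideanSpace ℝ (Fin N)} (hz : z ∈ (extChartAt (𝓡 N) c).target)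
    (hd : (extChartAt (𝓡 N) c).symm z ∈ (extChartAt (𝓡 N) d).source) (n : ℕ) :
    ContDiffAt ℝ n (fun z => extChartAt (𝓡 N) d ((extChartAt (𝓡 N) c).symm z)) z := by
  have : IsManifold (𝓡 N) (n : ℕ∞ω) M := IsManifold.of_le (n := ∞) (by exact_mod_cast le_top)
  have h := contDiffWithinAt_ext_coord_change (I := 𝓡 N) (n := n) d c (y := z) (by
    rw [PartialEquiv.trans_source]; exact ⟨hz, hd⟩)
  rwa [ModelWithCorners.range_eq_univ, contDiffWithinAt_univ] at h

theorem trans_mem_nhds {c d : M} {z : EuclideanSpace ℝ (Fin N)} (hz : z ∈ (extChartAt (𝓡 N) c).target)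
    (hd : (extChartAt (𝓡 N) c).symm z ∈ (extChartAt (𝓡 N) d).source) :
    ∀ᶠ w in 𝓝 z, w ∈ (extChartAt (𝓡 N) c).target ∧
      (extChartAt (𝓡 N) c).symm w ∈ (extChartAt (𝓡 N) d).source := by
  refine Filter.Eventually.and ((isOpen_target c).mem_nhds hz) ?_
  exact ((continuousAt_extChartAt_symm'' hz).preimage_mem_nhds
    ((isOpen_extChartAt_source d).mem_nhds hd))

theorem coordComp_trans {c d : M} {z : EuclideanSpace ℝ (Fin N)} (hz : z ∈ (extChartAt (𝓡 N) c).target)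
    (hd : (extChartAt (𝓡 N) c).symm z ∈ (extChartAt (𝓡 N) d).source)
    (X : ∀ x : M, TangentSpace (𝓡 N) x) (i : Fin N) :
    coordComp d X i (extChartAt (𝓡 N) d ((extChartAt (𝓡 N) c).symm z)) =
      ∑ k, transJac c d z i k * coordComp c X k z := by
  have hd' : (extChartAt (𝓡 N) c).symm z ∈ (chartAt (EuclideanSpace ℝ (Fin N)) d).source := by
    rwa [extChartAt_source] at hd
  have hcomp : HasMFDerivAt (𝓡 N) (𝓡 N) (extChartAt (𝓡 N) d ∘ (extChartAt (𝓡 N) c).symm) z _ :=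
    (mdifferentiableAt_extChartAt (I := 𝓡 N) hd').hasMFDerivAt.comp z (hasMFDerivAt_extChartAt_symm hz)
  have hF := hcomp.hasFDerivAt
  have hJ : ∀ k, transJac c d z i k = (EuclideanSpace.proj (𝕜 := ℝ) i)
    (mfderiv (𝓡 N) (𝓡 N) (extChartAt (𝓡 N) d) ((extChartAt (𝓡 N) c).symm z) (coordVec c k z) : EuclideanSpace ℝ (Fin N)) := by
    intro k
    have h2 := ((EuclideanSpace.proj (𝕜 := ℝ) i : EuclideanSpace ℝ (Fin N) →L[ℝ] ℝ).hasFDerivAt).comp z hF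
    rw [transJac, Matrix.of_apply, partialDeriv]
    erw [h2.fderiv]
    rfl
  rw [coordComp, (extChartAt (𝓡 N) d).left_inv hd, ← sum_coordComp_smul_coordVec hz X]
  simp only [hJ]
  let L : TangentSpace (𝓡 N) ((extChartAt (𝓡 N) c).symm z) →L[ℝ] ℝ := (EuclideanSpace.proj (𝕜 := ℝ) i).comp
    (mfderiv (𝓡 N) (𝓡 N) (extChartAt (𝓡 N) d) ((extChartAt (𝓡 N) c).symm z) :
      TangentSpace (𝓡 N) ((extChartAt (𝓡 N) c).symm z) →L[ℝ] EuclideanSpace ℝ (Fin N))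
  change L (∑ k, coordComp c X k z • coordVec c k z) = ∑ k, L (coordVec c k z) * coordComp c X k z
  rw [map_sum]
  refine Finset.sum_congr rfl fun k _ => ?_
  rw [map_smul, smul_eq_mul, mul_comm]

theorem gram_trans (g : SmoothMetric N M) {c d : M} {z : EuclideanSpace ℝ (Fin N)} (hz : z ∈ (extChartAt (𝓡 N) c).target)
    (hd : (extChartAt (𝓡 N) c).symm z ∈ (extChartAt (𝓡 N) d).source) :
    gram g c z = (transJac c d z).transpose *
      gram g d (extChartAt (𝓡 N) d ((extChartAt (𝓡 N) c).symm z)) * transJac c d z := by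
  ext k l
  have hy := (extChartAt (𝓡 N) d).map_source hd
  have h := inner_eq_sum g hy (constField c (EuclideanSpace.single k 1)) (constField c (EuclideanSpace.single l 1))
  rw [(extChartAt (𝓡 N) d).left_inv hd, ← coordVec_eq_constField hz, ← coordVec_eq_constField hz] at h
  have hc : ∀ k i, coordComp d (constField c (EuclideanSpace.single k 1)) i
      (extChartAt (𝓡 N) d ((extChartAt (𝓡 N) c).symm z)) = transJac c d z i k := by
    intro k i
    rw [coordComp_trans hz hd, Finset.sum_eq_single k]
    · simp [coordComp_constField hz]
    · intro j _ hj
      simp [coordComp_constField hz, hj]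
    · simp
  rw [gram, Matrix.of_apply, h]
  simp only [hc, Matrix.mul_apply, Matrix.transpose_apply, Finset.sum_mul]
  rw [Finset.sum_comm]
  refine Finset.sum_congr rfl fun j _ => Finset.sum_congr rfl fun i _ => ?_
  ring

theorem det_transJac_ne_zero (g : SmoothMetric N M) {c d : M} {z : EuclideanSpace ℝ (Fin N)} (hz : z ∈ (extChartAt (𝓡 N) c).target)
    (hd : (extChartAt (𝓡 N) c).symm z ∈ (extChartAt (𝓡 N) d).source) : (transJac c d z).det ≠ 0 := by
  intro h
  have := det_gram_pos g hz
  rw [gram_trans g hz hd, Matrix.det_mul, h, mul_zero] at this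
  exact lt_irrefl _ this

theorem volDensity_trans (g : SmoothMetric N M) {c d : M} {z : EuclideanSpace ℝ (Fin N)} (hz : z ∈ (extChartAt (𝓡 N) c).target)
    (hd : (extChartAt (𝓡 N) c).symm z ∈ (extChartAt (𝓡 N) d).source) :
    volDensity g c z = |(transJac c d z).det| *
      volDensity g d (extChartAt (𝓡 N) d ((extChartAt (𝓡 N) c).symm z)) := by
  rw [volDensity, gram_trans g hz hd, Matrix.det_mul, Matrix.det_mul, Matrix.det_transpose, volDensity,
    ← Real.sqrt_sq_eq_abs, ← Real.sqrt_mul (sq_nonneg _)]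
  congr 1
  ring

/-- The divergence of a vector field, computed in the chart at `c`. -/
def coordDiv (g : SmoothMetric N M) (c : M) (X : ∀ x : M, TangentSpace (𝓡 N) x)
    (y : EuclideanSpace ℝ (Fin N)) : ℝ :=
  (volDensity g c y)⁻¹ * ∑ i, partialDeriv i (fun y => volDensity g c y * coordComp c X i y) y

theorem coordDiv_eq (g : SmoothMetric N M) {c : M} {y : EuclideanSpace ℝ (Fin N)}
    (hy : y ∈ (extChartAt (𝓡 N) c).target) {X : ∀ x : M, TangentSpace (𝓡 N) x}
    (hX : ∀ i, DifferentiableAt ℝ (coordComp c X i) y) :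
    coordDiv g c X y = ∑ i, partialDeriv i (coordComp c X i) y +
      ∑ m, coordComp c X m y * ∑ k, christoffel g c k k m y := by
  have h0 := (volDensity_pos g hy).ne'
  have hd := (contDiffAt_volDensity g hy 1).differentiableAt one_ne_zero
  rw [coordDiv, Finset.mul_sum, ← Finset.sum_add_distrib]
  refine Finset.sum_congr rfl fun i _ => ?_
  rw [partialDeriv_mul hd (hX i), partialDeriv_volDensity_eq_christoffel g hy]
  field_simp
  ring

theorem matrixDeriv_gram_trans (g : SmoothMetric N M) {c d : M} {z : EuclideanSpace ℝ (Fin N)} (hz : z ∈ (extChartAt (𝓡 N) c).target)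
    (hd : (extChartAt (𝓡 N) c).symm z ∈ (extChartAt (𝓡 N) d).source) (m : Fin N) :
    matrixDeriv m (gram g c) z =
      ((matrixDeriv m (transJac c d) z).transpose * gram g d (extChartAt (𝓡 N) d ((extChartAt (𝓡 N) c).symm z)) +
        (transJac c d z).transpose * ∑ p, transJac c d z p m •
          matrixDeriv p (gram g d) (extChartAt (𝓡 N) d ((extChartAt (𝓡 N) c).symm z))) * transJac c d z +
      (transJac c d z).transpose * gram g d (extChartAt (𝓡 N) d ((extChartAt (𝓡 N) c).symm z)) *
        matrixDeriv m (transJac c d) z := by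
  have hy := (extChartAt (𝓡 N) d).map_source hd
  have hψ := (contDiffAt_trans hz hd 1).differentiableAt one_ne_zero
  have hJ : ∀ i k, DifferentiableAt ℝ (fun z => transJac c d z i k) z := fun i k =>
    (ContDiffAt.partialDeriv (n := 1) (contDiffAt_euclidean.1 (contDiffAt_trans hz hd 2) i) k).differentiableAt one_ne_zero
  have hG : ∀ i j, DifferentiableAt ℝ
      (fun z => gram g d (extChartAt (𝓡 N) d ((extChartAt (𝓡 N) c).symm z)) i j) z := fun i j =>
    DifferentiableAt.comp (g := fun y => gram g d y i j) z (differentiableAt_gram g hy i j) hψ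
  have h1 : matrixDeriv m (gram g c) z = matrixDeriv m (fun z => (transJac c d z).transpose *
      gram g d (extChartAt (𝓡 N) d ((extChartAt (𝓡 N) c).symm z)) * transJac c d z) z := by
    ext i j
    refine Filter.EventuallyEq.partialDeriv_eq ?_ m
    filter_upwards [trans_mem_nhds hz hd] with w hw
    rw [gram_trans g hw.1 hw.2]
  have h2 : matrixDeriv m (fun z => gram g d (extChartAt (𝓡 N) d ((extChartAt (𝓡 N) c).symm z))) z =
      ∑ p, transJac c d z p m • matrixDeriv p (gram g d) (extChartAt (𝓡 N) d ((extChartAt (𝓡 N) c).symm z)) := by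
    ext i j
    rw [Matrix.sum_apply]
    refine (partialDeriv_comp (differentiableAt_gram g hy i j) hψ m).trans (Finset.sum_congr rfl fun p _ => ?_)
    rw [mul_comm]
    rfl
  rw [h1, matrixDeriv_mul m (fun i j => ?_) hJ, matrixDeriv_mul (A := fun z => (transJac c d z).transpose) m (fun i j => hJ j i) hG, h2]
  · rfl
  · simp only [Matrix.mul_apply]
    exact DifferentiableAt.fun_sum fun k _ => (hJ k i).fun_mul (hG k j)

/-- Differentiate the transformation law `X' ∘ ψ = J X`, multiply by `J⁻¹` and take the trace. The
symmetry of the second derivatives of `ψ` turns the terms with derivatives of `J` into the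
logarithmic derivative of `det J`. -/
theorem sum_partialDeriv_coordComp_trans (g : SmoothMetric N M) {c d : M} {z : EuclideanSpace ℝ (Fin N)} (hz : z ∈ (extChartAt (𝓡 N) c).target)
    (hd : (extChartAt (𝓡 N) c).symm z ∈ (extChartAt (𝓡 N) d).source) {X : ∀ x : M, TangentSpace (𝓡 N) x}
    (hX : ∀ i, DifferentiableAt ℝ (coordComp c X i) z)
    (hX' : ∀ i, DifferentiableAt ℝ (coordComp d X i) (extChartAt (𝓡 N) d ((extChartAt (𝓡 N) c).symm z))) :
    ∑ i, partialDeriv i (coordComp d X i) (extChartAt (𝓡 N) d ((extChartAt (𝓡 N) c).symm z)) =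
      ∑ i, partialDeriv i (coordComp c X i) z +
        ∑ m, coordComp c X m z * ((transJac c d z)⁻¹ * matrixDeriv m (transJac c d) z).trace := by
  have hψ := (contDiffAt_trans hz hd 1).differentiableAt one_ne_zero
  have hJ2 : ∀ i, ContDiffAt ℝ 2 (fun z => extChartAt (𝓡 N) d ((extChartAt (𝓡 N) c).symm z) i) z :=
    fun i => contDiffAt_euclidean.1 (contDiffAt_trans hz hd 2) i
  have hJ : ∀ i k, DifferentiableAt ℝ (fun z => transJac c d z i k) z := fun i k =>
    (ContDiffAt.partialDeriv (n := 1) (hJ2 i) k).differentiableAt one_ne_zero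
  have hu : IsUnit (transJac c d z).det := isUnit_iff_ne_zero.2 (det_transJac_ne_zero g hz hd)
  set J := transJac c d z with hJdef
  let DX' : Matrix (Fin N) (Fin N) ℝ := Matrix.of fun i p =>
    partialDeriv p (coordComp d X i) (extChartAt (𝓡 N) d ((extChartAt (𝓡 N) c).symm z))
  let DX : Matrix (Fin N) (Fin N) ℝ := Matrix.of fun i p => partialDeriv p (coordComp c X i) z
  let Q : Matrix (Fin N) (Fin N) ℝ := Matrix.of fun i m =>
    ∑ k, partialDeriv m (fun z => transJac c d z i k) z * coordComp c X k z
  have key : DX' * J = Q + J * DX := by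
    ext i m
    have h1 := partialDeriv_comp (hX' i) hψ m
    rw [Filter.EventuallyEq.partialDeriv_eq (h := fun w => ∑ k, transJac c d w i k * coordComp c X k w) (by
      filter_upwards [trans_mem_nhds hz hd] with w hw
      exact coordComp_trans hw.1 hw.2 X i), partialDeriv_sum fun k => (hJ i k).fun_mul (hX k)] at h1
    rw [Matrix.mul_apply, Matrix.add_apply, Matrix.mul_apply]
    refine Eq.trans h1.symm ?_
    simp only [Q, Matrix.of_apply, DX, ← Finset.sum_add_distrib]
    exact Finset.sum_congr rfl fun k _ => partialDeriv_mul (hJ i k) (hX k) m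
  have ht : DX'.trace = (J⁻¹ * Q).trace + DX.trace := by
    have := congrArg (fun A => (J⁻¹ * A).trace) key
    simp only [Matrix.mul_add, Matrix.trace_add] at this
    rwa [Matrix.trace_mul_comm, Matrix.mul_assoc, Matrix.mul_nonsing_inv _ hu, Matrix.mul_one, ← Matrix.mul_assoc,
      Matrix.nonsing_inv_mul _ hu, Matrix.one_mul] at this
  have hQ : (J⁻¹ * Q).trace = ∑ m, coordComp c X m z * (J⁻¹ * matrixDeriv m (transJac c d) z).trace := by
    simp only [Matrix.trace, Matrix.diag, Matrix.mul_apply, Q, Matrix.of_apply, Finset.mul_sum, matrixDeriv]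
    have hsym : ∀ i k m, partialDeriv m (fun z => transJac c d z i k) z = partialDeriv k (fun z => transJac c d z i m) z :=
      fun i k m => partialDeriv_comm (hJ2 i) m k
    rw [Finset.sum_comm (f := fun m a => ∑ i, coordComp c X m z * (J⁻¹ a i * partialDeriv m (fun z => transJac c d z i a) z))]
    refine Finset.sum_congr rfl fun a _ => ?_
    rw [Finset.sum_comm (f := fun m i => coordComp c X m z * (J⁻¹ a i * partialDeriv m (fun z => transJac c d z i a) z))]
    refine Finset.sum_congr rfl fun i _ => Finset.sum_congr rfl fun k _ => ?_
    rw [hsym i k a]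
    ring
  rw [hQ] at ht
  rw [add_comm]
  exact ht

/-- The sum of the `∂ᵢ Xⁱ` is not invariant: it gains `tr (J⁻¹ ∂J)`. The contracted Christoffel
symbol loses exactly this term, since the volume densities of the charts differ by the factor `|det
J|`. -/
theorem coordDiv_trans (g : SmoothMetric N M) {c d : M} {z : EuclideanSpace ℝ (Fin N)} (hz : z ∈ (extChartAt (𝓡 N) c).target)
    (hd : (extChartAt (𝓡 N) c).symm z ∈ (extChartAt (𝓡 N) d).source) {X : ∀ x : M, TangentSpace (𝓡 N) x}
    (hX : ContMDiffAt (𝓡 N) (𝓡 N).tangent 1 (fun x => (⟨x, X x⟩ : TangentBundle (𝓡 N) M)) ((extChartAt (𝓡 N) c).symm z)) :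
    coordDiv g d X (extChartAt (𝓡 N) d ((extChartAt (𝓡 N) c).symm z)) = coordDiv g c X z := by
  have hy := (extChartAt (𝓡 N) d).map_source hd
  have hXc : ∀ i, DifferentiableAt ℝ (coordComp c X i) z := fun i => by
    have := (contMDiffAt_field_iff ((extChartAt (𝓡 N) c).map_target hz) X 1).1 hX i
    rw [(extChartAt (𝓡 N) c).right_inv hz] at this
    exact this.differentiableAt one_ne_zero
  have hXd : ∀ i, DifferentiableAt ℝ (coordComp d X i) (extChartAt (𝓡 N) d ((extChartAt (𝓡 N) c).symm z)) := fun i =>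
    ((contMDiffAt_field_iff hd X 1).1 hX i).differentiableAt one_ne_zero
  rw [coordDiv_eq g hz hXc, coordDiv_eq g hy hXd, sum_partialDeriv_coordComp_trans g hz hd hXc hXd, add_assoc]
  congr 1
  have htr : ∀ (c : M) (y : EuclideanSpace ℝ (Fin N)) m, ∑ k, christoffel g c k k m y =
      (1 / 2) * ((gram g c y)⁻¹ * matrixDeriv m (gram g c) y).trace := fun c y m => sum_christoffel g c y m
  have h2 : ∀ m, ((gram g c z)⁻¹ * matrixDeriv m (gram g c) z).trace = 2 * ((transJac c d z)⁻¹ * matrixDeriv m (transJac c d) z).trace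
      + ∑ p, transJac c d z p m * ((gram g d (extChartAt (𝓡 N) d ((extChartAt (𝓡 N) c).symm z)))⁻¹ *
        matrixDeriv p (gram g d) (extChartAt (𝓡 N) d ((extChartAt (𝓡 N) c).symm z))).trace := by
    intro m
    rw [matrixDeriv_gram_trans g hz hd, gram_trans g hz hd, trace_inv_mul_conj
      (isUnit_iff_ne_zero.2 (det_transJac_ne_zero g hz hd)) (isUnit_iff_ne_zero.2 (det_gram_pos g hy).ne'),
      Finset.mul_sum, Matrix.trace_sum]
    congr 1
    refine Finset.sum_congr rfl fun p _ => ?_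
    rw [Matrix.mul_smul, Matrix.trace_smul, smul_eq_mul]
  simp only [htr, h2, coordComp_trans hz hd]
  simp only [mul_add, Finset.mul_sum, Finset.sum_mul, Finset.sum_add_distrib]
  congr 1
  · refine Finset.sum_congr rfl fun p _ => ?_
    ring
  · rw [Finset.sum_comm]
    refine Finset.sum_congr rfl fun p _ => Finset.sum_congr rfl fun m _ => ?_
    ring

/-- The definition computes the divergence at each point in a chart that depends on the point. Here
one fixed chart serves a whole neighbourhood, as continuity and integration require. -/
theorem divergence_eq_coordDiv (g : SmoothMetric N M) {c x : M} (hx : x ∈ (extChartAt (𝓡 N) c).source)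
    {X : ∀ x : M, TangentSpace (𝓡 N) x}
    (hX : ContMDiffAt (𝓡 N) (𝓡 N).tangent 1 (fun x => (⟨x, X x⟩ : TangentBundle (𝓡 N) M)) x) :
    g.divergence X x = coordDiv g c X (extChartAt (𝓡 N) c x) := by
  have hz := (extChartAt (𝓡 N) c).map_source hx
  have hd : (extChartAt (𝓡 N) c).symm (extChartAt (𝓡 N) c x) ∈ (extChartAt (𝓡 N) x).source := by
    rw [(extChartAt (𝓡 N) c).left_inv hx]; exact mem_extChartAt_source x
  rw [← coordDiv_trans g hz hd (by rwa [(extChartAt (𝓡 N) c).left_inv hx]), (extChartAt (𝓡 N) c).left_inv hx]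
  rfl

theorem fderiv_trans_det {c d : M} {z : EuclideanSpace ℝ (Fin N)} (hz : z ∈ (extChartAt (𝓡 N) c).target)
    (hd : (extChartAt (𝓡 N) c).symm z ∈ (extChartAt (𝓡 N) d).source) :
    (fderiv ℝ (fun z => extChartAt (𝓡 N) d ((extChartAt (𝓡 N) c).symm z)) z).det = (transJac c d z).det := by
  have hψ := (contDiffAt_trans hz hd 1).differentiableAt one_ne_zero
  rw [ContinuousLinearMap.det, ← LinearMap.det_toMatrix (EuclideanSpace.basisFun (Fin N) ℝ).toBasis]
  congr 1
  ext i k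
  have := ((EuclideanSpace.proj (𝕜 := ℝ) i : EuclideanSpace ℝ (Fin N) →L[ℝ] ℝ).hasFDerivAt).comp z hψ.hasFDerivAt
  rw [LinearMap.toMatrix_apply, transJac, Matrix.of_apply, partialDeriv,
    show (fun z => extChartAt (𝓡 N) d ((extChartAt (𝓡 N) c).symm z) i) =
      (EuclideanSpace.proj (𝕜 := ℝ) i : EuclideanSpace ℝ (Fin N) →L[ℝ] ℝ) ∘
      (fun z => extChartAt (𝓡 N) d ((extChartAt (𝓡 N) c).symm z)) from rfl, this.fderiv]
  simp

/-! ### The Riemannian volume measure in charts -/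

section Volume

variable [MeasurableSpace M] [BorelSpace M]

theorem measurableSet_target_inter_preimage (c : M) {B : Set M} (hB : MeasurableSet B) :
    MeasurableSet ((extChartAt (𝓡 N) c).target ∩ (extChartAt (𝓡 N) c).symm ⁻¹' B) := by
  classical
  have hm : Measurable ((extChartAt (𝓡 N) c).target.piecewise (extChartAt (𝓡 N) c).symm (fun _ => c)) :=
    ContinuousOn.measurable_piecewise (continuousOn_extChartAt_symm c) continuousOn_const
      (isOpen_target c).measurableSet
  convert (isOpen_target (N := N) c).measurableSet.inter (hm hB) using 1
  ext y
  constructor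
  · rintro ⟨h1, h2⟩
    exact ⟨h1, by rwa [Set.mem_preimage, Set.piecewise_eq_of_mem _ _ _ h1] at *⟩
  · rintro ⟨h1, h2⟩
    exact ⟨h1, by rwa [Set.mem_preimage, Set.piecewise_eq_of_mem _ _ _ h1] at *⟩

theorem aemeasurable_extChartAt_symm (g : SmoothMetric N M) (c : M) :
    AEMeasurable (extChartAt (𝓡 N) c).symm
      ((volume.withDensity fun y => ENNReal.ofReal (g.volDensity c y)).restrict (extChartAt (𝓡 N) c).target) :=
  (continuousOn_extChartAt_symm c).aemeasurable (isOpen_target c).measurableSet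

theorem chartVolume_apply (g : SmoothMetric N M) (c : M) {B : Set M} (hB : MeasurableSet B) :
    g.chartVolume c B = ∫⁻ y in (extChartAt (𝓡 N) c).target ∩ (extChartAt (𝓡 N) c).symm ⁻¹' B,
      ENNReal.ofReal (g.volDensity c y) := by
  rw [chartVolume, Measure.map_apply_of_aemeasurable (aemeasurable_extChartAt_symm g c) hB,
    Measure.restrict_apply' (isOpen_target c).measurableSet, withDensity_apply', Set.inter_comm]

/-- Change of variables for the transition map: its Jacobian determinant is absorbed by the
transformation law of the densities. -/
theorem chartVolume_eq_of_subset (g : SmoothMetric N M) {c d : M} {B : Set M} (hB : MeasurableSet B)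
    (hc : B ⊆ (extChartAt (𝓡 N) c).source) (hd : B ⊆ (extChartAt (𝓡 N) d).source) :
    g.chartVolume c B = g.chartVolume d B := by
  rw [chartVolume_apply g c hB, chartVolume_apply g d hB]
  set s := (extChartAt (𝓡 N) c).target ∩ (extChartAt (𝓡 N) c).symm ⁻¹' B with hs
  have hsd : ∀ z ∈ s, (extChartAt (𝓡 N) c).symm z ∈ (extChartAt (𝓡 N) d).source := fun z hz => hd hz.2
  have him : (fun z => extChartAt (𝓡 N) d ((extChartAt (𝓡 N) c).symm z)) '' s =
      (extChartAt (𝓡 N) d).target ∩ (extChartAt (𝓡 N) d).symm ⁻¹' B := by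
    ext w
    constructor
    · rintro ⟨z, hz, rfl⟩
      refine ⟨(extChartAt (𝓡 N) d).map_source (hsd z hz), ?_⟩
      rw [Set.mem_preimage, (extChartAt (𝓡 N) d).left_inv (hsd z hz)]
      exact hz.2
    · rintro ⟨h1, h2⟩
      refine ⟨extChartAt (𝓡 N) c ((extChartAt (𝓡 N) d).symm w), ⟨(extChartAt (𝓡 N) c).map_source (hc h2), ?_⟩, ?_⟩
      · rw [Set.mem_preimage, (extChartAt (𝓡 N) c).left_inv (hc h2)]; exact h2
      · simp only [(extChartAt (𝓡 N) c).left_inv (hc h2), (extChartAt (𝓡 N) d).right_inv h1]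
  have hinj : Set.InjOn (fun z => extChartAt (𝓡 N) d ((extChartAt (𝓡 N) c).symm z)) s := by
    intro z hz w hw h
    have := (extChartAt (𝓡 N) d).injOn (hsd z hz) (hsd w hw) h
    exact (extChartAt (𝓡 N) c).symm.injOn hz.1 hw.1 this
  rw [← him, lintegral_image_eq_lintegral_abs_det_fderiv_mul volume
    (measurableSet_target_inter_preimage c hB)
    (fun z hz => ((contDiffAt_trans hz.1 (hsd z hz) 1).differentiableAt one_ne_zero).hasFDerivAt.hasFDerivWithinAt) hinj]
  refine setLIntegral_congr_fun (measurableSet_target_inter_preimage c hB) fun z hz => ?_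
  rw [fderiv_trans_det hz.1 (hsd z hz), ← ENNReal.ofReal_mul (abs_nonneg _), volDensity_trans g hz.1 (hsd z hz)]

theorem chartVolume_inter_source (g : SmoothMetric N M) (c : M) {B : Set M} (hB : MeasurableSet B) :
    g.chartVolume c (B ∩ (extChartAt (𝓡 N) c).source) = g.chartVolume c B := by
  rw [chartVolume_apply g c hB, chartVolume_apply g c (hB.inter (isOpen_extChartAt_source c).measurableSet)]
  congr 2
  ext y
  simp only [Set.mem_inter_iff, Set.mem_preimage]
  exact ⟨fun h => ⟨h.1, h.2.1⟩, fun h => ⟨h.1, h.2, (extChartAt (𝓡 N) c).map_target h.1⟩⟩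

/-- The supremum of the chart measures could a priori exceed each of them. The upper bound comes
from one measure that dominates all chart measures and agrees with each of them on its chart domain.
-/
theorem vol_eq_chartVolume [CompactSpace M] (g : SmoothMetric N M) {c : M} {B : Set M} (hB : MeasurableSet B)
    (hc : B ⊆ (extChartAt (𝓡 N) c).source) : g.vol B = g.chartVolume c B := by
  refine le_antisymm ?_ (Measure.le_iff'.1 (le_iSup g.chartVolume c) B)
  obtain ⟨t, -, ht⟩ := isCompact_univ.elim_nhds_subcover (fun x : M => (extChartAt (𝓡 N) x).source)
    (fun x _ => extChartAt_source_mem_nhds x)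
  have hne : (t : Set M).Nonempty := by
    obtain ⟨x, hx, -⟩ := Set.mem_iUnion₂.1 (ht (Set.mem_univ c))
    exact ⟨x, hx⟩
  obtain ⟨e, he⟩ := t.countable_toSet.exists_eq_range hne
  let D : ℕ → Set M := disjointed fun n => (extChartAt (𝓡 N) (e n)).source
  have hDm : ∀ n, MeasurableSet (D n) := MeasurableSet.disjointed fun n => (isOpen_extChartAt_source (e n)).measurableSet
  have hDs : ∀ n, D n ⊆ (extChartAt (𝓡 N) (e n)).source := disjointed_subset _
  have hDd : Pairwise (Function.onFun Disjoint D) := disjoint_disjointed _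
  have hDU : ⋃ n, D n = Set.univ := by
    rw [iUnion_disjointed]
    refine Set.eq_univ_of_forall fun x => ?_
    obtain ⟨y, hy, hxy⟩ := Set.mem_iUnion₂.1 (ht (Set.mem_univ x))
    have : y ∈ (t : Set M) := hy
    rw [he] at this
    obtain ⟨n, rfl⟩ := this
    exact Set.mem_iUnion.2 ⟨n, hxy⟩
  -- The dominating measure: split `M` into disjoint pieces, each inside one chart domain, and use
  -- the measure of that chart on its piece. By agreement on overlaps it restricts to every chart
  -- measure.
  let ν : Measure M := Measure.sum fun n => (g.chartVolume (e n)).restrict (D n)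
  have hν : ∀ (d : M) {B : Set M}, MeasurableSet B → ν (B ∩ (extChartAt (𝓡 N) d).source) = g.chartVolume d B := by
    intro d B hB
    have hB' : MeasurableSet (B ∩ (extChartAt (𝓡 N) d).source) := hB.inter (isOpen_extChartAt_source d).measurableSet
    rw [← chartVolume_inter_source g d hB, Measure.sum_apply _ hB']
    have h1 : B ∩ (extChartAt (𝓡 N) d).source = ⋃ n, (B ∩ (extChartAt (𝓡 N) d).source) ∩ D n := by
      rw [← Set.inter_iUnion, hDU, Set.inter_univ]
    conv_rhs => rw [h1]
    rw [measure_iUnion (fun i j hij => (hDd hij).mono Set.inter_subset_right Set.inter_subset_right)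
      (fun n => hB'.inter (hDm n))]
    refine tsum_congr fun n => ?_
    rw [Measure.restrict_apply hB', chartVolume_eq_of_subset g (hB'.inter (hDm n))
      (Set.inter_subset_right.trans (hDs n)) (Set.inter_subset_left.trans Set.inter_subset_right)]
  have hle : g.vol ≤ ν := by
    refine iSup_le fun d => Measure.le_iff.2 fun B hB => ?_
    rw [← hν d hB]
    exact measure_mono Set.inter_subset_left
  calc g.vol B ≤ ν B := hle B
    _ = g.chartVolume c B := by rw [← hν c hB, Set.inter_eq_left.2 hc]

theorem vol_restrict_source [CompactSpace M] (g : SmoothMetric N M) (c : M) :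
    g.vol.restrict (extChartAt (𝓡 N) c).source = g.chartVolume c := by
  ext B hB
  rw [Measure.restrict_apply hB, vol_eq_chartVolume g (hB.inter (isOpen_extChartAt_source c).measurableSet)
    Set.inter_subset_right, chartVolume_inter_source g c hB]

theorem integral_vol_eq [CompactSpace M] (g : SmoothMetric N M) (c : M) {f : M → ℝ}
    (hf : AEStronglyMeasurable f g.vol) (h0 : ∀ x ∉ (extChartAt (𝓡 N) c).source, f x = 0) :
    ∫ x, f x ∂g.vol = ∫ y in (extChartAt (𝓡 N) c).target,
      g.volDensity c y * f ((extChartAt (𝓡 N) c).symm y) := by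
  rw [← setIntegral_eq_integral_of_forall_compl_eq_zero h0, vol_restrict_source, chartVolume, integral_map
    (aemeasurable_extChartAt_symm g c)]
  · have hd : AEMeasurable (fun y => Real.toNNReal (g.volDensity c y)) (volume.restrict (extChartAt (𝓡 N) c).target) := by
      refine AEMeasurable.real_toNNReal (ContinuousOn.aemeasurable (fun y hy => ?_) (isOpen_target c).measurableSet)
      exact (contDiffAt_volDensity g hy 0).continuousAt.continuousWithinAt
    rw [restrict_withDensity (isOpen_target c).measurableSet]
    have := integral_withDensity_eq_integral_smul₀ hd (fun y => f ((extChartAt (𝓡 N) c).symm y))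
    refine this.trans (setIntegral_congr_fun (isOpen_target c).measurableSet fun y hy => ?_)
    simp only [NNReal.smul_def, smul_eq_mul, Real.coe_toNNReal _ (volDensity_pos g hy).le]
  · have := hf.mono_measure (Measure.restrict_le_self (s := (extChartAt (𝓡 N) c).source))
    rwa [vol_restrict_source] at this

/-- Used twice: `Ω` has positive volume, and a set cannot be both null and conull near the same
point. -/
instance isOpenPosMeasure_vol (g : SmoothMetric N M) : g.vol.IsOpenPosMeasure := by
  refine ⟨fun U hU hne h0 => ?_⟩
  obtain ⟨x, hx⟩ := hne
  have h1 : g.chartVolume x U = 0 := le_antisymm ((Measure.le_iff'.1 (le_iSup g.chartVolume x) U).trans h0.le) zero_le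
  rw [chartVolume_apply g x hU.measurableSet] at h1
  have hopen : IsOpen ((extChartAt (𝓡 N) x).target ∩ (extChartAt (𝓡 N) x).symm ⁻¹' U) :=
    (continuousOn_extChartAt_symm x).isOpen_inter_preimage (isOpen_target x) hU
  have hm : AEMeasurable (fun y => ENNReal.ofReal (g.volDensity x y))
      (volume.restrict ((extChartAt (𝓡 N) x).target ∩ (extChartAt (𝓡 N) x).symm ⁻¹' U)) := by
    refine AEMeasurable.ennreal_ofReal (ContinuousOn.aemeasurable (fun y hy => ?_) hopen.measurableSet)
    exact (contDiffAt_volDensity g hy.1 0).continuousAt.continuousWithinAt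
  rw [setLIntegral_eq_zero_iff' hopen.measurableSet hm] at h1
  have hpos : volume ((extChartAt (𝓡 N) x).target ∩ (extChartAt (𝓡 N) x).symm ⁻¹' U) ≠ 0 :=
    (hopen.measure_pos volume ⟨extChartAt (𝓡 N) x x, mem_extChartAt_target x, by
      rwa [Set.mem_preimage, extChartAt_to_inv]⟩).ne'
  refine hpos (measure_mono_null (fun y hy => ?_) h1)
  simp only [Set.mem_compl_iff, Set.mem_ofPred_eq]
  exact fun h => (ENNReal.ofReal_pos.2 (volDensity_pos g hy.1)).ne' (h hy)

instance isLocallyFiniteMeasure_vol [CompactSpace M] (g : SmoothMetric N M) : IsLocallyFiniteMeasure g.vol := by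
  refine ⟨fun x => ?_⟩
  obtain ⟨r, hr, hrs⟩ := Metric.nhds_basis_closedBall.mem_iff.1
    ((isOpen_target x).mem_nhds (mem_extChartAt_target (I := 𝓡 N) x))
  have hU : (extChartAt (𝓡 N) x).source ∩ extChartAt (𝓡 N) x ⁻¹' Metric.ball (extChartAt (𝓡 N) x x) r ∈ 𝓝 x :=
    Filter.inter_mem (extChartAt_source_mem_nhds x)
      ((continuousAt_extChartAt x).preimage_mem_nhds (Metric.ball_mem_nhds _ hr))
  have hopen : IsOpen ((extChartAt (𝓡 N) x).source ∩ extChartAt (𝓡 N) x ⁻¹' Metric.ball (extChartAt (𝓡 N) x x) r) :=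
    (continuousOn_extChartAt x).isOpen_inter_preimage (isOpen_extChartAt_source x) Metric.isOpen_ball
  refine ⟨_, hU, ?_⟩
  rw [vol_eq_chartVolume g hopen.measurableSet Set.inter_subset_left, chartVolume_apply g x hopen.measurableSet]
  have hsub : (extChartAt (𝓡 N) x).target ∩ (extChartAt (𝓡 N) x).symm ⁻¹'
      ((extChartAt (𝓡 N) x).source ∩ extChartAt (𝓡 N) x ⁻¹' Metric.ball (extChartAt (𝓡 N) x x) r) ⊆
      Metric.closedBall (extChartAt (𝓡 N) x x) r := by
    rintro y ⟨h1, h2, h3⟩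
    rw [Set.mem_preimage, (extChartAt (𝓡 N) x).right_inv h1] at h3
    exact Metric.ball_subset_closedBall h3
  refine (lintegral_mono_set hsub).trans_lt ?_
  have hc : ContinuousOn (g.volDensity x) (Metric.closedBall (extChartAt (𝓡 N) x x) r) := fun y hy =>
    (contDiffAt_volDensity g (hrs hy) 0).continuousAt.continuousWithinAt
  exact Integrable.lintegral_lt_top (hc.integrableOn_compact (isCompact_closedBall _ _))

end Volume

end SmoothMetric

/-! ### Integration by parts in Euclidean space -/

section Euclidean

variable {N : ℕ} {K : Set (EuclideanSpace ℝ (Fin N))} {f h : EuclideanSpace ℝ (Fin N) → ℝ}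

theorem eventuallyEq_zero_of_notMem (hK : IsCompact K) (h0 : ∀ y ∉ K, f y = 0) {y : EuclideanSpace ℝ (Fin N)}
    (hy : y ∉ K) : f =ᶠ[𝓝 y] fun _ => 0 := by
  filter_upwards [hK.isClosed.isOpen_compl.mem_nhds hy] with z hz using h0 z hz

theorem partialDeriv_eq_zero_of_notMem (hK : IsCompact K) (h0 : ∀ y ∉ K, f y = 0) {y : EuclideanSpace ℝ (Fin N)}
    (hy : y ∉ K) (i : Fin N) : partialDeriv i f y = 0 := by
  rw [(eventuallyEq_zero_of_notMem hK h0 hy).partialDeriv_eq]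
  simp [partialDeriv]

theorem contDiff_of_eq_zero_off (hK : IsCompact K) (h0 : ∀ y ∉ K, f y = 0) {n : ℕ∞ω}
    (hf : ∀ y ∈ K, ContDiffAt ℝ n f y) : ContDiff ℝ n f := by
  refine contDiff_iff_contDiffAt.2 fun y => ?_
  by_cases hy : y ∈ K
  · exact hf y hy
  · exact contDiffAt_const.congr_of_eventuallyEq (eventuallyEq_zero_of_notMem hK h0 hy)

theorem integrable_of_continuousOn_compact (hK : IsCompact K) (h0 : ∀ y ∉ K, f y = 0)
    (hf : ContinuousOn f K) : Integrable f :=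
  (integrableOn_iff_integrable_of_support_subset
    (Function.support_subset_iff'.2 h0)).1 (hf.integrableOn_compact hK)

theorem integral_partialDeriv_eq_zero (hK : IsCompact K) (h0 : ∀ y ∉ K, f y = 0)
    (hf : ∀ y ∈ K, ContDiffAt ℝ 1 f y) (i : Fin N) : ∫ y, partialDeriv i f y = 0 := by
  have hc := contDiff_of_eq_zero_off hK h0 hf
  have hI : Integrable f := integrable_of_continuousOn_compact hK h0 hc.continuous.continuousOn
  have hI' : Integrable (fun y => fderiv ℝ f y (EuclideanSpace.single i 1)) :=
    integrable_of_continuousOn_compact hK (fun y hy => partialDeriv_eq_zero_of_notMem hK h0 hy i)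
      ((hc.continuous_fderiv one_ne_zero).clm_apply continuous_const).continuousOn
  have := integral_mul_fderiv_eq_neg_fderiv_mul_of_integrable (μ := volume) (f := fun _ : EuclideanSpace ℝ (Fin N) => (1 : ℝ)) (g := f)
    (v := EuclideanSpace.single i 1) (by simp) (by simpa using hI') (by simpa using hI)
    (fun _ _ => differentiableAt_const _) (fun y _ => hc.differentiable one_ne_zero y)
  simpa [partialDeriv] using this

theorem integral_mul_partialDeriv (hK : IsCompact K) (h0 : ∀ y ∉ K, h y = 0)
    (hh : ContDiff ℝ 1 h) (hf : ∀ y ∈ K, ContDiffAt ℝ 1 f y) (i : Fin N) :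
    ∫ y, f y * partialDeriv i h y = - ∫ y, partialDeriv i f y * h y := by
  have h1 : ∀ y, partialDeriv i (fun y => f y * h y) y = partialDeriv i f y * h y + f y * partialDeriv i h y := by
    intro y
    by_cases hy : y ∈ K
    · exact partialDeriv_mul ((hf y hy).differentiableAt one_ne_zero) (hh.differentiable one_ne_zero y) i
    · rw [partialDeriv_eq_zero_of_notMem hK (fun y hy => by rw [h0 y hy, mul_zero]) hy,
        partialDeriv_eq_zero_of_notMem hK h0 hy, h0 y hy]
      ring
  have h2 := integral_partialDeriv_eq_zero (f := fun y => f y * h y) hK (fun y hy => by rw [h0 y hy, mul_zero])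
    (fun y hy => (hf y hy).mul hh.contDiffAt) i
  have hfc : ContinuousOn f K := fun y hy => (hf y hy).continuousAt.continuousWithinAt
  have hfc' : ContinuousOn (partialDeriv i f) K := fun y hy =>
    (ContDiffAt.partialDeriv (n := 0) (hf y hy) i).continuousAt.continuousWithinAt
  have hhc' : ContinuousOn (partialDeriv i h) K := fun y _ =>
    (ContDiffAt.partialDeriv (n := 0) hh.contDiffAt i).continuousAt.continuousWithinAt
  simp only [h1] at h2
  rw [integral_add] at h2
  · linarith
  · exact integrable_of_continuousOn_compact hK (fun y hy => by rw [h0 y hy, mul_zero]) (hfc'.mul hh.continuous.continuousOn)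
  · exact integrable_of_continuousOn_compact hK
      (fun y hy => by rw [partialDeriv_eq_zero_of_notMem hK h0 hy, mul_zero]) (hfc.mul hhc')

end Euclidean

/-! ### Calculus of `C¹` vector fields and the divergence theorem -/

namespace SmoothMetric

variable {N : ℕ} {M : Type*} [TopologicalSpace M]
  [ChartedSpace (EuclideanSpace ℝ (Fin N)) M] [IsManifold (𝓡 N) ∞ M]

/-- The vector field `X` is `C¹` at `x`. -/
abbrev FieldC1At (X : ∀ x : M, TangentSpace (𝓡 N) x) (x : M) : Prop :=
  ContMDiffAt (𝓡 N) (𝓡 N).tangent 1 (fun x => (⟨x, X x⟩ : TangentBundle (𝓡 N) M)) x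

theorem fieldC1At_iff {c x : M} (hx : x ∈ (extChartAt (𝓡 N) c).source) (X : ∀ x : M, TangentSpace (𝓡 N) x) :
    FieldC1At X x ↔ ∀ i, ContDiffAt ℝ 1 (coordComp c X i) (extChartAt (𝓡 N) c x) :=
  contMDiffAt_field_iff hx X 1

theorem coordComp_smul {c : M} {y : EuclideanSpace ℝ (Fin N)} (hy : y ∈ (extChartAt (𝓡 N) c).target)
    (f : M → ℝ) (X : ∀ x : M, TangentSpace (𝓡 N) x) (i : Fin N) :
    coordComp c (fun x => f x • X x) i y = f ((extChartAt (𝓡 N) c).symm y) * coordComp c X i y := by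
  rw [coordComp_eq hy, coordComp_eq hy, map_smul]
  rfl

theorem coordComp_add {c : M} {y : EuclideanSpace ℝ (Fin N)} (hy : y ∈ (extChartAt (𝓡 N) c).target)
    (X Y : ∀ x : M, TangentSpace (𝓡 N) x) (i : Fin N) :
    coordComp c (fun x => X x + Y x) i y = coordComp c X i y + coordComp c Y i y := by
  rw [coordComp_eq hy, coordComp_eq hy, coordComp_eq hy, map_add]
  rfl

theorem FieldC1At.add {X Y : ∀ x : M, TangentSpace (𝓡 N) x} {x : M} (hX : FieldC1At X x) (hY : FieldC1At Y x) :
    FieldC1At (fun x => X x + Y x) x := by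
  have hx := mem_extChartAt_source (I := 𝓡 N) x
  rw [fieldC1At_iff hx] at *
  refine fun i => ((hX i).add (hY i)).congr_of_eventuallyEq ?_
  filter_upwards [(isOpen_target x).mem_nhds (mem_extChartAt_target x)] with y hy using coordComp_add hy X Y i

theorem FieldC1At.smul {X : ∀ x : M, TangentSpace (𝓡 N) x} {x : M} (hX : FieldC1At X x) {f : M → ℝ}
    (hf : ContMDiffAt (𝓡 N) 𝓘(ℝ, ℝ) 1 f x) : FieldC1At (fun x => f x • X x) x := by
  have hx := mem_extChartAt_source (I := 𝓡 N) x
  rw [fieldC1At_iff hx] at *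
  refine fun i => (((contMDiffAt_iff_comp_symm hx f 1).1 hf).mul (hX i)).congr_of_eventuallyEq ?_
  filter_upwards [(isOpen_target x).mem_nhds (mem_extChartAt_target x)] with y hy using coordComp_smul hy f X i

theorem fieldC1At_zero (x : M) : FieldC1At (fun x : M => (0 : TangentSpace (𝓡 N) x)) x := by
  have hx := mem_extChartAt_source (I := 𝓡 N) x
  rw [fieldC1At_iff hx]
  refine fun i => (contDiffAt_const (c := (0 : ℝ))).congr_of_eventuallyEq ?_
  filter_upwards [(isOpen_target x).mem_nhds (mem_extChartAt_target x)] with y hy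
  rw [coordComp_eq hy, map_zero]
  rfl

theorem FieldC1At.congr {X Y : ∀ x : M, TangentSpace (𝓡 N) x} {x : M} (hX : FieldC1At X x)
    (h : ∀ᶠ z in 𝓝 x, Y z = X z) : FieldC1At Y x := by
  refine ContMDiffAt.congr_of_eventuallyEq hX ?_
  filter_upwards [h] with z hz
  rw [hz]

theorem divergence_congr (g : SmoothMetric N M) {X Y : ∀ x : M, TangentSpace (𝓡 N) x} {x : M}
    (h : ∀ᶠ z in 𝓝 x, Y z = X z) : g.divergence Y x = g.divergence X x := by
  simp only [divergence]
  congr 1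
  refine Finset.sum_congr rfl fun i _ => Filter.EventuallyEq.partialDeriv_eq ?_ i
  have := (continuousAt_extChartAt_symm (I := 𝓡 N) x)
  have h2 := this.eventually (by rwa [extChartAt_to_inv])
  filter_upwards [h2] with y hy
  simp only [coordComp]
  rw [hy]

theorem coordDiv_continuousAt (g : SmoothMetric N M) {c : M} {X : ∀ x : M, TangentSpace (𝓡 N) x} {y : EuclideanSpace ℝ (Fin N)}
    (hy : y ∈ (extChartAt (𝓡 N) c).target) (hX : ∀ i, ContDiffAt ℝ 1 (coordComp c X i) y) :
    ContinuousAt (coordDiv g c X) y := by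
  refine ((contDiffAt_volDensity g hy 0).continuousAt.inv₀ (volDensity_pos g hy).ne').mul ?_
  refine tendsto_finsetSum _ fun i _ => ?_
  exact (ContDiffAt.partialDeriv (n := 0) ((contDiffAt_volDensity g hy 1).mul (hX i)) i).continuousAt

theorem FieldC1At.eventually {X : ∀ x : M, TangentSpace (𝓡 N) x} {x : M} (hX : FieldC1At X x) :
    ∀ᶠ z in 𝓝 x, FieldC1At X z := by
  have : IsManifold (𝓡 N) 1 M := IsManifold.of_le (n := ∞) (by exact_mod_cast le_top)
  have hx := mem_extChartAt_source (I := 𝓡 N) x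
  have h1 := (fieldC1At_iff hx X).1 hX
  have h2 : ∀ᶠ y in 𝓝 (extChartAt (𝓡 N) x x), ∀ i, ContDiffAt ℝ 1 (coordComp x X i) y :=
    Filter.eventually_all.2 fun i => (h1 i).eventually (by simp)
  filter_upwards [(continuousAt_extChartAt x).eventually h2, extChartAt_source_mem_nhds (I := 𝓡 N) x] with z hz hzs
  exact (fieldC1At_iff hzs X).2 hz

theorem FieldC1At.continuousAt_divergence (g : SmoothMetric N M) {X : ∀ x : M, TangentSpace (𝓡 N) x} {x : M}
    (hX : FieldC1At X x) : ContinuousAt (g.divergence X) x := by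
  have hx := mem_extChartAt_source (I := 𝓡 N) x
  have h1 := coordDiv_continuousAt g (mem_extChartAt_target x) ((fieldC1At_iff hx X).1 hX)
  refine (ContinuousAt.comp (f := extChartAt (𝓡 N) x) h1 (continuousAt_extChartAt x)).congr ?_
  filter_upwards [hX.eventually, extChartAt_source_mem_nhds (I := 𝓡 N) x] with z hz hzs
  exact (divergence_eq_coordDiv g hzs hz).symm

/-- The derivative of the function `f` along the vector field `X`. -/
def fieldDeriv (f : M → ℝ) (X : ∀ x : M, TangentSpace (𝓡 N) x) (x : M) : ℝ :=
  mfderiv (𝓡 N) 𝓘(ℝ, ℝ) f x (X x)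

theorem fieldDeriv_eq_sum {c : M} {y : EuclideanSpace ℝ (Fin N)} (hy : y ∈ (extChartAt (𝓡 N) c).target)
    {f : M → ℝ} (hf : MDifferentiableAt (𝓡 N) 𝓘(ℝ, ℝ) f ((extChartAt (𝓡 N) c).symm y)) (X : ∀ x : M, TangentSpace (𝓡 N) x) :
    fieldDeriv f X ((extChartAt (𝓡 N) c).symm y) =
      ∑ i, partialDeriv i (f ∘ (extChartAt (𝓡 N) c).symm) y * coordComp c X i y := by
  have h := hasFDerivWithinAt_comp_symm hy hf.mdifferentiableWithinAt (S := Set.univ)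
  rw [Set.preimage_univ, hasFDerivWithinAt_univ] at h
  rw [fieldDeriv, ← sum_coordComp_smul_coordVec hy X, map_sum]
  refine Finset.sum_congr rfl fun i _ => ?_
  rw [map_smul, partialDeriv, h.fderiv, mul_comm, ← coordDiff_eq, coordDiff, mfderivWithin_univ]
  rfl

theorem divergence_add (g : SmoothMetric N M) {X Y : ∀ x : M, TangentSpace (𝓡 N) x} {x : M} (hX : FieldC1At X x)
    (hY : FieldC1At Y x) : g.divergence (fun x => X x + Y x) x = g.divergence X x + g.divergence Y x := by
  have hx := mem_extChartAt_source (I := 𝓡 N) x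
  have ht := mem_extChartAt_target (I := 𝓡 N) x
  have dX := fun i => ((fieldC1At_iff hx X).1 hX i).differentiableAt one_ne_zero
  have dY := fun i => ((fieldC1At_iff hx Y).1 hY i).differentiableAt one_ne_zero
  have dω := (contDiffAt_volDensity g ht 1).differentiableAt one_ne_zero
  simp only [divergence]
  rw [← mul_add, ← Finset.sum_add_distrib]
  congr 1
  refine Finset.sum_congr rfl fun i _ => ?_
  rw [← partialDeriv_add (dω.fun_mul (dX i)) (dω.fun_mul (dY i))]
  refine Filter.EventuallyEq.partialDeriv_eq ?_ i
  filter_upwards [(isOpen_target x).mem_nhds ht] with y hy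
  rw [coordComp_add hy]
  ring

theorem divergence_smul (g : SmoothMetric N M) {X : ∀ x : M, TangentSpace (𝓡 N) x} {x : M} (hX : FieldC1At X x)
    {f : M → ℝ} (hf : ContMDiffAt (𝓡 N) 𝓘(ℝ, ℝ) 1 f x) : g.divergence (fun x => f x • X x) x =
      f x * g.divergence X x + fieldDeriv f X x := by
  have hx := mem_extChartAt_source (I := 𝓡 N) x
  have ht := mem_extChartAt_target (I := 𝓡 N) x
  have dX := fun i => ((fieldC1At_iff hx X).1 hX i).differentiableAt one_ne_zero
  have dω := (contDiffAt_volDensity g ht 1).differentiableAt one_ne_zero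
  have df := ((contMDiffAt_iff_comp_symm hx f 1).1 hf).differentiableAt one_ne_zero
  have h1 := fieldDeriv_eq_sum ht (f := f) (by rw [extChartAt_to_inv]; exact hf.mdifferentiableAt one_ne_zero) X
  simp only [extChartAt_to_inv] at h1
  rw [h1]
  have h0 := (volDensity_pos g ht).ne'
  have h2 : ∀ i, partialDeriv i (fun y => volDensity g x y * coordComp x (fun x => f x • X x) i y) (extChartAt (𝓡 N) x x) =
      f x * partialDeriv i (fun y => volDensity g x y * coordComp x X i y) (extChartAt (𝓡 N) x x) +
      volDensity g x (extChartAt (𝓡 N) x x) * (partialDeriv i (f ∘ (extChartAt (𝓡 N) x).symm) (extChartAt (𝓡 N) x x) *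
        coordComp x X i (extChartAt (𝓡 N) x x)) := by
    intro i
    have h3 := partialDeriv_mul df (dω.fun_mul (dX i)) i
    rw [Function.comp_apply, extChartAt_to_inv] at h3
    have h4 : partialDeriv i (fun y => volDensity g x y * coordComp x (fun x => f x • X x) i y) (extChartAt (𝓡 N) x x) =
        partialDeriv i (fun y => (f ∘ (extChartAt (𝓡 N) x).symm) y * (volDensity g x y * coordComp x X i y)) (extChartAt (𝓡 N) x x) := by
      refine Filter.EventuallyEq.partialDeriv_eq ?_ i
      filter_upwards [(isOpen_target x).mem_nhds ht] with y hy
      rw [coordComp_smul hy, Function.comp_apply]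
      ring
    rw [h4, h3]
    ring
  simp only [divergence, h2, Finset.sum_add_distrib, ← Finset.mul_sum]
  field_simp

theorem divergence_zero (g : SmoothMetric N M) (x : M) :
    g.divergence (fun x : M => (0 : TangentSpace (𝓡 N) x)) x = 0 := by
  have h := divergence_add g (fieldC1At_zero (N := N) x) (fieldC1At_zero x)
  simpa using h

theorem divergence_eq_zero_of_notMem (g : SmoothMetric N M) {K : Set M} (hK : IsClosed K)
    {Z : ∀ x : M, TangentSpace (𝓡 N) x} (h0 : ∀ x ∉ K, Z x = 0) {x : M} (hx : x ∉ K) : g.divergence Z x = 0 := by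
  rw [divergence_congr g (X := fun x => 0), divergence_zero]
  filter_upwards [hK.isOpen_compl.mem_nhds hx] with z hz using h0 z hz

theorem fieldC1At_of_notMem {K : Set M} (hK : IsClosed K)
    {Z : ∀ x : M, TangentSpace (𝓡 N) x} (h0 : ∀ x ∉ K, Z x = 0) {x : M} (hx : x ∉ K) : FieldC1At Z x := by
  refine (fieldC1At_zero x).congr ?_
  filter_upwards [hK.isOpen_compl.mem_nhds hx] with z hz using h0 z hz

theorem divergence_sum (g : SmoothMetric N M) {ι : Type*} (t : Finset ι) {X : ι → ∀ x : M, TangentSpace (𝓡 N) x} {x : M}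
    (hX : ∀ i, FieldC1At (X i) x) : FieldC1At (fun x => ∑ i ∈ t, X i x) x ∧
      g.divergence (fun x => ∑ i ∈ t, X i x) x = ∑ i ∈ t, g.divergence (X i) x := by
  classical
  induction t using Finset.induction_on with
  | empty => simpa using ⟨fieldC1At_zero x, divergence_zero g x⟩
  | insert a t ha ih =>
    simp only [Finset.sum_insert ha]
    exact ⟨(hX a).add ih.1, by rw [divergence_add g (hX a) ih.1, ih.2]⟩

section Volume

variable [MeasurableSpace M] [BorelSpace M] [CompactSpace M]

theorem continuous_divergence (g : SmoothMetric N M) {Z : ∀ x : M, TangentSpace (𝓡 N) x} (hZ : ∀ x, FieldC1At Z x) :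
    Continuous (g.divergence Z) :=
  continuous_iff_continuousAt.2 fun x => (hZ x).continuousAt_divergence g

theorem integrable_of_continuous (g : SmoothMetric N M) {f : M → ℝ} (hf : Continuous f) : Integrable f g.vol := by
  have : IsFiniteMeasure g.vol := inferInstance
  exact hf.integrable_of_hasCompactSupport (HasCompactSupport.of_compactSpace f)

theorem volDensity_mul_divergence (g : SmoothMetric N M) {c : M} {y : EuclideanSpace ℝ (Fin N)}
    (hy : y ∈ (extChartAt (𝓡 N) c).target) {Z : ∀ x : M, TangentSpace (𝓡 N) x}
    (hZ : FieldC1At Z ((extChartAt (𝓡 N) c).symm y)) :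
    g.volDensity c y * g.divergence Z ((extChartAt (𝓡 N) c).symm y) =
      ∑ i, partialDeriv i (fun y => volDensity g c y * coordComp c Z i y) y := by
  rw [divergence_eq_coordDiv g ((extChartAt (𝓡 N) c).map_target hy) hZ, (extChartAt (𝓡 N) c).right_inv hy,
    coordDiv, ← mul_assoc, mul_inv_cancel₀ (volDensity_pos g hy).ne', one_mul]

/-- In the chart the density cancels the prefactor of the divergence, so the integrand is a sum of
partial derivatives of compactly supported `C¹` functions. -/
theorem integral_divergence_eq_zero_of_subset_source (g : SmoothMetric N M) {c : M} {K : Set M} (hK : IsClosed K)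
    (hKc : K ⊆ (extChartAt (𝓡 N) c).source) {Z : ∀ x : M, TangentSpace (𝓡 N) x} (h0 : ∀ x ∉ K, Z x = 0)
    (hZ : ∀ x, FieldC1At Z x) : ∫ x, g.divergence Z x ∂g.vol = 0 := by
  classical
  have ht := (isOpen_target (N := N) c)
  rw [integral_vol_eq g c (integrable_of_continuous g (continuous_divergence g hZ)).aestronglyMeasurable
    (fun x hx => divergence_eq_zero_of_notMem g hK h0 fun h => hx (hKc h)),
    setIntegral_congr_fun ht.measurableSet (fun y hy => volDensity_mul_divergence g hy (hZ _))]
  -- The components are uncontrolled off the chart target. The indicator extends them by zero, and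
  -- the result is `C¹` because the support is a compact subset of the open target.
  let F : Fin N → EuclideanSpace ℝ (Fin N) → ℝ := fun i =>
    (extChartAt (𝓡 N) c).target.indicator fun y => volDensity g c y * coordComp c Z i y
  have hK' : IsCompact (extChartAt (𝓡 N) c '' K) :=
    hK.isCompact.image_of_continuousOn ((continuousOn_extChartAt c).mono hKc)
  have hKt : extChartAt (𝓡 N) c '' K ⊆ (extChartAt (𝓡 N) c).target := by
    rintro _ ⟨x, hx, rfl⟩
    exact (extChartAt (𝓡 N) c).map_source (hKc hx)
  have hF0 : ∀ i, ∀ y ∉ extChartAt (𝓡 N) c '' K, F i y = 0 := by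
    intro i y hy
    by_cases hyt : y ∈ (extChartAt (𝓡 N) c).target
    · have : (extChartAt (𝓡 N) c).symm y ∉ K := fun h => hy ⟨_, h, (extChartAt (𝓡 N) c).right_inv hyt⟩
      simp only [F]
      rw [Set.indicator_of_mem hyt, coordComp_eq hyt, h0 _ this, map_zero]
      simp
    · exact Set.indicator_of_notMem hyt _
  have hFe : ∀ i, ∀ y ∈ (extChartAt (𝓡 N) c).target, F i =ᶠ[𝓝 y] fun y => volDensity g c y * coordComp c Z i y := by
    intro i y hy
    filter_upwards [ht.mem_nhds hy] with z hz using Set.indicator_of_mem hz _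
  have hFd : ∀ i, ∀ y ∈ extChartAt (𝓡 N) c '' K, ContDiffAt ℝ 1 (F i) y := by
    rintro i _ ⟨x, hx, rfl⟩
    have hxt := hKt ⟨x, hx, rfl⟩
    exact ((contDiffAt_volDensity g hxt 1).mul ((fieldC1At_iff (hKc hx) Z).1 (hZ x) i)).congr_of_eventuallyEq (hFe i _ hxt)
  have h1 : ∀ i, ∫ y, partialDeriv i (F i) y = 0 := fun i => integral_partialDeriv_eq_zero hK' (hF0 i) (hFd i) i
  rw [setIntegral_congr_fun (g := fun y => ∑ i, partialDeriv i (F i) y) ht.measurableSet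
    (fun y hy => Finset.sum_congr rfl fun i _ => ((hFe i y hy).partialDeriv_eq i).symm),
    setIntegral_eq_integral_of_forall_compl_eq_zero, integral_finsetSum]
  · exact Finset.sum_eq_zero fun i _ => h1 i
  · intro i _
    exact integrable_of_continuousOn_compact hK' (fun y hy => partialDeriv_eq_zero_of_notMem hK' (hF0 i) hy i)
      (fun y hy => (ContDiffAt.partialDeriv (n := 0) (hFd i y hy) i).continuousAt.continuousWithinAt)
  · intro y hy
    exact Finset.sum_eq_zero fun i _ => partialDeriv_eq_zero_of_notMem hK' (hF0 i) (fun h => hy (hKt h)) i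

/-- The divergence theorem on a closed manifold. -/
theorem integral_divergence_eq_zero [T2Space M] (g : SmoothMetric N M) {Z : ∀ x : M, TangentSpace (𝓡 N) x}
    (hZ : ∀ x, FieldC1At Z x) : ∫ x, g.divergence Z x ∂g.vol = 0 := by
  -- A partition of unity subordinate to chart domains reduces the claim to fields supported in one
  -- chart; by compactness only finitely many functions are nonzero.
  obtain ⟨f, hf⟩ := SmoothPartitionOfUnity.exists_isSubordinate_chartAt_source (𝓡 N) M
  have hfin : {i | (Function.support (f i)).Nonempty}.Finite := f.locallyFinite.finite_nonempty_of_compact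
  set t := hfin.toFinset with ht
  have hsum : ∀ x, ∑ i ∈ t, f i x = 1 := by
    intro x
    rw [← f.sum_eq_one (Set.mem_univ x)]
    refine (finsum_eq_sum_of_support_subset _ fun i hi => ?_).symm
    simp only [ht, Set.Finite.coe_toFinset, Set.mem_ofPred_eq]
    exact ⟨x, hi⟩
  have hf1 : ∀ i x, ContMDiffAt (𝓡 N) 𝓘(ℝ, ℝ) 1 (f i) x := fun i x =>
    ((f i).contMDiff.of_le (by exact_mod_cast le_top)).contMDiffAt
  have hC : ∀ i x, FieldC1At (fun x => f i x • Z x) x := fun i x => (hZ x).smul (hf1 i x)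
  have h1 : ∀ x, g.divergence Z x = ∑ i ∈ t, g.divergence (fun x => f i x • Z x) x := by
    intro x
    rw [← (divergence_sum g t fun i => hC i x).2]
    refine divergence_congr g (Filter.Eventually.of_forall fun z => ?_)
    rw [← Finset.sum_smul, hsum, one_smul]
  simp only [h1]
  rw [integral_finsetSum]
  · refine Finset.sum_eq_zero fun i _ => ?_
    refine integral_divergence_eq_zero_of_subset_source g (c := i) (isClosed_tsupport (f i)) ?_ ?_ (hC i)
    · rw [extChartAt_source]; exact hf i
    · intro x hx
      rw [image_eq_zero_of_notMem_tsupport hx, zero_smul]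
  · exact fun i _ => integrable_of_continuous g (continuous_divergence g (hC i))

end Volume

/-- The vector field with the coordinate expression `a` in the chart at `c`, extended by zero. -/
def chartField (c : M) (a : EuclideanSpace ℝ (Fin N) → EuclideanSpace ℝ (Fin N)) (x : M) : TangentSpace (𝓡 N) x :=
  constField c (a (extChartAt (𝓡 N) c x)) x

theorem coordComp_chartField {c : M} {y : EuclideanSpace ℝ (Fin N)} (hy : y ∈ (extChartAt (𝓡 N) c).target)
    (a : EuclideanSpace ℝ (Fin N) → EuclideanSpace ℝ (Fin N)) (i : Fin N) :
    coordComp c (chartField c a) i y = a y i := by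
  rw [coordComp_eq hy, chartField, (extChartAt (𝓡 N) c).right_inv hy, constField,
    (triv c).continuousLinearMapAt_symmL (R := ℝ)]
  exact symm_mem_source hy

theorem fieldC1At_chartField {c x : M} (hx : x ∈ (extChartAt (𝓡 N) c).source)
    {a : EuclideanSpace ℝ (Fin N) → EuclideanSpace ℝ (Fin N)} (ha : ContDiffAt ℝ 1 a (extChartAt (𝓡 N) c x)) :
    FieldC1At (chartField c a) x := by
  rw [fieldC1At_iff hx]
  refine fun i => (contDiffAt_euclidean.1 ha i).congr_of_eventuallyEq ?_
  filter_upwards [(isOpen_target c).mem_nhds ((extChartAt (𝓡 N) c).map_source hx)] with y hy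
  exact coordComp_chartField hy a i

theorem chartField_eq_zero {c : M} {K : Set (EuclideanSpace ℝ (Fin N))}
    {a : EuclideanSpace ℝ (Fin N) → EuclideanSpace ℝ (Fin N)} (h0 : ∀ y ∉ K, a y = 0) {x : M}
    (hx : x ∉ (extChartAt (𝓡 N) c).symm '' K) : chartField c a x = 0 := by
  by_cases hxs : x ∈ (extChartAt (𝓡 N) c).source
  · rw [chartField, h0 _ fun h => hx ⟨_, h, (extChartAt (𝓡 N) c).left_inv hxs⟩, constField, map_zero]
  · rw [chartField, constField, Trivialization.symmL_apply_of_notMem]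
    rwa [extChartAt_source] at hxs

end SmoothMetric

/-! ### Commuting derivatives under the integral and a weak maximum principle -/

section Euclidean

variable {N : ℕ} {f h : EuclideanSpace ℝ (Fin N) → ℝ}

theorem continuous_partialDeriv (hf : ContDiff ℝ 1 f) (i : Fin N) : Continuous (partialDeriv i f) :=
  (hf.continuous_fderiv one_ne_zero).clm_apply continuous_const

/-- For `C²` functions this is two integrations by parts. For `C¹` functions the derivatives in
direction `i` are replaced by difference quotients, which may be moved across by translation while
the derivative in direction `j` is moved by parts; Lipschitz bounds justify the limit. -/
theorem integral_partialDeriv_mul_comm_of_hasCompactSupport (hf : ContDiff ℝ 1 f) (hfc : HasCompactSupport f)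
    (hh : ContDiff ℝ 1 h) (hhc : HasCompactSupport h) (i j : Fin N) :
    ∫ y, partialDeriv j f y * partialDeriv i h y = ∫ y, partialDeriv i f y * partialDeriv j h y := by
  obtain ⟨C, hC⟩ := hf.lipschitzWith_of_hasCompactSupport hfc one_ne_zero
  obtain ⟨D, hD⟩ := hh.lipschitzWith_of_hasCompactSupport hhc one_ne_zero
  set e : EuclideanSpace ℝ (Fin N) := EuclideanSpace.single i 1 with he
  have hf0 : ∀ y ∉ tsupport f, f y = 0 := fun y hy => image_eq_zero_of_notMem_tsupport hy
  have hh0 : ∀ y ∉ tsupport h, h y = 0 := fun y hy => image_eq_zero_of_notMem_tsupport hy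
  have hIf : Integrable (partialDeriv j f) := integrable_of_continuousOn_compact hfc
    (fun y hy => partialDeriv_eq_zero_of_notMem hfc hf0 hy j) (continuous_partialDeriv hf j).continuousOn
  have hIh : Integrable (partialDeriv j h) := integrable_of_continuousOn_compact hhc
    (fun y hy => partialDeriv_eq_zero_of_notMem hhc hh0 hy j) (continuous_partialDeriv hh j).continuousOn
  have A := hD.integral_inv_smul_sub_mul_tendsto_integral_lineDeriv_mul hIf e
  have B := hC.integral_inv_smul_sub_mul_tendsto_integral_lineDeriv_mul hIh (-e)
  have hlh : ∀ y, lineDeriv ℝ h y e = partialDeriv i h y := fun y =>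
    (hh.differentiable one_ne_zero y).lineDeriv_eq_fderiv
  have hlf : ∀ y, lineDeriv ℝ f y (-e) = - partialDeriv i f y := fun y => by
    rw [(hf.differentiable one_ne_zero y).lineDeriv_eq_fderiv, map_neg]; rfl
  simp only [hlh] at A
  simp only [hlf, neg_mul, integral_neg] at B
  -- The discrete identity: integrate by parts in direction `j`, then shift the variable by `t e`.
  -- The shift moves the increment from `h` to `f` and reverses its direction.
  have key : ∀ t : ℝ, ∫ x, (t⁻¹ • (h (x + t • e) - h x)) * partialDeriv j f x =
      - ∫ x, (t⁻¹ • (f (x + t • -e) - f x)) * partialDeriv j h x := by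
    intro t
    have h1 : ContDiff ℝ 1 fun x => h (x + t • e) := hh.comp (contDiff_id.add contDiff_const)
    have h2 : ∫ x, h (x + t • e) * partialDeriv j f x = - ∫ x, partialDeriv j h (x + t • e) * f x := by
      rw [integral_mul_partialDeriv hfc hf0 hf (fun y _ => h1.contDiffAt) j]
      congr 2
      ext x
      rw [partialDeriv, fderiv_comp_add_right]
      rfl
    have h3 : ∫ x, partialDeriv j h (x + t • e) * f x = ∫ x, partialDeriv j h x * f (x + t • -e) := by
      rw [← integral_add_right_eq_self (fun x => partialDeriv j h x * f (x + t • -e)) (t • e)]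
      simp
    have h4 : ∫ x, h x * partialDeriv j f x = - ∫ x, partialDeriv j h x * f x :=
      integral_mul_partialDeriv hfc hf0 hf (fun y _ => hh.contDiffAt) j
    have hcf : Continuous f := hf.continuous
    have hch : Continuous h := hh.continuous
    have i1 : Integrable fun x => h (x + t • e) * partialDeriv j f x := integrable_of_continuousOn_compact hfc
      (fun y hy => by rw [partialDeriv_eq_zero_of_notMem hfc hf0 hy, mul_zero])
      (h1.continuous.mul (continuous_partialDeriv hf j)).continuousOn
    have i2 : Integrable fun x => h x * partialDeriv j f x := integrable_of_continuousOn_compact hfc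
      (fun y hy => by rw [partialDeriv_eq_zero_of_notMem hfc hf0 hy, mul_zero])
      (hch.mul (continuous_partialDeriv hf j)).continuousOn
    have i3 : Integrable fun x => partialDeriv j h x * f (x + t • -e) := integrable_of_continuousOn_compact hhc
      (fun y hy => by rw [partialDeriv_eq_zero_of_notMem hhc hh0 hy, zero_mul])
      ((continuous_partialDeriv hh j).mul (hcf.comp (continuous_id.add continuous_const))).continuousOn
    have i4 : Integrable fun x => partialDeriv j h x * f x := integrable_of_continuousOn_compact hhc
      (fun y hy => by rw [partialDeriv_eq_zero_of_notMem hhc hh0 hy, zero_mul])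
      ((continuous_partialDeriv hh j).mul hcf).continuousOn
    have e1 : ∫ x, (t⁻¹ • (h (x + t • e) - h x)) * partialDeriv j f x =
        t⁻¹ * ((∫ x, h (x + t • e) * partialDeriv j f x) - ∫ x, h x * partialDeriv j f x) := by
      rw [← integral_sub i1 i2, ← integral_const_mul]
      congr 1; ext x; simp only [smul_eq_mul]; ring
    have e2 : ∫ x, (t⁻¹ • (f (x + t • -e) - f x)) * partialDeriv j h x =
        t⁻¹ * ((∫ x, partialDeriv j h x * f (x + t • -e)) - ∫ x, partialDeriv j h x * f x) := by
      rw [← integral_sub i3 i4, ← integral_const_mul]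
      congr 1; ext x; simp only [smul_eq_mul]; ring
    rw [e1, e2, h2, h3, h4]
    ring
  simp only [key] at A
  have := tendsto_nhds_unique A B.neg
  rw [neg_neg] at this
  rw [← this]
  congr 1; ext x; ring

/-- Localised form: `f` need only be `C¹` near the support of `h`, since multiplication by a bump
that equals `1` around that support changes nothing in the integrals. -/
theorem integral_partialDeriv_mul_comm {y₀ : EuclideanSpace ℝ (Fin N)} {r R : ℝ} (hr : 0 < r) (hrR : r < R)
    (hf : ∀ y ∈ Metric.closedBall y₀ R, ContDiffAt ℝ 1 f y) (hh : ContDiff ℝ 1 h)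
    (h0 : ∀ y ∉ Metric.closedBall y₀ r, h y = 0) (i j : Fin N) :
    ∫ y, partialDeriv j f y * partialDeriv i h y = ∫ y, partialDeriv i f y * partialDeriv j h y := by
  let b : ContDiffBump y₀ := ⟨(r + R) / 2, R, by linarith, by linarith⟩
  have hK : IsCompact (Metric.closedBall y₀ r) := isCompact_closedBall _ _
  have hb0 : ∀ y ∉ Metric.closedBall y₀ R, f y * b y = 0 := by
    intro y hy
    rw [b.zero_of_le_dist, mul_zero]
    exact (not_le.1 hy).le
  have hfb : ContDiff ℝ 1 fun y => f y * b y := contDiff_of_eq_zero_off (isCompact_closedBall y₀ R) hb0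
    fun y hy => (hf y hy).mul b.contDiffAt
  have hfbc : HasCompactSupport fun y => f y * b y :=
    HasCompactSupport.intro (isCompact_closedBall y₀ R) hb0
  have hhc : HasCompactSupport h := HasCompactSupport.intro hK h0
  have key : ∀ (k l : Fin N) y, partialDeriv k f y * partialDeriv l h y =
      partialDeriv k (fun y => f y * b y) y * partialDeriv l h y := by
    intro k l y
    by_cases hy : y ∈ Metric.closedBall y₀ r
    · congr 1
      refine Filter.EventuallyEq.partialDeriv_eq ?_ k
      have : Metric.ball y₀ ((r + R) / 2) ∈ 𝓝 y := Metric.isOpen_ball.mem_nhds (by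
        rw [Metric.mem_ball]; rw [Metric.mem_closedBall] at hy; linarith)
      filter_upwards [this] with z hz
      rw [b.one_of_mem_closedBall (Metric.ball_subset_closedBall hz), mul_one]
    · rw [partialDeriv_eq_zero_of_notMem hK h0 hy, mul_zero, mul_zero]
  simp only [key]
  exact integral_partialDeriv_mul_comm_of_hasCompactSupport hfb hfbc hh hhc i j

theorem partialDeriv_real_comp {ψ : ℝ → ℝ} {q : EuclideanSpace ℝ (Fin N) → ℝ} {y : EuclideanSpace ℝ (Fin N)}
    (hψ : DifferentiableAt ℝ ψ (q y)) (hq : DifferentiableAt ℝ q y) (i : Fin N) :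
    partialDeriv i (fun y => ψ (q y)) y = deriv ψ (q y) * partialDeriv i q y := by
  have := hψ.hasDerivAt.comp_hasFDerivAt y hq.hasFDerivAt
  rw [partialDeriv, show (fun y => ψ (q y)) = ψ ∘ q from rfl, this.fderiv]
  rfl

/-- A `C¹` function that is weakly strictly subharmonic near `y₀`, for the operator
`∑ ∂ᵢ (aᵢₗ ∂ₗ ·)`, has no local maximum at `y₀`. -/
theorem not_isLocalMax_of_weak_subharmonic {y₀ : EuclideanSpace ℝ (Fin N)} {R : ℝ} (hR : 0 < R)
    {a : Fin N → Fin N → EuclideanSpace ℝ (Fin N) → ℝ}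
    (ha : ∀ i l, ∀ y ∈ Metric.closedBall y₀ R, ContDiffAt ℝ 1 (a i l) y)
    (hpos : ∀ y ∈ Metric.closedBall y₀ R, ∀ ξ : Fin N → ℝ, 0 ≤ ∑ i, ∑ l, a i l y * ξ l * ξ i)
    {v F : EuclideanSpace ℝ (Fin N) → ℝ} (hv : ∀ y ∈ Metric.closedBall y₀ R, ContDiffAt ℝ 1 v y)
    (hF : ∀ y ∈ Metric.closedBall y₀ R, ContinuousAt F y) (hF0 : 0 < F y₀)
    (hweak : ∀ φ : EuclideanSpace ℝ (Fin N) → ℝ, ContDiff ℝ 1 φ → (∀ y, 0 ≤ φ y) →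
      (∀ y ∉ Metric.closedBall y₀ (R / 2), φ y = 0) →
      ∫ y, ∑ i, ∑ l, a i l y * partialDeriv l v y * partialDeriv i φ y ≤ - ∫ y, F y * φ y) :
    ¬ IsLocalMax v y₀ := by
  intro hmax
  have hy0 : y₀ ∈ Metric.closedBall y₀ R := Metric.mem_closedBall_self hR.le
  obtain ⟨r, hr, hrs⟩ := Metric.nhds_basis_closedBall.mem_iff.1
    (Filter.inter_mem hmax ((hF y₀ hy0).eventually (lt_mem_nhds (half_lt_self hF0))))
  wlog hrR : r ≤ R / 2 generalizing r
  -- Shrinking the radius keeps the test function below inside the ball on which `hweak` may be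
  -- applied.
  · exact this (R / 2) (by positivity) ((Metric.closedBall_subset_closedBall (not_le.1 hrR).le).trans hrs) le_rfl
  set κ := F y₀ / 2 with hκ
  have hκ0 : 0 < κ := half_pos hF0
  have hsub : Metric.closedBall y₀ r ⊆ Metric.closedBall y₀ R := Metric.closedBall_subset_closedBall (by linarith)
  let b : Fin N → EuclideanSpace ℝ (Fin N) → ℝ := fun i y => ∑ l, a i l y * (2 * (y - y₀) l)
  have hb : ∀ i, ∀ y ∈ Metric.closedBall y₀ R, ContDiffAt ℝ 1 (b i) y := by
    intro i y hy
    refine ContDiffAt.sum fun l _ => (ha i l y hy).mul (contDiffAt_const.mul ?_)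
    exact contDiffAt_euclidean.1 (contDiffAt_id.sub contDiffAt_const) l
  -- `D` is the operator applied to `‖y - y₀‖²`. It is continuous, since the coefficients are `C¹`,
  -- hence bounded by some `C` on the closed ball.
  let D : EuclideanSpace ℝ (Fin N) → ℝ := fun y => ∑ i, partialDeriv i (b i) y
  have hDc : ContinuousOn D (Metric.closedBall y₀ R) := fun y hy => by
    refine ContinuousAt.continuousWithinAt (tendsto_finsetSum _ fun i _ => ?_)
    exact (ContDiffAt.partialDeriv (n := 0) (hb i y hy) i).continuousAt
  obtain ⟨C, hC⟩ := (isCompact_closedBall y₀ R).exists_bound_of_continuousOn hDc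
  have hC0 : 0 ≤ C := (norm_nonneg _).trans (hC y₀ hy0)
  -- Chosen so that `δ C < κ`: the quadratic correction must cost less than the strict
  -- subharmonicity `F ≥ κ` gains.
  set δ := κ / (2 * (C + 1)) with hδ
  have hδ0 : 0 < δ := by positivity
  have hδC : δ * C < κ := by
    rw [hδ, div_mul_eq_mul_div, div_lt_iff₀ (by positivity)]
    nlinarith
  -- Subtracting a small paraboloid makes the maximum strict. The added constant makes `q` positive
  -- at `y₀` and nonpositive for `r / 2 ≤ ‖y - y₀‖ ≤ r`.
  let q : EuclideanSpace ℝ (Fin N) → ℝ := fun y => v y - v y₀ - δ * ‖y - y₀‖ ^ 2 + δ * r ^ 2 / 4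
  have hq : ∀ y ∈ Metric.closedBall y₀ R, ContDiffAt ℝ 1 q y := fun y hy =>
    (((hv y hy).sub contDiffAt_const).sub (contDiffAt_const.mul
      ((contDiff_norm_sq ℝ).contDiffAt.comp y (contDiffAt_id.sub contDiffAt_const)))).add contDiffAt_const
  have hqle : ∀ y ∈ Metric.closedBall y₀ r, y ∉ Metric.closedBall y₀ (r / 2) → q y ≤ 0 := by
    intro y hy hy2
    have h1 : v y ≤ v y₀ := (hrs hy).1
    rw [Metric.mem_closedBall, dist_eq_norm, not_le] at hy2
    have : (r / 2) ^ 2 ≤ ‖y - y₀‖ ^ 2 := pow_le_pow_left₀ (by positivity) hy2.le 2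
    have := mul_le_mul_of_nonneg_left this hδ0.le
    simp only [q]
    nlinarith
  -- The test function is a smooth truncation of `q`: it is nondecreasing in `q` and vanishes for `q
  -- ≤ 0`, so its support lies in the ball of radius `r / 2`.
  let φ : EuclideanSpace ℝ (Fin N) → ℝ := (Metric.closedBall y₀ r).indicator fun y => expNegInvGlue (q y)
  have hφ0 : ∀ y ∉ Metric.closedBall y₀ (r / 2), φ y = 0 := by
    intro y hy
    by_cases hyr : y ∈ Metric.closedBall y₀ r
    · simp only [φ]
      rw [Set.indicator_of_mem hyr, expNegInvGlue.zero_of_nonpos (hqle y hyr hy)]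
    · exact Set.indicator_of_notMem hyr _
  have hφe : ∀ y ∈ Metric.closedBall y₀ (r / 2), φ =ᶠ[𝓝 y] fun y => expNegInvGlue (q y) := by
    intro y hy
    have : Metric.ball y₀ r ∈ 𝓝 y := Metric.isOpen_ball.mem_nhds (by
      rw [Metric.mem_ball]; rw [Metric.mem_closedBall] at hy; linarith)
    filter_upwards [this] with z hz
    exact Set.indicator_of_mem (Metric.ball_subset_closedBall hz) _
  have hsub2 : Metric.closedBall y₀ (r / 2) ⊆ Metric.closedBall y₀ r := Metric.closedBall_subset_closedBall (by linarith)
  have hK : IsCompact (Metric.closedBall y₀ (r / 2)) := isCompact_closedBall _ _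
  have hψ1 : ContDiff ℝ 1 expNegInvGlue := by exact_mod_cast expNegInvGlue.contDiff (n := 1)
  have hφ1 : ContDiff ℝ 1 φ := contDiff_of_eq_zero_off hK hφ0 fun y hy =>
    (hψ1.contDiffAt.comp y (hq y (hsub (hsub2 hy)))).congr_of_eventuallyEq (hφe y hy)
  have hφnn : ∀ y, 0 ≤ φ y := fun y => Set.indicator_nonneg (fun y _ => expNegInvGlue.nonneg _) y
  have hw := hweak φ hφ1 hφnn fun y hy => hφ0 y fun h => hy (Metric.closedBall_subset_closedBall (by linarith) h)
  have hcφ : ∀ i, ContinuousOn (partialDeriv i φ) (Metric.closedBall y₀ (r / 2)) := fun i =>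
    (continuous_partialDeriv hφ1 i).continuousOn
  have hib : ∀ i, Integrable fun y => b i y * partialDeriv i φ y := fun i =>
    integrable_of_continuousOn_compact hK
      (fun y hy => by rw [partialDeriv_eq_zero_of_notMem hK hφ0 hy, mul_zero])
      (ContinuousOn.mul (fun y hy => (hb i y (hsub (hsub2 hy))).continuousAt.continuousWithinAt) (hcφ i))
  have hiD : ∀ i, Integrable fun y => partialDeriv i (b i) y * φ y := fun i =>
    integrable_of_continuousOn_compact hK (fun y hy => by rw [hφ0 y hy, mul_zero])
      (ContinuousOn.mul (fun y hy => (ContDiffAt.partialDeriv (n := 0) (hb i y (hsub (hsub2 hy))) i).continuousAt.continuousWithinAt)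
        hφ1.continuous.continuousOn)
  have hiφ : Integrable φ := integrable_of_continuousOn_compact hK hφ0 hφ1.continuous.continuousOn
  -- As `∇v = ∇q + δ ∇‖y - y₀‖²` and `∇φ = ψ'(q) ∇q` with `ψ' ≥ 0`, ellipticity makes the part
  -- quadratic in `∇q` nonnegative. Only the paraboloid term remains.
  have h1 : δ * ∑ i, ∫ y, b i y * partialDeriv i φ y ≤
      ∫ y, ∑ i, ∑ l, a i l y * partialDeriv l v y * partialDeriv i φ y := by
    rw [← integral_finsetSum _ fun i _ => hib i, ← integral_const_mul]
    refine integral_mono ((integrable_finsetSum _ fun i _ => hib i).const_mul δ) ?_ fun y => ?_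
    · refine integrable_finsetSum _ fun i _ => integrable_finsetSum _ fun l _ => ?_
      refine integrable_of_continuousOn_compact hK
        (fun y hy => by rw [partialDeriv_eq_zero_of_notMem hK hφ0 hy, mul_zero])
        (ContinuousOn.mul (ContinuousOn.mul (fun y hy => (ha i l y (hsub (hsub2 hy))).continuousAt.continuousWithinAt)
          (fun y hy => (ContDiffAt.partialDeriv (n := 0) (hv y (hsub (hsub2 hy))) l).continuousAt.continuousWithinAt)) (hcφ i))
    · simp only
      by_cases hy : y ∈ Metric.closedBall y₀ (r / 2)
      · have hyR := hsub (hsub2 hy)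
        have hdq := (hq y hyR).differentiableAt one_ne_zero
        have hdv := (hv y hyR).differentiableAt one_ne_zero
        have hφd : ∀ i, partialDeriv i φ y = deriv expNegInvGlue (q y) * partialDeriv i q y := fun i => by
          rw [(hφe y hy).partialDeriv_eq, partialDeriv_real_comp (hψ1.differentiable one_ne_zero _) hdq]
        have hvd : ∀ l, partialDeriv l v y = partialDeriv l q y + δ * (2 * (y - y₀) l) := by
          intro l
          have hn : HasFDerivAt (fun y : EuclideanSpace ℝ (Fin N) => ‖y - y₀‖ ^ 2) (2 • (innerSL ℝ (y - y₀))) y := by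
            simpa using ((hasFDerivAt_id y).sub_const y₀).norm_sq
          have hq' : HasFDerivAt q (fderiv ℝ v y - δ • (2 • (innerSL ℝ (y - y₀)))) y :=
            ((hdv.hasFDerivAt.sub_const (v y₀)).sub (hn.const_mul δ)).add_const (δ * r ^ 2 / 4)
          rw [partialDeriv, partialDeriv, hq'.fderiv]
          simp [EuclideanSpace.inner_single_right]
        have hd0 : 0 ≤ deriv expNegInvGlue (q y) := expNegInvGlue.monotone.deriv_nonneg
        have hp := mul_nonneg hd0 (hpos y hyR fun i => partialDeriv i q y)
        have e : ∑ i, ∑ l, a i l y * partialDeriv l v y * partialDeriv i φ y =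
            deriv expNegInvGlue (q y) * (∑ i, ∑ l, a i l y * partialDeriv l q y * partialDeriv i q y) +
            δ * ∑ i, b i y * partialDeriv i φ y := by
          simp only [hφd, hvd, b, Finset.mul_sum, Finset.sum_mul, ← Finset.sum_add_distrib]
          refine Finset.sum_congr rfl fun i _ => Finset.sum_congr rfl fun l _ => ?_
          ring
        rw [e]
        linarith
      · simp [partialDeriv_eq_zero_of_notMem hK hφ0 hy]
  have h2 : ∀ i, ∫ y, b i y * partialDeriv i φ y = - ∫ y, partialDeriv i (b i) y * φ y := fun i =>
    integral_mul_partialDeriv hK hφ0 hφ1 (fun y hy => hb i y (hsub (hsub2 hy))) i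
  have h3 : ∑ i, ∫ y, b i y * partialDeriv i φ y = - ∫ y, D y * φ y := by
    simp only [h2, D, Finset.sum_mul, Finset.sum_neg_distrib]
    rw [integral_finsetSum _ fun i _ => hiD i]
  have hiDφ : Integrable fun y => D y * φ y := by
    simp only [D, Finset.sum_mul]
    exact integrable_finsetSum _ fun i _ => hiD i
  have h4 : ∫ y, D y * φ y ≤ C * ∫ y, φ y := by
    rw [← integral_const_mul]
    refine integral_mono hiDφ (hiφ.const_mul C) fun y => ?_
    simp only
    by_cases hy : y ∈ Metric.closedBall y₀ (r / 2)
    · exact mul_le_mul_of_nonneg_right ((le_abs_self _).trans (hC y (hsub (hsub2 hy)))) (hφnn y)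
    · rw [hφ0 y hy, mul_zero, mul_zero]
  have h5 : κ * ∫ y, φ y ≤ ∫ y, F y * φ y := by
    rw [← integral_const_mul]
    refine integral_mono (hiφ.const_mul κ) ?_ fun y => ?_
    · exact integrable_of_continuousOn_compact hK (fun y hy => by rw [hφ0 y hy, mul_zero])
        (ContinuousOn.mul (fun y hy => (hF y (hsub (hsub2 hy))).continuousWithinAt) hφ1.continuous.continuousOn)
    · simp only
      by_cases hy : y ∈ Metric.closedBall y₀ (r / 2)
      · exact mul_le_mul_of_nonneg_right (hrs (hsub2 hy)).2.le (hφnn y)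
      · rw [hφ0 y hy, mul_zero, mul_zero]
  have h6 : 0 < ∫ y, φ y := by
    refine hφ1.continuous.integral_pos_of_hasCompactSupport_nonneg_nonzero (HasCompactSupport.intro hK hφ0) hφnn (x := y₀) ?_
    simp only [φ]
    rw [Set.indicator_of_mem (Metric.mem_closedBall_self hr.le)]
    refine (expNegInvGlue.pos_of_pos ?_).ne'
    simp only [q, sub_self, norm_zero]
    have : 0 < δ * r ^ 2 / 4 := by positivity
    linarith
  have h7 := mul_le_mul_of_nonneg_left h4 hδ0.le
  -- The chain `-δ C ∫ φ ≤ ∫ a ∇v ∇φ ≤ -κ ∫ φ` contradicts `δ C < κ` and `∫ φ > 0`.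
  have h8 : 0 < (κ - δ * C) * ∫ y, φ y := mul_pos (by linarith) h6
  rw [h3] at h1
  nlinarith

end Euclidean

/-! ### The integrated Bochner identity -/

section Bochner

/-- The pointwise algebra behind `tr(∇X ∇Y) - div X div Y + Ric(X,Y) = div(∇_Y X - (div X) Y)`,
multiplied by the density `w`. The symbols `A`, `D`, `T` stand for the first derivatives of `X`,
`Y`, `Γ`. No second derivative of `X` occurs: on the right, the first sum pairs derivatives of `X`
with those of `w Y`, and the second is the divergence of the part of the flux that contains `Γ`. -/
theorem bochner_algebra {ι : Type*} [Fintype ι] (w : ℝ) (X Y : ι → ℝ) (A D : ι → ι → ℝ)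
    (Γ : ι → ι → ι → ℝ) (T : ι → ι → ι → ι → ℝ) (hΓ : ∀ k i j, Γ k i j = Γ k j i) :
    w * ((∑ i, ∑ j, (A i j + ∑ k, Γ i k j * X k) * (D j i + ∑ k, Γ j k i * Y k)) -
        ((∑ i, A i i) + ∑ k, (∑ m, Γ m k m) * X k) * ((∑ i, D i i) + ∑ k, (∑ m, Γ m k m) * Y k) +
        ∑ i, ∑ j, ((∑ k, (T k k i j - T j k i k)) +
          ∑ k, ∑ l, (Γ k k l * Γ l i j - Γ k j l * Γ l i k)) * X i * Y j) =
      (∑ i, ∑ j, (A i j * (w * (∑ m, Γ m i m) * Y j + w * D j i) -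
        A i i * (w * (∑ m, Γ m j m) * Y j + w * D j j))) +
      ∑ i, (w * (∑ m, Γ m i m) * ((∑ j, (∑ k, Γ i k j * X k) * Y j) - (∑ k, (∑ m, Γ m k m) * X k) * Y i) +
        w * ((∑ j, ((∑ k, (T i i k j * X k + Γ i k j * A k i)) * Y j + (∑ k, Γ i k j * X k) * D j i)) -
          ((∑ k, ((∑ m, T i m k m) * X k + (∑ m, Γ m k m) * A k i)) * Y i +
            (∑ k, (∑ m, Γ m k m) * X k) * D i i))) := by
  set G : ι → ℝ := fun k => ∑ m, Γ m k m with hG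
  have hG' : ∀ k, ∑ m, Γ m k m = G k := fun k => rfl
  set C : ι → ι → ℝ := fun i j => ∑ k, Γ i k j * X k with hC
  have hC' : ∀ i j, ∑ k, Γ i k j * X k = C i j := fun i j => rfl
  set F : ι → ι → ℝ := fun i j => ∑ k, Γ i k j * Y k with hF
  have hF' : ∀ i j, ∑ k, Γ i k j * Y k = F i j := fun i j => rfl
  simp only [hG', hC', hF']
  set p := ∑ k, G k * X k with hp
  set q := ∑ k, G k * Y k with hq
  have hGG : ∀ l, ∑ k, Γ k k l = G l := fun l => Finset.sum_congr rfl fun k _ => hΓ _ _ _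
  have e1 : ∑ i, ∑ j, C i j * F j i = ∑ i, ∑ j, (∑ k, ∑ l, Γ k j l * Γ l i k) * X i * Y j := by
    simp only [hC, hF, Finset.sum_mul, Finset.mul_sum]
    calc ∑ a, ∑ b, ∑ l, ∑ k, Γ a k b * X k * (Γ b l a * Y l)
        = ∑ b, ∑ a, ∑ l, ∑ k, Γ a k b * X k * (Γ b l a * Y l) := Finset.sum_comm
      _ = ∑ b, ∑ a, ∑ k, ∑ l, Γ a k b * X k * (Γ b l a * Y l) :=
          Finset.sum_congr rfl fun b _ => Finset.sum_congr rfl fun a _ => Finset.sum_comm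
      _ = ∑ b, ∑ k, ∑ a, ∑ l, Γ a k b * X k * (Γ b l a * Y l) :=
          Finset.sum_congr rfl fun b _ => Finset.sum_comm
      _ = ∑ k, ∑ b, ∑ a, ∑ l, Γ a k b * X k * (Γ b l a * Y l) := Finset.sum_comm
      _ = ∑ k, ∑ b, ∑ l, ∑ a, Γ a k b * X k * (Γ b l a * Y l) :=
          Finset.sum_congr rfl fun k _ => Finset.sum_congr rfl fun b _ => Finset.sum_comm
      _ = ∑ k, ∑ l, ∑ b, ∑ a, Γ a k b * X k * (Γ b l a * Y l) :=
          Finset.sum_congr rfl fun k _ => Finset.sum_comm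
      _ = _ := by
          refine Finset.sum_congr rfl fun k _ => Finset.sum_congr rfl fun l _ =>
            Finset.sum_congr rfl fun b _ => Finset.sum_congr rfl fun a _ => ?_
          ring
  have e2 : ∑ i, ∑ j, A i j * F j i = ∑ i, ∑ j, (∑ k, Γ i k j * A k i) * Y j := by
    simp only [hF, Finset.sum_mul, Finset.mul_sum]
    calc ∑ i, ∑ j, ∑ l, A i j * (Γ j l i * Y l)
        = ∑ j, ∑ i, ∑ l, A i j * (Γ j l i * Y l) := Finset.sum_comm
      _ = ∑ j, ∑ l, ∑ i, A i j * (Γ j l i * Y l) := Finset.sum_congr rfl fun _ _ => Finset.sum_comm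
      _ = _ := by
          refine Finset.sum_congr rfl fun k _ => Finset.sum_congr rfl fun l _ =>
            Finset.sum_congr rfl fun b _ => ?_
          rw [hΓ k b l]; ring
  have e3 : ∑ i, ∑ j, (∑ k, T k k i j) * X i * Y j = ∑ i, ∑ j, (∑ k, T i i k j * X k) * Y j := by
    simp only [Finset.sum_mul]
    calc ∑ i, ∑ j, ∑ k, T k k i j * X i * Y j
        = ∑ i, ∑ k, ∑ j, T k k i j * X i * Y j := Finset.sum_congr rfl fun _ _ => Finset.sum_comm
      _ = ∑ k, ∑ i, ∑ j, T k k i j * X i * Y j := Finset.sum_comm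
      _ = _ := Finset.sum_congr rfl fun _ _ => Finset.sum_comm
  have e4 : ∑ i, ∑ j, (∑ k, T j k i k) * X i * Y j = ∑ i, (∑ k, (∑ m, T i m k m) * X k) * Y i := by
    rw [Finset.sum_comm]
    simp only [Finset.sum_mul]
  have e5 : ∑ i, ∑ j, (∑ k, ∑ l, Γ k k l * Γ l i j) * X i * Y j = ∑ i, G i * ∑ j, C i j * Y j := by
    have : ∀ i j, ∑ k, ∑ l, Γ k k l * Γ l i j = ∑ l, G l * Γ l i j := fun i j => by
      rw [Finset.sum_comm]
      exact Finset.sum_congr rfl fun l _ => by rw [← Finset.sum_mul, hGG]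
    simp only [this, hC, Finset.sum_mul, Finset.mul_sum]
    calc ∑ i, ∑ j, ∑ l, G l * Γ l i j * X i * Y j
        = ∑ i, ∑ l, ∑ j, G l * Γ l i j * X i * Y j := Finset.sum_congr rfl fun _ _ => Finset.sum_comm
      _ = ∑ l, ∑ i, ∑ j, G l * Γ l i j * X i * Y j := Finset.sum_comm
      _ = ∑ l, ∑ j, ∑ i, G l * Γ l i j * X i * Y j := Finset.sum_congr rfl fun _ _ => Finset.sum_comm
      _ = _ := by
          refine Finset.sum_congr rfl fun k _ => Finset.sum_congr rfl fun l _ =>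
            Finset.sum_congr rfl fun b _ => ?_
          ring
  have e6 : ∑ i, ∑ j, A i j * (G i * Y j) = ∑ i, (∑ k, G k * A k i) * Y i := by
    rw [Finset.sum_comm]
    simp only [Finset.sum_mul]
    exact Finset.sum_congr rfl fun i _ => Finset.sum_congr rfl fun j _ => by ring
  have L1 : ∑ i, ∑ j, (A i j + C i j) * (D j i + F j i) = (∑ i, ∑ j, A i j * D j i) +
      (∑ i, ∑ j, A i j * F j i) + (∑ i, ∑ j, C i j * D j i) + ∑ i, ∑ j, C i j * F j i := by
    simp only [← Finset.sum_add_distrib]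
    exact Finset.sum_congr rfl fun i _ => Finset.sum_congr rfl fun j _ => by ring
  have L2 : ∑ i, ∑ j, ((∑ k, (T k k i j - T j k i k)) +
          ∑ k, ∑ l, (Γ k k l * Γ l i j - Γ k j l * Γ l i k)) * X i * Y j =
      (∑ i, ∑ j, (∑ k, T k k i j) * X i * Y j) - (∑ i, ∑ j, (∑ k, T j k i k) * X i * Y j) +
      (∑ i, ∑ j, (∑ k, ∑ l, Γ k k l * Γ l i j) * X i * Y j) -
      ∑ i, ∑ j, (∑ k, ∑ l, Γ k j l * Γ l i k) * X i * Y j := by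
    simp only [← Finset.sum_add_distrib, ← Finset.sum_sub_distrib]
    refine Finset.sum_congr rfl fun i _ => Finset.sum_congr rfl fun j _ => ?_
    simp only [Finset.sum_sub_distrib, Finset.sum_add_distrib]
    ring
  have R1 : ∑ i, ∑ j, (A i j * (w * G i * Y j + w * D j i) - A i i * (w * G j * Y j + w * D j j)) =
      w * (∑ i, ∑ j, A i j * (G i * Y j)) + w * (∑ i, ∑ j, A i j * D j i) -
        w * ((∑ i, A i i) * (q + ∑ i, D i i)) := by
    rw [hq, ← Finset.sum_add_distrib, Finset.sum_mul_sum]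
    simp only [Finset.mul_sum, ← Finset.sum_add_distrib, ← Finset.sum_sub_distrib]
    exact Finset.sum_congr rfl fun i _ => Finset.sum_congr rfl fun j _ => by ring
  have R2 : ∑ i, (w * G i * ((∑ j, C i j * Y j) - p * Y i) +
        w * ((∑ j, ((∑ k, (T i i k j * X k + Γ i k j * A k i)) * Y j + C i j * D j i)) -
          ((∑ k, ((∑ m, T i m k m) * X k + G k * A k i)) * Y i + p * D i i))) =
      w * (∑ i, G i * ∑ j, C i j * Y j) - w * (p * q) +
      w * ((∑ i, ∑ j, (∑ k, T i i k j * X k) * Y j) + (∑ i, ∑ j, (∑ k, Γ i k j * A k i) * Y j) +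
        (∑ i, ∑ j, C i j * D j i) - (∑ i, (∑ k, (∑ m, T i m k m) * X k) * Y i) -
        (∑ i, (∑ k, G k * A k i) * Y i) - p * ∑ i, D i i) := by
    rw [hq, Finset.mul_sum _ _ p, Finset.mul_sum _ _ p]
    simp only [← Finset.sum_add_distrib, ← Finset.sum_sub_distrib, Finset.mul_sum _ _ w]
    refine Finset.sum_congr rfl fun i _ => ?_
    simp only [Finset.sum_add_distrib, add_mul]
    ring
  rw [L1, L2, R1, R2, e1, e2, e3, e4, e5, e6]
  ring

theorem partialDeriv_sub {N : ℕ} {f h : EuclideanSpace ℝ (Fin N) → ℝ} {y : EuclideanSpace ℝ (Fin N)}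
    (hf : DifferentiableAt ℝ f y) (hh : DifferentiableAt ℝ h y) (i : Fin N) :
    partialDeriv i (fun z => f z - h z) y = partialDeriv i f y - partialDeriv i h y := by
  simp [partialDeriv, fderiv_fun_sub hf hh]

/-- The integrated Bochner identity in a chart, for a `C¹` field `X` and a `C¹` field `Y` with compact support. -/
theorem integral_bochner_eq_zero {N : ℕ} {y₀ : EuclideanSpace ℝ (Fin N)} {r R : ℝ} (hr : 0 < r) (hrR : r < R)
    {w : EuclideanSpace ℝ (Fin N) → ℝ} {Γ : Fin N → Fin N → Fin N → EuclideanSpace ℝ (Fin N) → ℝ}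
    {X Y : Fin N → EuclideanSpace ℝ (Fin N) → ℝ}
    (hw : ∀ y ∈ Metric.closedBall y₀ R, ContDiffAt ℝ 1 w y)
    (hΓ : ∀ k i j, ∀ y ∈ Metric.closedBall y₀ R, ContDiffAt ℝ 1 (Γ k i j) y)
    (hsym : ∀ k i j y, Γ k i j y = Γ k j i y)
    (hdw : ∀ m, ∀ y ∈ Metric.closedBall y₀ R, partialDeriv m w y = w y * ∑ k, Γ k k m y)
    (hX : ∀ i, ∀ y ∈ Metric.closedBall y₀ R, ContDiffAt ℝ 1 (X i) y) (hY : ∀ i, ContDiff ℝ 1 (Y i))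
    (hY0 : ∀ i, ∀ y ∉ Metric.closedBall y₀ r, Y i y = 0) :
    let f := fun y => w y * ((∑ i, ∑ j, (partialDeriv j (X i) y + ∑ k, Γ i k j y * X k y) *
          (partialDeriv i (Y j) y + ∑ k, Γ j k i y * Y k y)) -
        ((∑ i, partialDeriv i (X i) y) + ∑ k, (∑ m, Γ m k m y) * X k y) *
          ((∑ i, partialDeriv i (Y i) y) + ∑ k, (∑ m, Γ m k m y) * Y k y) +
        ∑ i, ∑ j, ((∑ k, (partialDeriv k (Γ k i j) y - partialDeriv j (Γ k i k) y)) +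
          ∑ k, ∑ l, (Γ k k l y * Γ l i j y - Γ k j l y * Γ l i k y)) * X i y * Y j y)
    Integrable f ∧ ∫ y, f y = 0 := by
  intro f
  have hK : IsCompact (Metric.closedBall y₀ r) := isCompact_closedBall _ _
  have hsub : Metric.closedBall y₀ r ⊆ Metric.closedBall y₀ R := Metric.closedBall_subset_closedBall hrR.le
  -- `V` is the Christoffel part of `w (∇_Y X - (div X) Y)`. It is `C¹`, so its divergence
  -- integrates to zero. The remaining part of the flux contains `∂X` and cannot be differentiated
  -- again; it is treated by pairing `∂X` with `∂W`.
  let V : Fin N → EuclideanSpace ℝ (Fin N) → ℝ := fun i y =>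
    w y * ((∑ j, (∑ k, Γ i k j y * X k y) * Y j y) - (∑ k, (∑ m, Γ m k m y) * X k y) * Y i y)
  let W : Fin N → EuclideanSpace ℝ (Fin N) → ℝ := fun j y => w y * Y j y
  have hW0 : ∀ j, ∀ y ∉ Metric.closedBall y₀ r, W j y = 0 := fun j y hy => by simp only [W, hY0 j y hy, mul_zero]
  have hV0 : ∀ j, ∀ y ∉ Metric.closedBall y₀ r, V j y = 0 := fun j y hy => by simp [V, hY0 _ y hy]
  have hW : ∀ j, ContDiff ℝ 1 (W j) := fun j => contDiff_of_eq_zero_off hK (hW0 j) fun y hy =>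
    (hw y (hsub hy)).mul (hY j).contDiffAt
  have hV : ∀ i, ∀ y ∈ Metric.closedBall y₀ r, ContDiffAt ℝ 1 (V i) y := by
    intro i y hy
    have hyR := hsub hy
    refine (hw y hyR).mul (ContDiffAt.sub (ContDiffAt.sum fun j _ => (ContDiffAt.sum fun k _ =>
      (hΓ i k j y hyR).mul (hX k y hyR)).mul (hY j).contDiffAt) ((ContDiffAt.sum fun k _ =>
      (ContDiffAt.sum fun m _ => hΓ m k m y hyR).mul (hX k y hyR)).mul (hY i).contDiffAt))
  have hVc : ∀ i, ContDiff ℝ 1 (V i) := fun i => contDiff_of_eq_zero_off hK (hV0 i) (hV i)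
  have hpt : ∀ y, w y * ((∑ i, ∑ j, (partialDeriv j (X i) y + ∑ k, Γ i k j y * X k y) *
          (partialDeriv i (Y j) y + ∑ k, Γ j k i y * Y k y)) -
        ((∑ i, partialDeriv i (X i) y) + ∑ k, (∑ m, Γ m k m y) * X k y) *
          ((∑ i, partialDeriv i (Y i) y) + ∑ k, (∑ m, Γ m k m y) * Y k y) +
        ∑ i, ∑ j, ((∑ k, (partialDeriv k (Γ k i j) y - partialDeriv j (Γ k i k) y)) +
          ∑ k, ∑ l, (Γ k k l y * Γ l i j y - Γ k j l y * Γ l i k y)) * X i y * Y j y) =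
      (∑ i, ∑ j, (partialDeriv j (X i) y * partialDeriv i (W j) y -
        partialDeriv i (X i) y * partialDeriv j (W j) y)) + ∑ i, partialDeriv i (V i) y := by
    intro y
    by_cases hy : y ∈ Metric.closedBall y₀ r
    · have hyR := hsub hy
      have dw := (hw y hyR).differentiableAt one_ne_zero
      have dΓ := fun k i j => (hΓ k i j y hyR).differentiableAt one_ne_zero
      have dX := fun k => (hX k y hyR).differentiableAt one_ne_zero
      have dY := fun k => (hY k).differentiable one_ne_zero y
      have dG : ∀ k, DifferentiableAt ℝ (fun y => ∑ m, Γ m k m y) y := fun k =>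
        DifferentiableAt.fun_sum fun m _ => dΓ m k m
      have dC : ∀ i j, DifferentiableAt ℝ (fun y => ∑ k, Γ i k j y * X k y) y := fun i j =>
        DifferentiableAt.fun_sum fun k _ => (dΓ i k j).fun_mul (dX k)
      have dp : DifferentiableAt ℝ (fun y => ∑ k, (∑ m, Γ m k m y) * X k y) y :=
        DifferentiableAt.fun_sum fun k _ => (dG k).fun_mul (dX k)
      have d1 : ∀ i, DifferentiableAt ℝ (fun y => ∑ j, (∑ k, Γ i k j y * X k y) * Y j y) y := fun i =>
        DifferentiableAt.fun_sum fun j _ => (dC i j).fun_mul (dY j)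
      have hdw' : ∀ m, partialDeriv m w y = w y * ∑ k, Γ k m k y := fun m => by
        rw [hdw m y hyR]
        exact congrArg _ (Finset.sum_congr rfl fun k _ => hsym _ _ _ _)
      have hWd : ∀ i j, partialDeriv i (W j) y = w y * (∑ m, Γ m i m y) * Y j y + w y * partialDeriv i (Y j) y := by
        intro i j
        rw [partialDeriv_mul dw (dY j), hdw']
      have hVd : ∀ i, partialDeriv i (V i) y = w y * (∑ m, Γ m i m y) * ((∑ j, (∑ k, Γ i k j y * X k y) * Y j y) -
            (∑ k, (∑ m, Γ m k m y) * X k y) * Y i y) +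
          w y * ((∑ j, ((∑ k, (partialDeriv i (Γ i k j) y * X k y + Γ i k j y * partialDeriv i (X k) y)) * Y j y +
            (∑ k, Γ i k j y * X k y) * partialDeriv i (Y j) y)) -
          ((∑ k, ((∑ m, partialDeriv i (Γ m k m) y) * X k y + (∑ m, Γ m k m y) * partialDeriv i (X k) y)) * Y i y +
            (∑ k, (∑ m, Γ m k m y) * X k y) * partialDeriv i (Y i) y)) := by
        intro i
        rw [partialDeriv_mul dw ((d1 i).fun_sub (dp.fun_mul (dY i))), hdw',
          partialDeriv_sub (d1 i) (dp.fun_mul (dY i)), partialDeriv_mul dp (dY i),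
          partialDeriv_sum fun j => (dC i j).fun_mul (dY j), partialDeriv_sum fun k => (dG k).fun_mul (dX k)]
        have e1 : ∀ j, partialDeriv i (fun y => (∑ k, Γ i k j y * X k y) * Y j y) y =
            (∑ k, (partialDeriv i (Γ i k j) y * X k y + Γ i k j y * partialDeriv i (X k) y)) * Y j y +
              (∑ k, Γ i k j y * X k y) * partialDeriv i (Y j) y := by
          intro j
          rw [partialDeriv_mul (dC i j) (dY j), partialDeriv_sum fun k => (dΓ i k j).fun_mul (dX k)]
          simp only [partialDeriv_mul (dΓ i _ j) (dX _)]
        have e2 : ∀ k, partialDeriv i (fun y => (∑ m, Γ m k m y) * X k y) y =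
            (∑ m, partialDeriv i (Γ m k m) y) * X k y + (∑ m, Γ m k m y) * partialDeriv i (X k) y := by
          intro k
          rw [partialDeriv_mul (dG k) (dX k), partialDeriv_sum fun m => dΓ m k m]
        simp only [e1, e2]
      simp only [hWd, hVd]
      exact bochner_algebra (w y) (fun i => X i y) (fun i => Y i y) (fun i j => partialDeriv j (X i) y)
        (fun i j => partialDeriv j (Y i) y) (fun k i j => Γ k i j y) (fun m k i j => partialDeriv m (Γ k i j) y)
        (fun k i j => hsym k i j y)
    · simp [hY0 _ y hy, partialDeriv_eq_zero_of_notMem hK (hY0 _) hy,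
        partialDeriv_eq_zero_of_notMem hK (hW0 _) hy, partialDeriv_eq_zero_of_notMem hK (hV0 _) hy]
  have hi : ∀ i j k l, Integrable fun y => partialDeriv i (X j) y * partialDeriv k (W l) y := fun i j k l =>
    integrable_of_continuousOn_compact hK
      (fun y hy => by rw [partialDeriv_eq_zero_of_notMem hK (hW0 l) hy, mul_zero])
      (ContinuousOn.mul (fun y hy => (ContDiffAt.partialDeriv (n := 0) (hX j y (hsub hy)) i).continuousAt.continuousWithinAt)
        (continuous_partialDeriv (hW l) k).continuousOn)
  have hiV : ∀ i, Integrable fun y => partialDeriv i (V i) y := fun i =>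
    integrable_of_continuousOn_compact hK (fun y hy => partialDeriv_eq_zero_of_notMem hK (hV0 i) hy i)
      (continuous_partialDeriv (hVc i) i).continuousOn
  simp only [f, hpt]
  have hs : ∀ i j, Integrable fun y => partialDeriv j (X i) y * partialDeriv i (W j) y -
      partialDeriv i (X i) y * partialDeriv j (W j) y := fun i j => (hi _ _ _ _).sub (hi _ _ _ _)
  refine ⟨(integrable_finsetSum _ fun i _ => integrable_finsetSum _ fun j _ => hs i j).add
    (integrable_finsetSum _ fun i _ => hiV i), ?_⟩
  rw [integral_add (integrable_finsetSum _ fun i _ => integrable_finsetSum _ fun j _ => hs i j)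
    (integrable_finsetSum _ fun i _ => hiV i),
    integral_finsetSum _ fun i _ => integrable_finsetSum _ fun j _ => hs i j,
    integral_finsetSum _ fun i _ => hiV i]
  rw [Finset.sum_eq_zero, Finset.sum_eq_zero, add_zero]
  · intro i _
    exact integral_partialDeriv_eq_zero hK (hV0 i) (hV i) i
  · intro i _
    rw [integral_finsetSum _ fun j _ => hs i j]
    refine Finset.sum_eq_zero fun j _ => ?_
    rw [integral_sub (hi _ _ _ _) (hi _ _ _ _), sub_eq_zero]
    -- This replaces the commutation of second derivatives of `X`, which need not exist.
    exact integral_partialDeriv_mul_comm hr hrR (hX i) (hW j) (hW0 j) i j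

end Bochner

open scoped MatrixOrder in
/-- A matrix that is self-adjoint for the inner product `G` satisfies `(tr B)² ≤ n tr (B²)`. -/
theorem Matrix.PosDef.sq_trace_le {ι : Type*} [Fintype ι] [DecidableEq ι] {G B : Matrix ι ι ℝ} (hG : G.PosDef)
    (hB : (G * B).transpose = G * B) : B.trace ^ 2 ≤ Fintype.card ι * (B * B).trace := by
  -- With `G⁻¹ = Sᴴ S`, the matrix `S (G C) Sᴴ` is symmetric and its square has the same trace as
  -- `C²`, which is therefore a sum of squares.
  have key : ∀ C : Matrix ι ι ℝ, (G * C).transpose = G * C → 0 ≤ (C * C).trace := by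
    intro C hC
    obtain ⟨S, hS⟩ := CStarAlgebra.nonneg_iff_eq_star_mul_self.mp hG.inv.posSemidef.nonneg
    rw [Matrix.star_eq_conjTranspose] at hS
    have hu : IsUnit G.det := (Matrix.isUnit_iff_isUnit_det _).1 hG.isUnit
    have h1 : C = S.conjTranspose * S * (G * C) := by
      rw [← hS, ← Matrix.mul_assoc, Matrix.nonsing_inv_mul _ hu, Matrix.one_mul]
    have h2 : (C * C).trace = ((S * (G * C) * S.conjTranspose) * (S * (G * C) * S.conjTranspose).conjTranspose).trace := by
      rw [Matrix.conjTranspose_mul, Matrix.conjTranspose_mul, Matrix.conjTranspose_conjTranspose,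
        Matrix.conjTranspose_eq_transpose_of_trivial (G * C), hC]
      conv_lhs => rw [h1]
      rw [Matrix.mul_assoc, Matrix.mul_assoc, Matrix.trace_mul_comm]
      simp only [Matrix.mul_assoc]
    rw [h2]
    exact (Matrix.posSemidef_self_mul_conjTranspose _).trace_nonneg
  rcases isEmpty_or_nonempty ι with hι | hι
  · simp [Matrix.trace]
  have hn : (0 : ℝ) < Fintype.card ι := by exact_mod_cast Fintype.card_pos
  -- The trace-free part of `B`: nonnegativity of the trace of its square is the Cauchy–Schwarz
  -- inequality claimed.
  set t := B.trace / Fintype.card ι with ht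
  have h := key (B - t • 1) (by
    rw [Matrix.mul_sub, Matrix.transpose_sub, hB, Matrix.mul_smul, Matrix.mul_one, Matrix.transpose_smul]
    congr 2
    have := hG.isHermitian
    rwa [Matrix.IsHermitian, Matrix.conjTranspose_eq_transpose_of_trivial] at this)
  have e : ((B - t • 1) * (B - t • 1)).trace = (B * B).trace - B.trace ^ 2 / Fintype.card ι := by
    simp only [Matrix.sub_mul, Matrix.mul_sub, Matrix.smul_mul, Matrix.mul_smul, Matrix.one_mul, Matrix.mul_one,
      Matrix.trace_sub, Matrix.trace_smul, Matrix.trace_one, smul_eq_mul, ht]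
    field_simp
    ring
  rw [e, sub_nonneg, div_le_iff₀ hn] at h
  linarith

/-! ### The Hessian and strict subharmonicity of the squared gradient -/

namespace SmoothMetric

variable {N : ℕ} {M : Type*} [TopologicalSpace M]
  [ChartedSpace (EuclideanSpace ℝ (Fin N)) M] [IsManifold (𝓡 N) ∞ M]

theorem coordDiff_univ {c : M} {y : EuclideanSpace ℝ (Fin N)} (hy : y ∈ (extChartAt (𝓡 N) c).target) {u : M → ℝ}
    (hu : MDifferentiableAt (𝓡 N) 𝓘(ℝ, ℝ) u ((extChartAt (𝓡 N) c).symm y)) (l : Fin N) :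
    coordDiff c Set.univ u l y = partialDeriv l (u ∘ (extChartAt (𝓡 N) c).symm) y := by
  have h := hasFDerivWithinAt_comp_symm hy (S := Set.univ) (u := u) (mdifferentiableWithinAt_univ.2 hu)
  rw [Set.preimage_univ, hasFDerivWithinAt_univ] at h
  rw [partialDeriv, h.fderiv, coordDiff_eq]

theorem eventually_contMDiffAt_symm {c : M} {y : EuclideanSpace ℝ (Fin N)} (hy : y ∈ (extChartAt (𝓡 N) c).target)
    {u : M → ℝ} (hu : ContMDiffAt (𝓡 N) 𝓘(ℝ, ℝ) 2 u ((extChartAt (𝓡 N) c).symm y)) :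
    ∀ᶠ z in 𝓝 y, z ∈ (extChartAt (𝓡 N) c).target ∧
      ContMDiffAt (𝓡 N) 𝓘(ℝ, ℝ) 2 u ((extChartAt (𝓡 N) c).symm z) := by
  exact Filter.Eventually.and ((isOpen_target c).mem_nhds hy)
    ((continuousAt_extChartAt_symm'' hy).eventually ((contMDiffAt_iff_contMDiffAt_nhds (by simp)).1 hu))

theorem contDiffAt_comp_symm {c : M} {y : EuclideanSpace ℝ (Fin N)} (hy : y ∈ (extChartAt (𝓡 N) c).target)
    {u : M → ℝ} {n : ℕ} (hu : ContMDiffAt (𝓡 N) 𝓘(ℝ, ℝ) n u ((extChartAt (𝓡 N) c).symm y)) :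
    ContDiffAt ℝ n (u ∘ (extChartAt (𝓡 N) c).symm) y := by
  have := (contMDiffAt_iff_comp_symm ((extChartAt (𝓡 N) c).map_target hy) u n).1 hu
  rwa [(extChartAt (𝓡 N) c).right_inv hy] at this

theorem contDiffAt_coordComp_grad (g : SmoothMetric N M) {c : M} {y : EuclideanSpace ℝ (Fin N)}
    (hy : y ∈ (extChartAt (𝓡 N) c).target)
    {u : M → ℝ} (hu : ContMDiffAt (𝓡 N) 𝓘(ℝ, ℝ) 2 u ((extChartAt (𝓡 N) c).symm y)) (k : Fin N) :
    ContDiffAt ℝ 1 (coordComp c (g.grad u) k) y := by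
  have h2 := contDiffAt_comp_symm (n := 2) hy hu
  have : ContDiffAt ℝ 1 (fun z => ∑ l, (gram g c z)⁻¹ k l * partialDeriv l (u ∘ (extChartAt (𝓡 N) c).symm) z) y :=
    ContDiffAt.sum fun l _ => (contDiffAt_gram_inv g hy k l 1).mul (ContDiffAt.partialDeriv (n := 1) h2 l)
  refine this.congr_of_eventuallyEq ?_
  filter_upwards [eventually_contMDiffAt_symm hy hu] with z hz
  refine (coordComp_gradWithin g hz.1 Set.univ u k).trans ?_
  exact Finset.sum_congr rfl fun l _ => by rw [coordDiff_univ hz.1 (hz.2.mdifferentiableAt two_ne_zero)]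

theorem fieldC1At_grad (g : SmoothMetric N M) {x : M} {u : M → ℝ} (hu : ContMDiffAt (𝓡 N) 𝓘(ℝ, ℝ) 2 u x) :
    FieldC1At (g.grad u) x := by
  have hx := mem_extChartAt_source (I := 𝓡 N) x
  rw [fieldC1At_iff hx]
  refine fun i => contDiffAt_coordComp_grad g ((extChartAt (𝓡 N) x).map_source hx) ?_ i
  rwa [(extChartAt (𝓡 N) x).left_inv hx]

/-- The components `∇ⱼ Xⁱ` of the covariant derivative of a vector field in the chart at `c`. -/
def covDeriv (g : SmoothMetric N M) (c : M) (X : ∀ x : M, TangentSpace (𝓡 N) x) (i j : Fin N)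
    (y : EuclideanSpace ℝ (Fin N)) : ℝ :=
  partialDeriv j (coordComp c X i) y + ∑ k, christoffel g c i k j y * coordComp c X k y

theorem gram_mul_inv (g : SmoothMetric N M) {c : M} {y : EuclideanSpace ℝ (Fin N)}
    (hy : y ∈ (extChartAt (𝓡 N) c).target) : gram g c y * (gram g c y)⁻¹ = 1 :=
  Matrix.mul_nonsing_inv _ (det_gram_pos g hy).ne'.isUnit

theorem inv_mul_gram (g : SmoothMetric N M) {c : M} {y : EuclideanSpace ℝ (Fin N)}
    (hy : y ∈ (extChartAt (𝓡 N) c).target) : (gram g c y)⁻¹ * gram g c y = 1 :=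
  Matrix.nonsing_inv_mul _ (det_gram_pos g hy).ne'.isUnit

theorem sum_gram_mul_christoffel (g : SmoothMetric N M) {c : M} {y : EuclideanSpace ℝ (Fin N)}
    (hy : y ∈ (extChartAt (𝓡 N) c).target) (l i j : Fin N) :
    ∑ m, gram g c y l m * christoffel g c m i j y = (1 / 2) * (partialDeriv i (fun z => gram g c z j l) y +
      partialDeriv j (fun z => gram g c z i l) y - partialDeriv l (fun z => gram g c z i j) y) := by
  set T : Fin N → ℝ := fun l => partialDeriv i (fun z => gram g c z j l) y +
      partialDeriv j (fun z => gram g c z i l) y - partialDeriv l (fun z => gram g c z i j) y with hT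
  have h1 : ∀ m, gram g c y l m * christoffel g c m i j y =
      ∑ p, (1 / 2) * (gram g c y l m * (gram g c y)⁻¹ m p * T p) := by
    intro m
    rw [christoffel, Finset.mul_sum, Finset.mul_sum]
    exact Finset.sum_congr rfl fun p _ => by simp only [hT]; ring
  have h2 : ∀ p, ∑ m, gram g c y l m * (gram g c y)⁻¹ m p = (1 : Matrix (Fin N) (Fin N) ℝ) l p := fun p => by
    rw [← gram_mul_inv g hy, Matrix.mul_apply]
  simp only [h1]
  rw [Finset.sum_comm]
  simp only [← Finset.mul_sum, ← Finset.sum_mul, h2]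
  simp [Matrix.one_apply, hT]

theorem sum_gram_mul_covDeriv (g : SmoothMetric N M) {c : M} {y : EuclideanSpace ℝ (Fin N)}
    (hy : y ∈ (extChartAt (𝓡 N) c).target) (X : ∀ x : M, TangentSpace (𝓡 N) x) (l j : Fin N) :
    ∑ i, gram g c y l i * covDeriv g c X i j y =
      (∑ i, gram g c y l i * partialDeriv j (coordComp c X i) y) + ∑ k, (1 / 2) *
        (partialDeriv k (fun z => gram g c z j l) y + partialDeriv j (fun z => gram g c z k l) y -
          partialDeriv l (fun z => gram g c z k j) y) * coordComp c X k y := by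
  simp only [covDeriv, mul_add, Finset.sum_add_distrib, Finset.mul_sum]
  congr 1
  rw [Finset.sum_comm]
  refine Finset.sum_congr rfl fun k _ => ?_
  rw [← sum_gram_mul_christoffel g hy, Finset.sum_mul]
  exact Finset.sum_congr rfl fun i _ => by ring

/-- The Hessian of a `C²` function is symmetric. -/
theorem sum_gram_mul_covDeriv_grad_symm (g : SmoothMetric N M) {c : M} {y : EuclideanSpace ℝ (Fin N)}
    (hy : y ∈ (extChartAt (𝓡 N) c).target)
    {u : M → ℝ} (hu : ContMDiffAt (𝓡 N) 𝓘(ℝ, ℝ) 2 u ((extChartAt (𝓡 N) c).symm y)) (l j : Fin N) :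
    ∑ i, gram g c y l i * covDeriv g c (g.grad u) i j y = ∑ i, gram g c y j i * covDeriv g c (g.grad u) i l y := by
  have h2 := contDiffAt_comp_symm (n := 2) hy hu
  have hXd := fun k => (contDiffAt_coordComp_grad g hy hu k).differentiableAt one_ne_zero
  have key : ∀ l j, ∑ i, gram g c y l i * partialDeriv j (coordComp c (g.grad u) i) y =
      partialDeriv j (partialDeriv l (u ∘ (extChartAt (𝓡 N) c).symm)) y -
        ∑ k, partialDeriv j (fun z => gram g c z l k) y * coordComp c (g.grad u) k y := by
    intro l j
    have e : partialDeriv l (u ∘ (extChartAt (𝓡 N) c).symm) =ᶠ[𝓝 y]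
        fun z => ∑ k, gram g c z l k * coordComp c (g.grad u) k z := by
      filter_upwards [eventually_contMDiffAt_symm hy hu] with z hz
      exact ((sum_gram_mul_coordComp_gradWithin g hz.1 Set.univ u l).trans
        (coordDiff_univ hz.1 (hz.2.mdifferentiableAt two_ne_zero) l)).symm
    rw [e.partialDeriv_eq, partialDeriv_sum fun k => (differentiableAt_gram g hy l k).fun_mul (hXd k),
      eq_sub_iff_add_eq, ← Finset.sum_add_distrib]
    refine Finset.sum_congr rfl fun k _ => ?_
    rw [partialDeriv_mul (differentiableAt_gram g hy l k) (hXd k)]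
    ring
  rw [sum_gram_mul_covDeriv g hy, sum_gram_mul_covDeriv g hy, key, key, partialDeriv_comm h2, sub_add, sub_add,
    ← Finset.sum_sub_distrib, ← Finset.sum_sub_distrib]
  congr 1
  refine Finset.sum_congr rfl fun k _ => ?_
  have hs : ∀ a b : Fin N, (fun z => gram g c z a b) = fun z => gram g c z b a := fun a b =>
    funext fun z => gram_symm g c z a b
  rw [hs l k, hs j l, hs j k]
  ring

/-- `∂ₗ |X|² = 2 g(∇ₗ X, X)`. -/
theorem partialDeriv_sum_gram (g : SmoothMetric N M) {c : M} {y : EuclideanSpace ℝ (Fin N)}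
    (hy : y ∈ (extChartAt (𝓡 N) c).target) {X : ∀ x : M, TangentSpace (𝓡 N) x}
    (hX : ∀ i, DifferentiableAt ℝ (coordComp c X i) y) (l : Fin N) :
    partialDeriv l (fun z => ∑ a, ∑ b, gram g c z a b * coordComp c X a z * coordComp c X b z) y =
      2 * ∑ a, coordComp c X a y * ∑ i, gram g c y a i * covDeriv g c X i l y := by
  have hG := fun a b => differentiableAt_gram g hy a b
  rw [partialDeriv_sum fun a => DifferentiableAt.fun_sum fun b _ => ((hG a b).fun_mul (hX a)).fun_mul (hX b)]
  have e1 : ∀ a, partialDeriv l (fun z => ∑ b, gram g c z a b * coordComp c X a z * coordComp c X b z) y =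
      ∑ b, ((partialDeriv l (fun z => gram g c z a b) y * coordComp c X a y +
        gram g c y a b * partialDeriv l (coordComp c X a) y) * coordComp c X b y +
        gram g c y a b * coordComp c X a y * partialDeriv l (coordComp c X b) y) := by
    intro a
    rw [partialDeriv_sum fun b => ((hG a b).fun_mul (hX a)).fun_mul (hX b)]
    refine Finset.sum_congr rfl fun b _ => ?_
    rw [partialDeriv_mul ((hG a b).fun_mul (hX a)) (hX b), partialDeriv_mul (hG a b) (hX a)]
  simp only [e1, sum_gram_mul_covDeriv g hy, mul_add, Finset.sum_add_distrib, add_mul]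
  have e2 : ∑ a, ∑ b, gram g c y a b * partialDeriv l (coordComp c X a) y * coordComp c X b y =
      ∑ a, ∑ b, gram g c y a b * coordComp c X a y * partialDeriv l (coordComp c X b) y := by
    rw [Finset.sum_comm]
    refine Finset.sum_congr rfl fun a _ => Finset.sum_congr rfl fun b _ => ?_
    rw [gram_symm]; ring
  have e3 : ∑ a, coordComp c X a y * ∑ k, (1 / 2) *
        (partialDeriv k (fun z => gram g c z l a) y + partialDeriv l (fun z => gram g c z k a) y -
          partialDeriv a (fun z => gram g c z k l) y) * coordComp c X k y =
      (1 / 2) * ∑ a, ∑ b, partialDeriv l (fun z => gram g c z a b) y * coordComp c X a y * coordComp c X b y := by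
    have h1 : ∑ a, ∑ k, partialDeriv k (fun z => gram g c z l a) y * coordComp c X a y * coordComp c X k y =
        ∑ a, ∑ k, partialDeriv a (fun z => gram g c z k l) y * coordComp c X a y * coordComp c X k y := by
      rw [Finset.sum_comm]
      refine Finset.sum_congr rfl fun a _ => Finset.sum_congr rfl fun b _ => ?_
      rw [show (fun z => gram g c z l b) = fun z => gram g c z b l from funext fun z => gram_symm g c z l b]
      ring
    have h2 : ∑ a, ∑ k, partialDeriv l (fun z => gram g c z k a) y * coordComp c X a y * coordComp c X k y =
        ∑ a, ∑ k, partialDeriv l (fun z => gram g c z a k) y * coordComp c X a y * coordComp c X k y := by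
      refine Finset.sum_congr rfl fun a _ => Finset.sum_congr rfl fun b _ => ?_
      rw [show (fun z => gram g c z b a) = fun z => gram g c z a b from funext fun z => gram_symm g c z b a]
    rw [← h2]
    have h3 : ∑ a, coordComp c X a y * ∑ k, (1 / 2) *
        (partialDeriv k (fun z => gram g c z l a) y + partialDeriv l (fun z => gram g c z k a) y -
          partialDeriv a (fun z => gram g c z k l) y) * coordComp c X k y = (1 / 2) *
        ((∑ a, ∑ k, partialDeriv k (fun z => gram g c z l a) y * coordComp c X a y * coordComp c X k y) +
        (∑ a, ∑ k, partialDeriv l (fun z => gram g c z k a) y * coordComp c X a y * coordComp c X k y) -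
        (∑ a, ∑ k, partialDeriv a (fun z => gram g c z k l) y * coordComp c X a y * coordComp c X k y)) := by
      simp only [← Finset.sum_add_distrib, ← Finset.sum_sub_distrib, Finset.mul_sum]
      exact Finset.sum_congr rfl fun a _ => Finset.sum_congr rfl fun k _ => by ring
    rw [h3, h1]
    ring
  have e4 : ∑ a, coordComp c X a y * ∑ i, gram g c y a i * partialDeriv l (coordComp c X i) y =
      ∑ a, ∑ b, gram g c y a b * coordComp c X a y * partialDeriv l (coordComp c X b) y := by
    simp only [Finset.mul_sum]
    exact Finset.sum_congr rfl fun a _ => Finset.sum_congr rfl fun k _ => by ring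
  rw [e2, e3, e4]
  ring

/-- The gradient of `|∇u|²` is `2 ∇_{∇u} ∇u`. Symmetry of the Hessian is what exchanges the
differentiated index with the contracted one. -/
theorem sum_covDeriv_grad_mul (g : SmoothMetric N M) {c : M} {y : EuclideanSpace ℝ (Fin N)}
    (hy : y ∈ (extChartAt (𝓡 N) c).target)
    {u : M → ℝ} (hu : ContMDiffAt (𝓡 N) 𝓘(ℝ, ℝ) 2 u ((extChartAt (𝓡 N) c).symm y)) (i : Fin N) :
    ∑ l, (gram g c y)⁻¹ i l * partialDeriv l (fun z => ∑ a, ∑ b, gram g c z a b *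
      coordComp c (g.grad u) a z * coordComp c (g.grad u) b z) y =
      2 * ∑ j, covDeriv g c (g.grad u) i j y * coordComp c (g.grad u) j y := by
  have hXd := fun k => (contDiffAt_coordComp_grad g hy hu k).differentiableAt one_ne_zero
  set B : Matrix (Fin N) (Fin N) ℝ := Matrix.of fun i j => covDeriv g c (g.grad u) i j y with hB
  set x : Fin N → ℝ := fun a => coordComp c (g.grad u) a y with hx
  have h1 : (fun l => partialDeriv l (fun z => ∑ a, ∑ b, gram g c z a b *
      coordComp c (g.grad u) a z * coordComp c (g.grad u) b z) y) = (2 : ℝ) • (gram g c y).mulVec (B.mulVec x) := by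
    ext l
    rw [partialDeriv_sum_gram g hy hXd, Matrix.mulVec_mulVec]
    simp only [Pi.smul_apply, smul_eq_mul, Matrix.mulVec, dotProduct, Matrix.mul_apply, hB, Matrix.of_apply]
    congr 1
    refine Finset.sum_congr rfl fun a _ => ?_
    rw [sum_gram_mul_covDeriv_grad_symm g hy hu a l, mul_comm]
  have h2 := congrArg (fun v => (gram g c y)⁻¹.mulVec v i) h1
  simp only [Matrix.mulVec_smul, Matrix.mulVec_mulVec, ← Matrix.mul_assoc, inv_mul_gram g hy, Matrix.one_mul] at h2
  exact h2

/-- The bound `(Δu)² ≤ N |Hess u|²`; the endomorphism `∇_j Xⁱ` is self-adjoint for `g` because `X`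
is a gradient. -/
theorem sq_sum_covDeriv_grad_le (g : SmoothMetric N M) {c : M} {y : EuclideanSpace ℝ (Fin N)}
    (hy : y ∈ (extChartAt (𝓡 N) c).target)
    {u : M → ℝ} (hu : ContMDiffAt (𝓡 N) 𝓘(ℝ, ℝ) 2 u ((extChartAt (𝓡 N) c).symm y)) :
    (∑ i, covDeriv g c (g.grad u) i i y) ^ 2 ≤
      N * ∑ i, ∑ j, covDeriv g c (g.grad u) i j y * covDeriv g c (g.grad u) j i y := by
  have := (gram_posDef g hy).sq_trace_le (B := Matrix.of fun i j => covDeriv g c (g.grad u) i j y) (by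
    ext i j
    simp only [Matrix.transpose_apply, Matrix.mul_apply, Matrix.of_apply]
    exact sum_gram_mul_covDeriv_grad_symm g hy hu j i)
  simpa [Matrix.trace, Matrix.mul_apply] using this

theorem exists_closedBall_chart {x₀ : M} {p : M → Prop} (h : ∀ᶠ x in 𝓝 x₀, p x) :
    ∃ R > 0, ∀ y ∈ Metric.closedBall (extChartAt (𝓡 N) x₀ x₀) R,
      y ∈ (extChartAt (𝓡 N) x₀).target ∧ p ((extChartAt (𝓡 N) x₀).symm y) := by
  have hy := mem_extChartAt_target (I := 𝓡 N) x₀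
  have hc := continuousAt_extChartAt_symm (I := 𝓡 N) x₀
  rw [ContinuousAt, extChartAt_to_inv] at hc
  exact Metric.nhds_basis_closedBall.mem_iff.1
    (Filter.Eventually.and ((isOpen_target x₀).mem_nhds hy) (hc.eventually h))

theorem divergence_symm_eq (g : SmoothMetric N M) {c : M} {y : EuclideanSpace ℝ (Fin N)}
    (hy : y ∈ (extChartAt (𝓡 N) c).target) {X : ∀ x : M, TangentSpace (𝓡 N) x}
    (hX : ∀ i, ContDiffAt ℝ 1 (coordComp c X i) y) :
    g.divergence X ((extChartAt (𝓡 N) c).symm y) = (∑ i, partialDeriv i (coordComp c X i) y) +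
      ∑ k, (∑ m, christoffel g c m k m y) * coordComp c X k y := by
  have hs := (extChartAt (𝓡 N) c).map_target hy
  rw [divergence_eq_coordDiv g hs ((fieldC1At_iff hs X).2 (by rwa [(extChartAt (𝓡 N) c).right_inv hy])),
    (extChartAt (𝓡 N) c).right_inv hy, coordDiv_eq g hy fun i => (hX i).differentiableAt one_ne_zero]
  congr 1
  refine Finset.sum_congr rfl fun m _ => ?_
  rw [mul_comm]
  exact congrArg (· * _) (Finset.sum_congr rfl fun k _ => christoffel_symm g c k k m y)

theorem sum_covDeriv (g : SmoothMetric N M) (c : M) (X : ∀ x : M, TangentSpace (𝓡 N) x) (y : EuclideanSpace ℝ (Fin N)) :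
    ∑ i, covDeriv g c X i i y = (∑ i, partialDeriv i (coordComp c X i) y) +
      ∑ k, (∑ m, christoffel g c m k m y) * coordComp c X k y := by
  simp only [covDeriv, Finset.sum_add_distrib, Finset.sum_mul]
  congr 1
  exact Finset.sum_comm

theorem continuousAt_ricciCoord (g : SmoothMetric N M) {c : M} {y : EuclideanSpace ℝ (Fin N)}
    (hy : y ∈ (extChartAt (𝓡 N) c).target) (i j : Fin N) : ContinuousAt (ricciCoord g c i j) y := by
  have h1 := fun k i j => (contDiffAt_christoffel g hy k i j 0).continuousAt
  have h2 := fun m k i j => ((contDiffAt_christoffel g hy k i j 1).partialDeriv (n := 0) m).continuousAt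
  exact (tendsto_finsetSum _ fun k _ => (h2 _ _ _ _).sub (h2 _ _ _ _)).add
    (tendsto_finsetSum _ fun k _ => tendsto_finsetSum _ fun l _ => ((h1 _ _ _).mul (h1 _ _ _)).sub ((h1 _ _ _).mul (h1 _ _ _)))

theorem contDiffAt_volDensity_mul_gram_inv (g : SmoothMetric N M) {c : M} {y : EuclideanSpace ℝ (Fin N)}
    (hy : y ∈ (extChartAt (𝓡 N) c).target) (i l : Fin N) :
    ContDiffAt ℝ 1 (fun y => volDensity g c y * (gram g c y)⁻¹ i l) y :=
  (contDiffAt_volDensity g hy 1).mul (contDiffAt_gram_inv g hy i l 1)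

theorem sum_volDensity_mul_gram_inv_nonneg (g : SmoothMetric N M) {c : M} {y : EuclideanSpace ℝ (Fin N)}
    (hy : y ∈ (extChartAt (𝓡 N) c).target) (ξ : Fin N → ℝ) :
    0 ≤ ∑ i, ∑ l, volDensity g c y * (gram g c y)⁻¹ i l * ξ l * ξ i := by
  have h := (gram_posDef g hy).inv.posSemidef.dotProduct_mulVec_nonneg ξ
  have e : ∑ i, ∑ l, volDensity g c y * (gram g c y)⁻¹ i l * ξ l * ξ i =
      volDensity g c y * (star ξ ⬝ᵥ (gram g c y)⁻¹.mulVec ξ) := by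
    simp only [dotProduct, Matrix.mulVec, Finset.mul_sum, Pi.star_apply, star_trivial]
    exact Finset.sum_congr rfl fun i _ => Finset.sum_congr rfl fun l _ => by ring
  rw [e]
  exact mul_nonneg (volDensity_pos g hy).le h

/-- A `C²` function `u` with `-Δu = 1` has no local minimum. -/
theorem not_isLocalMax_neg_of_laplacian (g : SmoothMetric N M) {x₀ : M} {u : M → ℝ}
    (hu : ∀ᶠ x in 𝓝 x₀, ContMDiffAt (𝓡 N) 𝓘(ℝ, ℝ) 2 u x) (hlap : ∀ᶠ x in 𝓝 x₀, -g.laplacian u x = 1) :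
    ¬ IsLocalMax (fun x => - u x) x₀ := by
  intro hmax
  obtain ⟨R, hR, hball⟩ := exists_closedBall_chart (N := N) (hu.and hlap)
  set y₀ := extChartAt (𝓡 N) x₀ x₀ with hy₀
  have hsub : Metric.closedBall y₀ (R / 2) ⊆ Metric.closedBall y₀ R := Metric.closedBall_subset_closedBall (by linarith)
  have hK : IsCompact (Metric.closedBall y₀ (R / 2)) := isCompact_closedBall _ _
  set X : Fin N → EuclideanSpace ℝ (Fin N) → ℝ := coordComp x₀ (g.grad u) with hXdef
  have hX : ∀ i, ∀ y ∈ Metric.closedBall y₀ R, ContDiffAt ℝ 1 (X i) y := fun i y hy =>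
    contDiffAt_coordComp_grad g (hball y hy).1 (hball y hy).2.1 i
  have hw : ∀ y ∈ Metric.closedBall y₀ R, ContDiffAt ℝ 1 (volDensity g x₀) y := fun y hy =>
    contDiffAt_volDensity g (hball y hy).1 1
  have hvd : ∀ y ∈ Metric.closedBall y₀ R, ContDiffAt ℝ 2 (fun y => u ((extChartAt (𝓡 N) x₀).symm y)) y := fun y hy =>
    contDiffAt_comp_symm (n := 2) (hball y hy).1 (hball y hy).2.1
  refine not_isLocalMax_of_weak_subharmonic hR (v := fun y => - u ((extChartAt (𝓡 N) x₀).symm y))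
    (F := volDensity g x₀)
    (a := fun i l y => volDensity g x₀ y * (gram g x₀ y)⁻¹ i l)
    (fun i l y hy => contDiffAt_volDensity_mul_gram_inv g (hball y hy).1 i l)
    (fun y hy => sum_volDensity_mul_gram_inv_nonneg g (hball y hy).1)
    (fun y hy => ((hvd y hy).of_le one_le_two).neg) (fun y hy => (hw y hy).continuousAt)
    (volDensity_pos g (mem_extChartAt_target x₀)) ?_ ?_
  · intro φ hφ hφ0 hφs
    -- The flux `φ w ∇u` has compact support, so integrating its divergence gives the weak form of
    -- `Δ(-u) = 1` with equality.
    let Z : Fin N → EuclideanSpace ℝ (Fin N) → ℝ := fun i y => φ y * (volDensity g x₀ y * X i y)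
    have hZ0 : ∀ i, ∀ y ∉ Metric.closedBall y₀ (R / 2), Z i y = 0 := fun i y hy => by simp only [Z, hφs y hy, zero_mul]
    have hZ : ∀ i, ∀ y ∈ Metric.closedBall y₀ (R / 2), ContDiffAt ℝ 1 (Z i) y := fun i y hy =>
      hφ.contDiffAt.mul ((hw y (hsub hy)).mul (hX i y (hsub hy)))
    have hZi : ∀ i, Integrable fun y => partialDeriv i (Z i) y := fun i =>
      integrable_of_continuousOn_compact hK (fun y hy => partialDeriv_eq_zero_of_notMem hK (hZ0 i) hy i)
        (continuous_partialDeriv (contDiff_of_eq_zero_off hK (hZ0 i) (hZ i)) i).continuousOn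
    have hpt : ∀ y, ∑ i, ∑ l, volDensity g x₀ y * (gram g x₀ y)⁻¹ i l *
        partialDeriv l (fun y => - u ((extChartAt (𝓡 N) x₀).symm y)) y * partialDeriv i φ y =
        - (volDensity g x₀ y * φ y) - ∑ i, partialDeriv i (Z i) y := by
      intro y
      by_cases hy : y ∈ Metric.closedBall y₀ (R / 2)
      · have hyR := hsub hy
        obtain ⟨hyt, hyu, hyl⟩ := hball y hyR
        have dw := (hw y hyR).differentiableAt one_ne_zero
        have dX := fun i => (hX i y hyR).differentiableAt one_ne_zero
        have e1 : ∀ i, ∑ l, (gram g x₀ y)⁻¹ i l * partialDeriv l (fun y => u ((extChartAt (𝓡 N) x₀).symm y)) y = X i y := by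
          intro i
          refine Eq.trans ?_ (coordComp_gradWithin g hyt Set.univ u i).symm
          exact Finset.sum_congr rfl fun l _ => by
            rw [coordDiff_univ hyt (hyu.mdifferentiableAt two_ne_zero)]; rfl
        have e2 : ∀ l, partialDeriv l (fun y => - u ((extChartAt (𝓡 N) x₀).symm y)) y =
            - partialDeriv l (fun y => u ((extChartAt (𝓡 N) x₀).symm y)) y := fun l => by
          simp [partialDeriv, fderiv_fun_neg]
        have e3 : ∑ i, partialDeriv i (fun y => volDensity g x₀ y * X i y) y = - volDensity g x₀ y := by
          have h1 := divergence_eq_coordDiv g ((extChartAt (𝓡 N) x₀).map_target hyt) (fieldC1At_grad g hyu)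
          rw [(extChartAt (𝓡 N) x₀).right_inv hyt, coordDiv] at h1
          have h2 : g.divergence (g.grad u) ((extChartAt (𝓡 N) x₀).symm y) = -1 := by
            rw [← hyl, neg_neg]; rfl
          have := (volDensity_pos g hyt).ne'
          rw [h2, inv_mul_eq_div, eq_div_iff this] at h1
          linarith
        have e4 : ∀ i, partialDeriv i (Z i) y = partialDeriv i φ y * (volDensity g x₀ y * X i y) +
            φ y * partialDeriv i (fun y => volDensity g x₀ y * X i y) y := fun i =>
          partialDeriv_mul (hφ.differentiable one_ne_zero y) (dw.fun_mul (dX i)) i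
        simp only [e2, e4, Finset.sum_add_distrib, ← Finset.mul_sum, e3]
        have e5 : ∀ i, ∑ l, volDensity g x₀ y * (gram g x₀ y)⁻¹ i l *
            -partialDeriv l (fun y => u ((extChartAt (𝓡 N) x₀).symm y)) y * partialDeriv i φ y =
            - (partialDeriv i φ y * (volDensity g x₀ y * X i y)) := fun i => by
          rw [← e1, Finset.mul_sum, Finset.mul_sum, ← Finset.sum_neg_distrib]
          exact Finset.sum_congr rfl fun l _ => by ring
        simp only [e5, Finset.sum_neg_distrib]
        ring
      · simp [hφs y hy, partialDeriv_eq_zero_of_notMem hK hφs hy, partialDeriv_eq_zero_of_notMem hK (hZ0 _) hy]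
    have hi : Integrable fun y => volDensity g x₀ y * φ y := integrable_of_continuousOn_compact hK
      (fun y hy => by rw [hφs y hy, mul_zero])
      (ContinuousOn.mul (fun y hy => (hw y (hsub hy)).continuousAt.continuousWithinAt) hφ.continuous.continuousOn)
    have hin : Integrable fun y => -(volDensity g x₀ y * φ y) := hi.neg
    simp only [hpt]
    rw [integral_sub hin (integrable_finsetSum _ fun i _ => hZi i), integral_neg,
      integral_finsetSum _ fun i _ => hZi i,
      Finset.sum_eq_zero fun i _ => integral_partialDeriv_eq_zero hK (hZ0 i) (hZ i) i, sub_zero]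
  · have hc := continuousAt_extChartAt_symm (I := 𝓡 N) x₀
    rw [ContinuousAt, extChartAt_to_inv] at hc
    filter_upwards [hc.eventually hmax] with y hy
    rw [hy₀, extChartAt_to_inv]
    exact hy

/-- If `-Δu = 1` near `x₀` and `Ric(∇u, ∇u) > -1/N` at `x₀`, then `|∇u|²` has no local maximum at `x₀`. -/
theorem not_isLocalMax_inner_grad (hN : 0 < N) (g : SmoothMetric N M) {x₀ : M} {u : M → ℝ}
    (hu : ∀ᶠ x in 𝓝 x₀, ContMDiffAt (𝓡 N) 𝓘(ℝ, ℝ) 2 u x) (hlap : ∀ᶠ x in 𝓝 x₀, -g.laplacian u x = 1)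
    (hric : g.ricci (g.grad u) x₀ > -1 / (N : ℝ)) :
    ¬ IsLocalMax (fun x => g.inner x (g.grad u x) (g.grad u x)) x₀ := by
  intro hmax
  have hN' : (0 : ℝ) < N := by exact_mod_cast hN
  obtain ⟨R, hR, hball⟩ := exists_closedBall_chart (N := N) (hu.and hlap)
  set y₀ := extChartAt (𝓡 N) x₀ x₀ with hy₀
  have hsub : Metric.closedBall y₀ (R / 2) ⊆ Metric.closedBall y₀ R := Metric.closedBall_subset_closedBall (by linarith)
  have hK : IsCompact (Metric.closedBall y₀ (R / 2)) := isCompact_closedBall _ _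
  set X : Fin N → EuclideanSpace ℝ (Fin N) → ℝ := coordComp x₀ (g.grad u) with hXdef
  have hX : ∀ i, ∀ y ∈ Metric.closedBall y₀ R, ContDiffAt ℝ 1 (X i) y := fun i y hy =>
    contDiffAt_coordComp_grad g (hball y hy).1 (hball y hy).2.1 i
  have hw : ∀ y ∈ Metric.closedBall y₀ R, ContDiffAt ℝ 1 (volDensity g x₀) y := fun y hy =>
    contDiffAt_volDensity g (hball y hy).1 1
  set v : EuclideanSpace ℝ (Fin N) → ℝ := fun y => ∑ a, ∑ b, gram g x₀ y a b * X a y * X b y with hv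
  have hvC : ∀ y ∈ Metric.closedBall y₀ R, ContDiffAt ℝ 1 v y := fun y hy =>
    ContDiffAt.sum fun a _ => ContDiffAt.sum fun b _ =>
      ((contDiffAt_gram g (hball y hy).1 a b 1).mul (hX a y hy)).mul (hX b y hy)
  -- The weak lower bound for `w Δ|∇u|²`. It is positive at `x₀` by the curvature hypothesis and
  -- continuous, so the hypothesis at the one point is enough.
  set F : EuclideanSpace ℝ (Fin N) → ℝ := fun y => 2 * (volDensity g x₀ y *
    (1 / N + ∑ i, ∑ j, ricciCoord g x₀ i j y * X i y * X j y)) with hF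
  have hFc : ∀ y ∈ Metric.closedBall y₀ R, ContinuousAt F y := fun y hy =>
    continuousAt_const.mul ((hw y hy).continuousAt.mul (continuousAt_const.add
      (tendsto_finsetSum _ fun i _ => tendsto_finsetSum _ fun j _ =>
        ((continuousAt_ricciCoord g (hball y hy).1 i j).mul (hX i y hy).continuousAt).mul (hX j y hy).continuousAt)))
  refine not_isLocalMax_of_weak_subharmonic hR (v := v) (F := F)
    (a := fun i l y => volDensity g x₀ y * (gram g x₀ y)⁻¹ i l)
    (fun i l y hy => contDiffAt_volDensity_mul_gram_inv g (hball y hy).1 i l)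
    (fun y hy => sum_volDensity_mul_gram_inv_nonneg g (hball y hy).1) hvC hFc ?_ ?_ ?_
  · refine mul_pos two_pos (mul_pos (volDensity_pos g (mem_extChartAt_target x₀)) ?_)
    have : g.ricci (g.grad u) x₀ = ∑ i, ∑ j, ricciCoord g x₀ i j y₀ * X i y₀ * X j y₀ := rfl
    rw [this, neg_div] at hric
    linarith
  · intro φ hφ hφ0 hφs
    -- Bochner is tested with `Y = φ ∇u`: the derivative of `φ` produces half the weak form of
    -- `Δ|∇u|²`, and the derivative of `∇u` produces `φ |Hess u|²`.
    let Y : Fin N → EuclideanSpace ℝ (Fin N) → ℝ := fun i y => φ y * X i y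
    have hY0 : ∀ i, ∀ y ∉ Metric.closedBall y₀ (R / 2), Y i y = 0 := fun i y hy => by simp only [Y, hφs y hy, zero_mul]
    have hYC : ∀ i, ContDiff ℝ 1 (Y i) := fun i => contDiff_of_eq_zero_off hK (hY0 i) fun y hy =>
      hφ.contDiffAt.mul (hX i y (hsub hy))
    let Z : Fin N → EuclideanSpace ℝ (Fin N) → ℝ := fun i y => volDensity g x₀ y * Y i y
    have hZ0 : ∀ i, ∀ y ∉ Metric.closedBall y₀ (R / 2), Z i y = 0 := fun i y hy => by simp only [Z, hY0 i y hy, mul_zero]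
    have hZ : ∀ i, ∀ y ∈ Metric.closedBall y₀ (R / 2), ContDiffAt ℝ 1 (Z i) y := fun i y hy =>
      (hw y (hsub hy)).mul (hYC i).contDiffAt
    have hZi : ∀ i, Integrable fun y => partialDeriv i (Z i) y := fun i =>
      integrable_of_continuousOn_compact hK (fun y hy => partialDeriv_eq_zero_of_notMem hK (hZ0 i) hy i)
        (continuous_partialDeriv (contDiff_of_eq_zero_off hK (hZ0 i) (hZ i)) i).continuousOn
    obtain ⟨hBi, hB⟩ := integral_bochner_eq_zero (half_pos hR) (half_lt_self hR) hw
      (fun k i j y hy => contDiffAt_christoffel g (hball y hy).1 k i j 1)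
      (fun k i j y => christoffel_symm g x₀ k i j y)
      (fun m y hy => partialDeriv_volDensity_eq_christoffel g (hball y hy).1 m) hX hYC hY0
    set β : EuclideanSpace ℝ (Fin N) → ℝ := fun y => volDensity g x₀ y *
        ((∑ i, ∑ j, (partialDeriv j (X i) y + ∑ k, christoffel g x₀ i k j y * X k y) *
          (partialDeriv i (Y j) y + ∑ k, christoffel g x₀ j k i y * Y k y)) -
        ((∑ i, partialDeriv i (X i) y) + ∑ k, (∑ m, christoffel g x₀ m k m y) * X k y) *
          ((∑ i, partialDeriv i (Y i) y) + ∑ k, (∑ m, christoffel g x₀ m k m y) * Y k y) +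
        ∑ i, ∑ j, ricciCoord g x₀ i j y * X i y * Y j y) with hβ
    change Integrable β at hBi
    change ∫ y, β y = 0 at hB
    -- The only loss is `tr (B²) ≥ 1/N`. Since `div ∇u = -1`, the product of divergences in the
    -- Bochner integrand equals `-div Y`; this is why `∂ᵢ Zᵢ`, the density times `div Y`, is
    -- subtracted, and it integrates to zero.
    have hle : ∀ y, (∑ i, ∑ l, volDensity g x₀ y * (gram g x₀ y)⁻¹ i l * partialDeriv l v y * partialDeriv i φ y) +
        F y * φ y ≤ 2 * β y - 2 * ∑ i, partialDeriv i (Z i) y := by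
      intro y
      by_cases hy : y ∈ Metric.closedBall y₀ (R / 2)
      · have hyR := hsub hy
        obtain ⟨hyt, hyu, hyl⟩ := hball y hyR
        have dw := (hw y hyR).differentiableAt one_ne_zero
        have dX := fun i => (hX i y hyR).differentiableAt one_ne_zero
        have dφ := hφ.differentiable one_ne_zero y
        have hdiv : (∑ i, partialDeriv i (X i) y) + ∑ k, (∑ m, christoffel g x₀ m k m y) * X k y = -1 := by
          rw [hXdef, ← divergence_symm_eq g hyt fun i => hX i y hyR, ← hyl, neg_neg]; rfl
        set B : Fin N → Fin N → ℝ := fun i j => covDeriv g x₀ (g.grad u) i j y with hBdef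
        have hBe : ∀ i j, partialDeriv j (X i) y + ∑ k, christoffel g x₀ i k j y * X k y = B i j := fun i j => rfl
        have hYe : ∀ i j, partialDeriv i (Y j) y + ∑ k, christoffel g x₀ j k i y * Y k y =
            φ y * B j i + partialDeriv i φ y * X j y := by
          intro i j
          rw [partialDeriv_mul dφ (dX j), ← hBe, mul_add, Finset.mul_sum]
          have : ∀ k, christoffel g x₀ j k i y * Y k y = φ y * (christoffel g x₀ j k i y * X k y) := fun k => by
            simp only [Y]; ring
          simp only [this]
          ring
        have htr := sq_sum_covDeriv_grad_le g hyt hyu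
        rw [sum_covDeriv, ← hXdef, hdiv] at htr
        have htr' : 1 / (N : ℝ) ≤ ∑ i, ∑ j, B i j * B j i := by
          rw [div_le_iff₀ hN']
          linarith
        have e1 : ∑ i, ∑ l, volDensity g x₀ y * (gram g x₀ y)⁻¹ i l * partialDeriv l v y * partialDeriv i φ y =
            2 * (volDensity g x₀ y * ∑ i, ∑ j, B i j * (partialDeriv i φ y * X j y)) := by
          have h1 := fun i => sum_covDeriv_grad_mul g hyt hyu i
          simp only [Finset.mul_sum]
          refine Finset.sum_congr rfl fun i _ => ?_
          calc _ = volDensity g x₀ y * partialDeriv i φ y * ∑ l, (gram g x₀ y)⁻¹ i l * partialDeriv l v y := by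
                rw [Finset.mul_sum]; exact Finset.sum_congr rfl fun l _ => by ring
            _ = volDensity g x₀ y * partialDeriv i φ y * (2 * ∑ j, B i j * X j y) := congrArg _ (h1 i)
            _ = _ := by
                rw [Finset.mul_sum, Finset.mul_sum]; exact Finset.sum_congr rfl fun l _ => by ring
        have e2 : ∑ i, ∑ j, B i j * (φ y * B j i + partialDeriv i φ y * X j y) =
            φ y * (∑ i, ∑ j, B i j * B j i) + ∑ i, ∑ j, B i j * (partialDeriv i φ y * X j y) := by
          simp only [Finset.mul_sum, ← Finset.sum_add_distrib]
          exact Finset.sum_congr rfl fun i _ => Finset.sum_congr rfl fun j _ => by ring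
        have e3 : ∑ i, ∑ j, ricciCoord g x₀ i j y * X i y * Y j y =
            φ y * ∑ i, ∑ j, ricciCoord g x₀ i j y * X i y * X j y := by
          simp only [Finset.mul_sum, Y]
          exact Finset.sum_congr rfl fun i _ => Finset.sum_congr rfl fun j _ => by ring
        have e4 : ∑ i, partialDeriv i (Z i) y = volDensity g x₀ y * ((∑ i, partialDeriv i (Y i) y) +
            ∑ k, (∑ m, christoffel g x₀ m k m y) * Y k y) := by
          rw [mul_add, Finset.mul_sum, Finset.mul_sum, ← Finset.sum_add_distrib]
          refine Finset.sum_congr rfl fun i _ => ?_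
          rw [partialDeriv_mul dw ((hYC i).differentiable one_ne_zero y),
            partialDeriv_volDensity_eq_christoffel g hyt i]
          simp only [christoffel_symm g x₀ _ _ i y]
          ring
        have hwp := volDensity_pos g hyt
        simp only [hβ, hF, hBe, hYe, hdiv, e1, e2, e3, e4]
        have := mul_le_mul_of_nonneg_left htr' (mul_nonneg hwp.le (hφ0 y))
        linarith
      · simp [hβ, hφs y hy, hY0 _ y hy, partialDeriv_eq_zero_of_notMem hK hφs hy, partialDeriv_eq_zero_of_notMem hK (hZ0 _) hy,
          partialDeriv_eq_zero_of_notMem hK (hY0 _) hy]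
    have hi1 : Integrable fun y => ∑ i, ∑ l, volDensity g x₀ y * (gram g x₀ y)⁻¹ i l * partialDeriv l v y * partialDeriv i φ y := by
      refine integrable_finsetSum _ fun i _ => integrable_finsetSum _ fun l _ => ?_
      exact integrable_of_continuousOn_compact hK
        (fun y hy => by rw [partialDeriv_eq_zero_of_notMem hK hφs hy, mul_zero])
        (ContinuousOn.mul (ContinuousOn.mul (fun y hy =>
            (contDiffAt_volDensity_mul_gram_inv g (hball y (hsub hy)).1 i l).continuousAt.continuousWithinAt)
          (fun y hy => (ContDiffAt.partialDeriv (n := 0) (hvC y (hsub hy)) l).continuousAt.continuousWithinAt))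
          (continuous_partialDeriv hφ i).continuousOn)
    have hi2 : Integrable fun y => F y * φ y := integrable_of_continuousOn_compact hK
      (fun y hy => by rw [hφs y hy, mul_zero])
      (ContinuousOn.mul (fun y hy => (hFc y (hsub hy)).continuousWithinAt) hφ.continuous.continuousOn)
    have hi3 : Integrable fun y => ∑ i, partialDeriv i (Z i) y := integrable_finsetSum _ fun i _ => hZi i
    have h := integral_mono (hi1.add hi2) ((hBi.const_mul 2).sub (hi3.const_mul 2)) hle
    simp only [Pi.add_apply, Pi.sub_apply] at h
    rw [integral_add hi1 hi2, integral_sub (hBi.const_mul 2) (hi3.const_mul 2), integral_const_mul, integral_const_mul,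
      hB, integral_finsetSum _ fun i _ => hZi i,
      Finset.sum_eq_zero fun i _ => integral_partialDeriv_eq_zero hK (hZ0 i) (hZ i) i] at h
    linarith
  · have hc := continuousAt_extChartAt_symm (I := 𝓡 N) x₀
    rw [ContinuousAt, extChartAt_to_inv] at hc
    have hve : ∀ y ∈ (extChartAt (𝓡 N) x₀).target, v y = g.inner ((extChartAt (𝓡 N) x₀).symm y)
        (g.grad u ((extChartAt (𝓡 N) x₀).symm y)) (g.grad u ((extChartAt (𝓡 N) x₀).symm y)) := fun y hy =>
      (inner_eq_sum g hy (g.grad u) (g.grad u)).symm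
    filter_upwards [hc.eventually hmax, (isOpen_target x₀).mem_nhds (mem_extChartAt_target x₀)] with y hy hyt
    rw [hve y hyt, hve y₀ (mem_extChartAt_target x₀), hy₀, extChartAt_to_inv]
    exact hy

/-! ### Behaviour of `u` and its gradient at the boundary -/

section Boundary

variable {Ω : Set M} {ρ : M → ℝ} {c : M} {y : EuclideanSpace ℝ (Fin N)}

theorem _root_.IsLocalDefiningFunction.eq_zero {p : M} (hρ : IsLocalDefiningFunction (N := N) Ω p ρ) (hΩ : IsOpen Ω)
    (hp : p ∈ frontier Ω) : ρ p = 0 := by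
  obtain ⟨-, U, hU, hpU, hs, hΩU⟩ := hρ
  have hc : ContinuousAt ρ p := (hs.contMDiffAt (hU.mem_nhds hpU)).continuousAt
  rw [hΩ.frontier_eq] at hp
  refine le_antisymm ?_ ?_
  · have : p ∈ closure (Ω ∩ U) := by
      rw [Set.inter_comm]
      exact hU.inter_closure ⟨hpU, hp.1⟩
    rw [hΩU] at this
    refine le_of_tendsto_of_frequently (b := 0) hc ?_
    rw [mem_closure_iff_frequently] at this
    exact this.mono fun x hx => hx.2.le
  · by_contra h
    have : p ∈ Ω ∩ U := by rw [hΩU]; exact ⟨hpU, not_le.1 h⟩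
    exact hp.2 this.1

theorem coordDeriv_univ_ne_zero (hy : y ∈ (extChartAt (𝓡 N) c).target)
    (h : mfderiv (𝓡 N) 𝓘(ℝ, ℝ) ρ ((extChartAt (𝓡 N) c).symm y) ≠ 0) : coordDeriv c Set.univ ρ y ≠ 0 := by
  intro h0
  apply h
  have h1 : ∀ l, coordDiff c Set.univ ρ l y = 0 := fun l => by rw [coordDiff_eq, h0]; rfl
  let L : TangentSpace (𝓡 N) ((extChartAt (𝓡 N) c).symm y) →L[ℝ] ℝ :=
    mfderivWithin (𝓡 N) 𝓘(ℝ, ℝ) ρ Set.univ ((extChartAt (𝓡 N) c).symm y)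
  have hL : L = 0 := by
    ext v
    have hs := (extChartAt (𝓡 N) c).map_target hy
    rw [← exists_constField_eq hs v, ← sum_coordComp_smul_coordVec hy (constField c _), map_sum]
    refine Finset.sum_eq_zero fun i _ => ?_
    rw [map_smul]
    exact (congrArg _ (h1 i)).trans (smul_zero _)
  rw [← mfderivWithin_univ]
  exact hL

/-- Directions along which a defining function decreases point into the domain. -/
theorem eventually_mem_of_coordDeriv_neg (hΩ : IsOpen Ω) (hy : y ∈ (extChartAt (𝓡 N) c).target)
    (hp : (extChartAt (𝓡 N) c).symm y ∈ frontier Ω)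
    (hρ : IsLocalDefiningFunction (N := N) Ω ((extChartAt (𝓡 N) c).symm y) ρ)
    {w : EuclideanSpace ℝ (Fin N)} (hw : coordDeriv c Set.univ ρ y w < 0) :
    ∀ᶠ s : ℝ in 𝓝[>] 0, y + s • w ∈ (extChartAt (𝓡 N) c).target ∧ (extChartAt (𝓡 N) c).symm (y + s • w) ∈ Ω := by
  have h0 := hρ.eq_zero hΩ hp
  obtain ⟨-, U, hU, hpU, hs, hΩU⟩ := hρ
  have hd : MDifferentiableAt (𝓡 N) 𝓘(ℝ, ℝ) ρ ((extChartAt (𝓡 N) c).symm y) :=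
    (hs.contMDiffAt (hU.mem_nhds hpU)).mdifferentiableAt (by simp)
  have hF := hasFDerivWithinAt_comp_symm hy (S := Set.univ) (u := ρ) (mdifferentiableWithinAt_univ.2 hd)
  rw [Set.preimage_univ, hasFDerivWithinAt_univ] at hF
  have hline : HasDerivAt (fun s : ℝ => y + s • w) w 0 := by
    simpa using ((hasDerivAt_id (0 : ℝ)).smul_const w).const_add y
  have hD : HasDerivAt (fun s : ℝ => ρ ((extChartAt (𝓡 N) c).symm (y + s • w))) (coordDeriv c Set.univ ρ y w) 0 :=

    HasFDerivAt.comp_hasDerivAt (l := ρ ∘ (extChartAt (𝓡 N) c).symm) (f := fun s : ℝ => y + s • w) (0 : ℝ)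
      (by simpa using hF) hline
  have hcont : Filter.Tendsto (fun s : ℝ => y + s • w) (𝓝[>] 0) (𝓝 y) := by
    have := hline.continuousAt.tendsto
    simp only [zero_smul, add_zero] at this
    exact this.mono_left nhdsWithin_le_nhds
  have hslope := (hasDerivAt_iff_tendsto_slope.1 hD).mono_left (nhdsWithin_mono (0 : ℝ) (fun s (hs : 0 < s) => hs.ne'))
  have hneg := hslope.eventually (gt_mem_nhds hw)
  have hUn := hcont.eventually ((continuousAt_extChartAt_symm'' hy).eventually (hU.mem_nhds hpU))
  filter_upwards [hneg, hUn, hcont.eventually ((isOpen_target c).mem_nhds hy), self_mem_nhdsWithin] with s h1 h2 h3 h4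
  refine ⟨h3, ?_⟩
  have h5 : ρ ((extChartAt (𝓡 N) c).symm (y + s • w)) < 0 := by
    rw [slope_def_field, sub_zero, zero_smul, add_zero, h0, sub_zero] at h1
    have := (div_lt_iff₀ (Set.mem_Ioi.1 h4)).1 h1
    linarith
  have h6 : (extChartAt (𝓡 N) c).symm (y + s • w) ∈ Ω ∩ U := by rw [hΩU]; exact ⟨h2, h5⟩
  exact h6.1

/-- Any vector becomes an element of the half-space after adding a large multiple of one element
`w₀`. This supplies the spanning tangent directions for unique differentiability at boundary points.
-/
theorem span_halfspace {L : EuclideanSpace ℝ (Fin N) →L[ℝ] ℝ} (hL : L ≠ 0) :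
    Submodule.span ℝ {w | L w < 0} = ⊤ := by
  obtain ⟨w₀, hw₀⟩ : ∃ w, L w < 0 := by
    obtain ⟨w, hw⟩ : ∃ w, L w ≠ 0 := by
      by_contra! h
      exact hL (ContinuousLinearMap.ext h)
    rcases lt_or_gt_of_ne hw with h | h
    · exact ⟨w, h⟩
    · exact ⟨-w, by simpa using h⟩
  refine eq_top_iff.2 fun w _ => ?_
  have h1 : L (w + ((|L w| + 1) / (- L w₀)) • w₀) < 0 := by
    rw [map_add, map_smul, smul_eq_mul]
    have : (|L w| + 1) / (- L w₀) * L w₀ = -(|L w| + 1) := by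
      have := hw₀.ne
      field_simp
    rw [this]
    linarith [le_abs_self (L w)]
  have h2 : w + ((|L w| + 1) / (- L w₀)) • w₀ ∈ Submodule.span ℝ {w | L w < 0} := Submodule.subset_span h1
  have h3 : w₀ ∈ Submodule.span ℝ {w | L w < 0} := Submodule.subset_span hw₀
  have := Submodule.sub_mem _ h2 (Submodule.smul_mem _ ((|L w| + 1) / (- L w₀)) h3)
  rwa [add_sub_cancel_right] at this

/-- Without unique differentiability the derivative within `closure Ω` would be an arbitrary choice
at boundary points. At such a point the tangent cone contains every direction along which the
defining function decreases. -/
theorem uniqueDiffOn_closure (hΩ : IsSmoothDomain N Ω) (c : M) :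
    UniqueDiffOn ℝ ((extChartAt (𝓡 N) c).target ∩ (extChartAt (𝓡 N) c).symm ⁻¹' closure Ω) := by
  intro y ⟨hy, hyc⟩
  by_cases hyΩ : (extChartAt (𝓡 N) c).symm y ∈ Ω
  · refine UniqueDiffWithinAt.mono (s := (extChartAt (𝓡 N) c).target ∩ (extChartAt (𝓡 N) c).symm ⁻¹' Ω) ?_
      (Set.inter_subset_inter_right _ (Set.preimage_mono subset_closure))
    exact ((continuousOn_extChartAt_symm c).isOpen_inter_preimage (isOpen_target c) hΩ.isOpen).uniqueDiffWithinAt ⟨hy, hyΩ⟩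
  · have hp : (extChartAt (𝓡 N) c).symm y ∈ frontier Ω := by
      rw [hΩ.isOpen.frontier_eq]; exact ⟨hyc, hyΩ⟩
    obtain ⟨ρ, hρ⟩ := hΩ.smooth_boundary _ hp
    have hL := coordDeriv_univ_ne_zero hy hρ.1
    refine ⟨?_, subset_closure ⟨hy, hyc⟩⟩
    have : Submodule.span ℝ (tangentConeAt ℝ ((extChartAt (𝓡 N) c).target ∩ (extChartAt (𝓡 N) c).symm ⁻¹' closure Ω) y) = ⊤ := by
      refine eq_top_iff.2 (le_of_eq_of_le (span_halfspace hL).symm (Submodule.span_mono fun w hw => ?_))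
      refine mem_tangentConeAt_of_add_smul_mem (l := 𝓝[>] (0 : ℝ)) (c := fun s => s)
        (nhdsWithin_mono (0 : ℝ) (fun s (hs : 0 < s) => hs.ne')) ?_
      filter_upwards [eventually_mem_of_coordDeriv_neg hΩ.isOpen hy hp hρ hw] with s hs
      exact ⟨hs.1, subset_closure hs.2⟩
    rw [this]
    exact dense_univ

/-- On the hyperplane `L = 0` the sign condition survives in the limit and holds for both signs of a
vector, so `D` vanishes there. A functional that vanishes on the kernel of `L` is a multiple of `L`.
-/
theorem exists_eq_smul_of_nonneg_on_halfspace {L D : EuclideanSpace ℝ (Fin N) →L[ℝ] ℝ} (hL : L ≠ 0)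
    (h : ∀ w, L w < 0 → 0 ≤ D w) : ∃ k : ℝ, D = k • L := by
  obtain ⟨w₀, hw₀⟩ : ∃ w, L w = -1 := by
    obtain ⟨w, hw⟩ : ∃ w, L w ≠ 0 := by
      by_contra! h
      exact hL (ContinuousLinearMap.ext h)
    exact ⟨(-(L w)⁻¹) • w, by simp [hw]⟩
  have h1 : ∀ z, L z = 0 → 0 ≤ D z := by
    intro z hz
    by_contra! hneg
    -- Small enough that a step of length `ε` along `w₀` enters the half-space while `D` stays
    -- negative.
    set ε := -D z / (2 * (|D w₀| + 1)) with hε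
    have hε0 : 0 < ε := div_pos (by linarith) (by positivity)
    have h2 := h (z + ε • w₀) (by simp [hz, hw₀, hε0])
    rw [map_add, map_smul, smul_eq_mul] at h2
    have h3 : ε * D w₀ ≤ ε * |D w₀| := mul_le_mul_of_nonneg_left (le_abs_self _) hε0.le
    have h4 : ε * (2 * (|D w₀| + 1)) = -D z := by rw [hε]; field_simp
    nlinarith [abs_nonneg (D w₀)]
  refine ⟨-D w₀, ContinuousLinearMap.ext fun w => ?_⟩
  have h2 : L (w + L w • w₀) = 0 := by simp [hw₀]
  have h3 := h1 _ h2
  have h4 := h1 (-(w + L w • w₀)) (by rw [map_neg, h2, neg_zero])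
  rw [map_neg] at h4
  have h5 : D (w + L w • w₀) = 0 := by linarith
  rw [map_add, map_smul, smul_eq_mul] at h5
  simp only [smul_apply, smul_eq_mul]
  linarith

/-- A one-sided difference quotient of `u ≥ 0` that starts at a zero of `u` is nonnegative. -/
theorem coordDeriv_nonneg (hy : y ∈ (extChartAt (𝓡 N) c).target) {u : M → ℝ}
    (hu : MDifferentiableWithinAt (𝓡 N) 𝓘(ℝ, ℝ) u (closure Ω) ((extChartAt (𝓡 N) c).symm y))
    (hup : u ((extChartAt (𝓡 N) c).symm y) = 0) (hu0 : ∀ x ∈ Ω, 0 ≤ u x) {w : EuclideanSpace ℝ (Fin N)}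
    (hw : ∀ᶠ s : ℝ in 𝓝[>] 0, (extChartAt (𝓡 N) c).symm (y + s • w) ∈ Ω) :
    0 ≤ coordDeriv c (closure Ω) u y w := by
  have hF := hasFDerivWithinAt_comp_symm hy hu
  have hline : HasDerivWithinAt (fun s : ℝ => y + s • w) w
      {s | (extChartAt (𝓡 N) c).symm (y + s • w) ∈ closure Ω} 0 := by
    simpa using (((hasDerivAt_id (0 : ℝ)).smul_const w).const_add y).hasDerivWithinAt
  have hD := HasFDerivWithinAt.comp_hasDerivWithinAt (l := u ∘ (extChartAt (𝓡 N) c).symm)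
    (f := fun s : ℝ => y + s • w) (0 : ℝ) (by simpa using hF) hline (fun s hs => hs)
  have hD2 : HasDerivWithinAt ((u ∘ (extChartAt (𝓡 N) c).symm) ∘ fun s : ℝ => y + s • w)
      (coordDeriv c (closure Ω) u y w) (Set.Ioi 0) 0 :=
    hD.mono_of_mem_nhdsWithin (hw.mono fun s hs => subset_closure hs)
  rw [hasDerivWithinAt_iff_tendsto_slope' (by simp)] at hD2
  refine ge_of_tendsto hD2 ?_
  filter_upwards [hw, self_mem_nhdsWithin] with s hs hs0
  rw [slope_def_field]
  simp only [Function.comp_apply, zero_smul, add_zero, hup, sub_zero]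
  exact div_nonneg (hu0 _ hs) (le_of_lt hs0)

/-- At a boundary point, a nonnegative function on `Ω` with zero boundary values has its gradient along the normal. -/
theorem exists_gradWithin_eq_smul (g : SmoothMetric N M) (hΩ : IsOpen Ω) {p : M} (hp : p ∈ frontier Ω)
    (hρ : IsLocalDefiningFunction (N := N) Ω p ρ) {u : M → ℝ}
    (hu : MDifferentiableWithinAt (𝓡 N) 𝓘(ℝ, ℝ) u (closure Ω) p) (hup : u p = 0) (hu0 : ∀ x ∈ Ω, 0 ≤ u x) :
    ∃ k : ℝ, g.gradWithin (closure Ω) u p = k • g.grad ρ p := by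
  obtain ⟨c, y, hy, rfl⟩ : ∃ c, ∃ y ∈ (extChartAt (𝓡 N) c).target, (extChartAt (𝓡 N) c).symm y = p :=
    ⟨p, _, mem_extChartAt_target p, extChartAt_to_inv p⟩
  obtain ⟨k, hk⟩ := exists_eq_smul_of_nonneg_on_halfspace (D := coordDeriv c (closure Ω) u y)
    (coordDeriv_univ_ne_zero hy hρ.1) fun w hw => coordDeriv_nonneg hy hu hup hu0
      ((eventually_mem_of_coordDeriv_neg hΩ hy hp hρ hw).mono fun s hs => hs.2)
  refine ⟨k, ?_⟩
  rw [← sum_coordComp_smul_coordVec hy (g.gradWithin (closure Ω) u), ← sum_coordComp_smul_coordVec hy (g.grad ρ),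
    Finset.smul_sum]
  refine Finset.sum_congr rfl fun i _ => ?_
  rw [smul_smul, coordComp_gradWithin g hy]
  congr 1
  refine Eq.trans ?_ (congrArg (k * ·) (coordComp_gradWithin g hy Set.univ ρ i).symm)
  simp only [coordDiff_eq, hk, Finset.mul_sum, smul_apply, smul_eq_mul]
  exact Finset.sum_congr rfl fun l _ => by ring

/-- At the boundary `∇u = k ∇ρ`, so the normal derivative already determines the length of the
gradient: the Neumann condition reads `k |∇ρ| = -l`. -/
theorem inner_gradWithin_frontier (g : SmoothMetric N M) (hΩ : IsSmoothDomain N Ω) {p : M} (hp : p ∈ frontier Ω)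
    {u : M → ℝ} {l : ℝ}
    (hu : MDifferentiableWithinAt (𝓡 N) 𝓘(ℝ, ℝ) u (closure Ω) p) (hup : u p = 0) (hu0 : ∀ x ∈ Ω, 0 ≤ u x)
    (hl : ∀ η : TangentSpace (𝓡 N) p, IsUnitOuterNormal g Ω p η →
      g.inner p (g.gradWithin (closure Ω) u p) η = -l) :
    g.inner p (g.gradWithin (closure Ω) u p) (g.gradWithin (closure Ω) u p) = l ^ 2 := by
  obtain ⟨ρ, hρ⟩ := hΩ.smooth_boundary p hp
  obtain ⟨k, hk⟩ := exists_gradWithin_eq_smul g hΩ.isOpen hp hρ hu hup hu0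
  have h := hl _ ⟨ρ, hρ, rfl⟩
  rw [hk] at h ⊢
  set q : ℝ := g.inner p (g.grad ρ p) (g.grad ρ p) with hq
  have e1 : ∀ a b : ℝ, g.inner p (a • g.grad ρ p) (b • g.grad ρ p) = a * b * q := by
    intro a b
    rw [map_smul, map_smul, smul_apply]
    simp only [smul_eq_mul, hq]
    ring
  have hq0 : 0 ≤ q := by
    by_cases h0 : g.grad ρ p = 0
    · rw [hq, h0]; simp
    · exact (g.pos p _ h0).le
  rw [e1] at h ⊢
  have hs := Real.mul_self_sqrt hq0
  -- True also for `q = 0` because `0⁻¹ = 0`, so `∇ρ ≠ 0` need not be invoked.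
  have hs2 : (Real.sqrt q)⁻¹ * q = Real.sqrt q := by
    by_cases h0 : Real.sqrt q = 0
    · rw [h0] at hs ⊢; simp
    · field_simp; rw [sq, hs]
  have h3 : k * Real.sqrt q = -l := by rw [← h, mul_assoc, hs2]
  calc k * k * q = (k * Real.sqrt q) ^ 2 := by rw [mul_pow, sq (Real.sqrt q), hs]; ring
    _ = l ^ 2 := by rw [h3]; ring

/-- On a set of unique differentiability the derivative of a `C²` function within the set is
continuous. This makes `|∇u|²` continuous up to the boundary. -/
theorem continuousOn_coordComp_gradWithin (g : SmoothMetric N M) (hΩ : IsSmoothDomain N Ω) {u : M → ℝ}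
    (hu : ContMDiffOn (𝓡 N) 𝓘(ℝ, ℝ) 2 u (closure Ω)) (c : M) (k : Fin N) :
    ContinuousOn (coordComp c (g.gradWithin (closure Ω) u) k)
      ((extChartAt (𝓡 N) c).target ∩ (extChartAt (𝓡 N) c).symm ⁻¹' closure Ω) := by
  have hU := uniqueDiffOn_closure hΩ c
  have hC : ContDiffOn ℝ 2 (u ∘ (extChartAt (𝓡 N) c).symm)
      ((extChartAt (𝓡 N) c).target ∩ (extChartAt (𝓡 N) c).symm ⁻¹' closure Ω) := by
    rw [← contMDiffOn_iff_contDiffOn]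
    refine hu.comp ((contMDiffOn_extChartAt_symm c).mono Set.inter_subset_left) Set.inter_subset_right
  have hd := hC.continuousOn_fderivWithin hU one_le_two
  have e : ∀ y ∈ (extChartAt (𝓡 N) c).target ∩ (extChartAt (𝓡 N) c).symm ⁻¹' closure Ω, ∀ l,
      coordDiff c (closure Ω) u l y = fderivWithin ℝ (u ∘ (extChartAt (𝓡 N) c).symm)
        ((extChartAt (𝓡 N) c).target ∩ (extChartAt (𝓡 N) c).symm ⁻¹' closure Ω) y (EuclideanSpace.single l 1) := by
    intro y hy l
    have h := (hasFDerivWithinAt_comp_symm hy.1 (((hu _ hy.2)).mdifferentiableWithinAt two_ne_zero)).mono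
      (s := (extChartAt (𝓡 N) c).target ∩ (extChartAt (𝓡 N) c).symm ⁻¹' closure Ω) Set.inter_subset_right
    rw [h.fderivWithin (hU y hy), coordDiff_eq]
  have h2 : ContinuousOn (fun y => ∑ l, (gram g c y)⁻¹ k l * fderivWithin ℝ (u ∘ (extChartAt (𝓡 N) c).symm)
        ((extChartAt (𝓡 N) c).target ∩ (extChartAt (𝓡 N) c).symm ⁻¹' closure Ω) y (EuclideanSpace.single l 1))
      ((extChartAt (𝓡 N) c).target ∩ (extChartAt (𝓡 N) c).symm ⁻¹' closure Ω) :=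
    continuousOn_finsetSum _ fun l _ => ContinuousOn.mul
      (fun y hy => (contDiffAt_gram_inv g hy.1 k l 0).continuousAt.continuousWithinAt)
      (hd.clm_apply continuousOn_const)
  refine h2.congr fun y hy => ?_
  rw [coordComp_gradWithin g hy.1]
  exact Finset.sum_congr rfl fun l _ => by rw [e y hy l]

theorem continuousWithinAt_inner (g : SmoothMetric N M) {X Y : ∀ x : M, TangentSpace (𝓡 N) x} {S : Set M} {x : M}
    (hx : x ∈ S) (hX : ∀ i, ContinuousOn (coordComp x X i) ((extChartAt (𝓡 N) x).target ∩ (extChartAt (𝓡 N) x).symm ⁻¹' S))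
    (hY : ∀ i, ContinuousOn (coordComp x Y i) ((extChartAt (𝓡 N) x).target ∩ (extChartAt (𝓡 N) x).symm ⁻¹' S)) :
    ContinuousWithinAt (fun z => g.inner z (X z) (Y z)) S x := by
  have hxs := mem_extChartAt_source (I := 𝓡 N) x
  have h1 : ContinuousOn (fun y => ∑ i, ∑ j, gram g x y i j * coordComp x X i y * coordComp x Y j y)
      ((extChartAt (𝓡 N) x).target ∩ (extChartAt (𝓡 N) x).symm ⁻¹' S) :=
    continuousOn_finsetSum _ fun i _ => continuousOn_finsetSum _ fun j _ =>
      (ContinuousOn.mul (fun y hy => (contDiffAt_gram g hy.1 i j 0).continuousAt.continuousWithinAt) (hX i)).mul (hY j)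
  have h2 : ContinuousOn (fun z => ∑ i, ∑ j, gram g x (extChartAt (𝓡 N) x z) i j *
      coordComp x X i (extChartAt (𝓡 N) x z) * coordComp x Y j (extChartAt (𝓡 N) x z))
      ((extChartAt (𝓡 N) x).source ∩ S) :=
    h1.comp ((continuousOn_extChartAt x).mono Set.inter_subset_left) fun z hz =>
      ⟨(extChartAt (𝓡 N) x).map_source hz.1, by rw [Set.mem_preimage, (extChartAt (𝓡 N) x).left_inv hz.1]; exact hz.2⟩
  have h3 : ContinuousOn (fun z => g.inner z (X z) (Y z)) ((extChartAt (𝓡 N) x).source ∩ S) := by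
    refine h2.congr fun z hz => ?_
    have := inner_eq_sum g ((extChartAt (𝓡 N) x).map_source hz.1) X Y
    rw [(extChartAt (𝓡 N) x).left_inv hz.1] at this
    exact this
  have h4 := h3 x ⟨hxs, hx⟩
  rw [Set.inter_comm] at h4
  exact (continuousWithinAt_inter (extChartAt_source_mem_nhds (I := 𝓡 N) x)).1 h4

end Boundary

/-! ### From the overdetermined problem to the strict gradient bound -/

/-- `u > 0` solves `-Δu = 1` in the smooth domain `Ω`, and `u = 0`, `|∇u| = l` on `∂Ω`, and `|∇u| < l` in `Ω`. -/
structure IsTorsionFunction (g : SmoothMetric N M) (Ω : Set M) (u : M → ℝ) (l : ℝ) : Prop where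
  domain : IsSmoothDomain N Ω
  contMDiffOn : ContMDiffOn (𝓡 N) 𝓘(ℝ, ℝ) 2 u (closure Ω)
  divergence_grad : ∀ x ∈ Ω, g.divergence (g.grad u) x = -1
  eq_zero : ∀ p ∈ frontier Ω, u p = 0
  pos : ∀ x ∈ Ω, 0 < u x
  l_pos : 0 < l
  inner_grad_lt : ∀ x ∈ Ω, g.inner x (g.grad u x) (g.grad u x) < l ^ 2
  inner_gradWithin_eq : ∀ p ∈ frontier Ω,
    g.inner p (g.gradWithin (closure Ω) u p) (g.gradWithin (closure Ω) u p) = l ^ 2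

section

variable {Ω : Set M} {u : M → ℝ}

theorem gradWithin_closure_eq_grad (g : SmoothMetric N M) (hΩ : IsOpen Ω) (u : M → ℝ) {x : M} (hx : x ∈ Ω) :
    g.gradWithin (closure Ω) u x = g.grad u x := by
  rw [grad, gradWithin, gradWithin, mfderivWithin_univ,
    mfderivWithin_of_mem_nhds (Filter.mem_of_superset (hΩ.mem_nhds hx) subset_closure)]

theorem contMDiffAt_of_mem (hΩ : IsOpen Ω) (hu : ContMDiffOn (𝓡 N) 𝓘(ℝ, ℝ) 2 u (closure Ω)) {x : M} (hx : x ∈ Ω) :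
    ContMDiffAt (𝓡 N) 𝓘(ℝ, ℝ) 2 u x :=
  hu.contMDiffAt (Filter.mem_of_superset (hΩ.mem_nhds hx) subset_closure)

/-- A continuous function on `closure Ω` without local maxima in `Ω` is smaller in `Ω` than on the boundary. -/
theorem lt_of_forall_not_isLocalMax [CompactSpace M] (hΩ : IsOpen Ω) (hne : Ω.Nonempty) {f : M → ℝ} {m : ℝ}
    (hf : ContinuousOn f (closure Ω)) (hm : ∀ p ∈ frontier Ω, f p = m) (hmax : ∀ x ∈ Ω, ¬ IsLocalMax f x) :
    ∀ x ∈ Ω, f x < m := by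
  -- A maximum over `closure Ω` cannot lie in `Ω`, so it lies on the frontier, which is thereby
  -- nonempty, and its value is `m`. A point of `Ω` with value at least `m` would be a maximum as
  -- well.
  obtain ⟨z, hz, hzmax⟩ := isClosed_closure.isCompact.exists_isMaxOn hne.closure hf
  have key : ∀ x ∈ Ω, ¬ ∀ w ∈ Ω, f w ≤ f x := fun x hx h =>
    hmax x hx (Filter.mem_of_superset (hΩ.mem_nhds hx) h)
  have hzf : z ∈ frontier Ω := by
    rw [hΩ.frontier_eq]
    exact ⟨hz, fun hzΩ => key z hzΩ fun w hw => hzmax (subset_closure hw)⟩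
  intro x hx
  by_contra! h
  refine key x hx fun w hw => ?_
  have h1 : f w ≤ f z := hzmax (subset_closure hw)
  rw [hm z hzf] at h1
  exact h1.trans h

/-- Two maximum principles in this order: for `-u`, which gives `u > 0` and with it the direction of
`∇u` on the frontier; then for `|∇u|²`, whose boundary value `l²` is known from the first. -/
theorem isTorsionFunction_of_overdetermined [CompactSpace M] (hN : 2 ≤ N)
    (g : SmoothMetric N M) (hΩ : IsSmoothDomain N Ω)
    (hu : ContMDiffOn (𝓡 N) 𝓘(ℝ, ℝ) 2 u (closure Ω)) {l : ℝ} (hl : 0 < l)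
    (h_eq : ∀ x ∈ Ω, -g.laplacian u x = 1)
    (h_dirichlet : ∀ p ∈ frontier Ω, u p = 0)
    (h_neumann : ∀ p ∈ frontier Ω, ∀ η : TangentSpace (𝓡 N) p, IsUnitOuterNormal g Ω p η →
      g.inner p (g.gradWithin (closure Ω) u p) η = -l)
    (h_ric : ∀ x ∈ Ω, g.ricci (g.grad u) x > -1 / (N : ℝ)) : g.IsTorsionFunction Ω u l := by
  have hev : ∀ x ∈ Ω, ∀ᶠ z in 𝓝 x, z ∈ Ω := fun x hx => hΩ.isOpen.mem_nhds hx
  have hpos : ∀ x ∈ Ω, 0 < u x := by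
    have := lt_of_forall_not_isLocalMax hΩ.isOpen hΩ.isConnected.nonempty (f := fun x => - u x) (m := 0)
      hu.continuousOn.neg (fun p hp => by simp [h_dirichlet p hp]) fun x hx =>
        not_isLocalMax_neg_of_laplacian g ((hev x hx).mono fun z hz => contMDiffAt_of_mem hΩ.isOpen hu hz)
          ((hev x hx).mono h_eq)
    exact fun x hx => by simpa using this x hx
  have hfr : ∀ p ∈ frontier Ω, g.inner p (g.gradWithin (closure Ω) u p) (g.gradWithin (closure Ω) u p) = l ^ 2 :=
    fun p hp => inner_gradWithin_frontier g hΩ hp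
      ((hu p (frontier_subset_closure hp)).mdifferentiableWithinAt two_ne_zero)
      (h_dirichlet p hp) (fun x hx => (hpos x hx).le) (h_neumann p hp)
  refine ⟨hΩ, hu, fun x hx => ?_, h_dirichlet, hpos, hl, ?_, hfr⟩
  · have := h_eq x hx
    rw [laplacian] at this
    linarith
  · have hc : ContinuousOn (fun x => g.inner x (g.gradWithin (closure Ω) u x) (g.gradWithin (closure Ω) u x)) (closure Ω) :=
      fun x hx => continuousWithinAt_inner g hx (continuousOn_coordComp_gradWithin g hΩ hu x)
        (continuousOn_coordComp_gradWithin g hΩ hu x)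
    have := lt_of_forall_not_isLocalMax hΩ.isOpen hΩ.isConnected.nonempty hc (m := l ^ 2) hfr fun x hx hmax => by
          refine not_isLocalMax_inner_grad (by omega) g ((hev x hx).mono fun z hz => contMDiffAt_of_mem hΩ.isOpen hu hz)
            ((hev x hx).mono h_eq) (h_ric x hx) ?_
          filter_upwards [hmax, hev x hx] with z hz hzΩ
          simpa only [gradWithin_closure_eq_grad g hΩ.isOpen u hzΩ, gradWithin_closure_eq_grad g hΩ.isOpen u hx] using hz
    intro x hx
    have := this x hx
    simpa only [gradWithin_closure_eq_grad g hΩ.isOpen u hx] using this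

end

section Inner

variable (g : SmoothMetric N M) {x : M}

theorem inner_self_nonneg (v : TangentSpace (𝓡 N) x) : 0 ≤ g.inner x v v := by
  by_cases h : v = 0
  · rw [h]; simp
  · exact (g.pos x v h).le

theorem inner_add_smul_self (a b : ℝ) (v w : TangentSpace (𝓡 N) x) :
    g.inner x (a • v + b • w) (a • v + b • w) =
      a ^ 2 * g.inner x v v + 2 * a * b * g.inner x v w + b ^ 2 * g.inner x w w := by
  have h := g.symm x w v
  simp only [map_add, map_smul, add_apply, smul_apply, smul_eq_mul]
  rw [h]
  ring

theorem sq_inner_le (v w : TangentSpace (𝓡 N) x) :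
    (g.inner x v w) ^ 2 ≤ g.inner x v v * g.inner x w w := by
  by_cases hw : w = 0
  · simp [hw]
  have hp : 0 < g.inner x w w := g.pos x w hw
  have h := inner_self_nonneg g ((g.inner x w w) • v + (- g.inner x v w) • w)
  rw [inner_add_smul_self] at h
  have h2 : 0 ≤ g.inner x w w * (g.inner x v v * g.inner x w w - (g.inner x v w) ^ 2) := by
    refine h.trans_eq ?_
    ring
  have := nonneg_of_mul_nonneg_right h2 hp
  linarith

theorem inner_convex_comb_le {a b : ℝ} (ha : 0 ≤ a) (hb : 0 ≤ b) (hab : a + b = 1) (v w : TangentSpace (𝓡 N) x) :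
    g.inner x (a • v + b • w) (a • v + b • w) ≤ a * g.inner x v v + b * g.inner x w w := by
  have h := inner_self_nonneg g ((1 : ℝ) • v + (-1 : ℝ) • w)
  rw [inner_add_smul_self] at h ⊢
  have e : b = 1 - a := by linarith
  subst e
  nlinarith [mul_nonneg (mul_nonneg ha hb) h]

theorem fieldDeriv_eq_inner (u : M → ℝ) (X : ∀ x : M, TangentSpace (𝓡 N) x) (x : M) :
    fieldDeriv u X x = g.inner x (g.grad u x) (X x) := by
  rw [grad, inner_gradWithin, mfderivWithin_univ]
  rfl

/-- Applied with `v = |∇u|²`: where `|∇u| ≥ μ`, a quantity bounded by `|∇u|` is bounded by `|∇u|² /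
μ`, whose weighted integral is known. -/
theorem abs_le_div_of_sq_le {a v μ : ℝ} (hμ : 0 < μ) (h1 : a ^ 2 ≤ v) (h2 : μ ^ 2 ≤ v) : |a| ≤ v / μ := by
  rw [le_div_iff₀ hμ]
  have hv : 0 ≤ v := (sq_nonneg _).trans h1
  refine abs_le_of_sq_le_sq' ?_ hv |>.2
  rw [mul_pow, sq_abs, sq v]
  exact mul_le_mul h1 h2 (sq_nonneg _) hv

end Inner

/-! ### Cutoffs at level sets of `u` and the perimeter of `Ω` -/

section Cutoff

/-- The profile of the cutoff: `0` for `t ≤ ε`, and `1` for `t ≥ 2ε`. -/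
def cutoffProfile (ε t : ℝ) : ℝ := Real.smoothTransition (t / ε - 1)

theorem contDiff_cutoffProfile (ε : ℝ) : ContDiff ℝ 1 (cutoffProfile ε) :=
  Real.smoothTransition.contDiff.comp ((contDiff_id.div_const ε).sub contDiff_const)

theorem monotone_cutoffProfile {ε : ℝ} (hε : 0 < ε) : Monotone (cutoffProfile ε) := fun s t hst =>
  Real.smoothTransition.monotone (by gcongr)

theorem cutoffProfile_eq_zero {ε t : ℝ} (hε : 0 < ε) (ht : t ≤ ε) : cutoffProfile ε t = 0 := by
  refine Real.smoothTransition.zero_of_nonpos ?_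
  have := (div_le_one hε).2 ht
  linarith

theorem cutoffProfile_eq_one {ε t : ℝ} (hε : 0 < ε) (ht : 2 * ε ≤ t) : cutoffProfile ε t = 1 := by
  refine Real.smoothTransition.one_of_one_le ?_
  have := (le_div_iff₀ hε).2 ht
  linarith

theorem deriv_cutoffProfile_eq_zero {ε t : ℝ} (hε : 0 < ε) (ht : 2 * ε < t) : deriv (cutoffProfile ε) t = 0 := by
  have : cutoffProfile ε =ᶠ[𝓝 t] fun _ => 1 := by
    filter_upwards [lt_mem_nhds ht] with s hs using cutoffProfile_eq_one hε hs.le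
  rw [this.deriv_eq, deriv_const]

/-- The cutoff function of the domain `Ω` at the level `ε` of `u`. -/
def cutoff (Ω : Set M) (u : M → ℝ) (ε : ℝ) : M → ℝ := Ω.indicator fun x => cutoffProfile ε (u x)

variable {g : SmoothMetric N M} {Ω : Set M} {u : M → ℝ} {l ε : ℝ}

theorem cutoff_nonneg (Ω : Set M) (u : M → ℝ) (ε : ℝ) (x : M) : 0 ≤ cutoff Ω u ε x :=
  Set.indicator_nonneg (fun _ _ => Real.smoothTransition.nonneg _) x

theorem cutoff_le_one (Ω : Set M) (u : M → ℝ) (ε : ℝ) (x : M) : cutoff Ω u ε x ≤ 1 :=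
  Set.indicator_le' (fun _ _ => Real.smoothTransition.le_one _) (fun _ _ => zero_le_one) x

theorem cutoff_eq_one (hε : 0 < ε) {x : M} (hx : x ∈ Ω) (hux : 2 * ε ≤ u x) : cutoff Ω u ε x = 1 := by
  rw [cutoff, Set.indicator_of_mem hx, cutoffProfile_eq_one hε hux]

namespace IsTorsionFunction

theorem isClosed_superlevel (h : g.IsTorsionFunction Ω u l) (ε : ℝ) : IsClosed (closure Ω ∩ u ⁻¹' Set.Ici ε) :=
  h.contMDiffOn.continuousOn.preimage_isClosed_of_isClosed isClosed_closure isClosed_Ici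

/-- As `u` vanishes on the frontier, its closed superlevel sets stay inside `Ω`. A field on `Ω`
times the cutoff thus extends by zero to a `C¹` field on all of `M`. -/
theorem superlevel_subset (h : g.IsTorsionFunction Ω u l) (hε : 0 < ε) : closure Ω ∩ u ⁻¹' Set.Ici ε ⊆ Ω := by
  intro x ⟨hx, hux⟩
  by_contra hxΩ
  have : x ∈ frontier Ω := by rw [h.domain.isOpen.frontier_eq]; exact ⟨hx, hxΩ⟩
  rw [Set.mem_preimage, h.eq_zero x this] at hux
  exact not_le.2 hε hux

theorem cutoff_eq_zero (hε : 0 < ε) {x : M} (hx : x ∉ closure Ω ∩ u ⁻¹' Set.Ici ε) : cutoff Ω u ε x = 0 := by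
  by_cases hxΩ : x ∈ Ω
  · rw [cutoff, Set.indicator_of_mem hxΩ, cutoffProfile_eq_zero hε]
    by_contra! h
    exact hx ⟨subset_closure hxΩ, h.le⟩
  · exact Set.indicator_of_notMem hxΩ _

theorem contMDiffAt (h : g.IsTorsionFunction Ω u l) {x : M} (hx : x ∈ Ω) : ContMDiffAt (𝓡 N) 𝓘(ℝ, ℝ) 2 u x :=
  contMDiffAt_of_mem h.domain.isOpen h.contMDiffOn hx

theorem fieldC1At_grad (h : g.IsTorsionFunction Ω u l) {x : M} (hx : x ∈ Ω) : FieldC1At (g.grad u) x :=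
  SmoothMetric.fieldC1At_grad g (h.contMDiffAt hx)

theorem cutoff_eventuallyEq (h : g.IsTorsionFunction Ω u l) {x : M} (hx : x ∈ Ω) :
    cutoff Ω u ε =ᶠ[𝓝 x] fun x => cutoffProfile ε (u x) := by
  filter_upwards [h.domain.isOpen.mem_nhds hx] with z hz using Set.indicator_of_mem hz _

theorem contMDiffAt_cutoff (h : g.IsTorsionFunction Ω u l) {x : M} (hx : x ∈ Ω) :
    ContMDiffAt (𝓡 N) 𝓘(ℝ, ℝ) 1 (cutoff Ω u ε) x :=
  ((contDiff_cutoffProfile ε).contMDiff.contMDiffAt.comp x ((h.contMDiffAt hx).of_le one_le_two)).congr_of_eventuallyEq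
    (h.cutoff_eventuallyEq hx)

theorem fieldDeriv_cutoff (h : g.IsTorsionFunction Ω u l) {x : M} (hx : x ∈ Ω) (X : ∀ x : M, TangentSpace (𝓡 N) x) :
    fieldDeriv (cutoff Ω u ε) X x = deriv (cutoffProfile ε) (u x) * g.inner x (g.grad u x) (X x) := by
  have h1 : HasMFDerivAt 𝓘(ℝ, ℝ) 𝓘(ℝ, ℝ) (cutoffProfile ε) (u x)
      (fderiv ℝ (cutoffProfile ε) (u x)) :=
    ((contDiff_cutoffProfile ε).differentiable one_ne_zero (u x)).hasFDerivAt.hasMFDerivAt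
  have h2 := HasMFDerivAt.comp x h1 ((h.contMDiffAt hx).mdifferentiableAt two_ne_zero).hasMFDerivAt
  have h3 := (h2.congr_of_eventuallyEq (h.cutoff_eventuallyEq (ε := ε) hx)).mfderiv
  rw [← fieldDeriv_eq_inner, fieldDeriv, h3]
  change fderiv ℝ (cutoffProfile ε) (u x) (fieldDeriv u X x) = _
  rw [fderiv_eq_smul_deriv, smul_eq_mul, mul_comm]

theorem fieldC1At_cutoff_smul (h : g.IsTorsionFunction Ω u l) (hε : 0 < ε) {X : ∀ x : M, TangentSpace (𝓡 N) x}
    (hX : ∀ x ∈ Ω, FieldC1At X x) (x : M) : FieldC1At (fun x => cutoff Ω u ε x • X x) x := by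
  by_cases hx : x ∈ Ω
  · exact (hX x hx).smul (h.contMDiffAt_cutoff hx)
  · exact fieldC1At_of_notMem (h.isClosed_superlevel ε) (fun z hz => by rw [cutoff_eq_zero hε hz, zero_smul])
      fun hxK => hx (h.superlevel_subset hε hxK)

theorem divergence_cutoff_smul_of_notMem (h : g.IsTorsionFunction Ω u l) (hε : 0 < ε) (X : ∀ x : M, TangentSpace (𝓡 N) x)
    {x : M} (hx : x ∉ Ω) : g.divergence (fun x => cutoff Ω u ε x • X x) x = 0 :=
  divergence_eq_zero_of_notMem g (h.isClosed_superlevel ε) (fun z hz => by rw [cutoff_eq_zero hε hz, zero_smul])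
    fun hxK => hx (h.superlevel_subset hε hxK)

theorem divergence_cutoff_smul (h : g.IsTorsionFunction Ω u l) {X : ∀ x : M, TangentSpace (𝓡 N) x}
    {x : M} (hx : x ∈ Ω) (hX : FieldC1At X x) : g.divergence (fun x => cutoff Ω u ε x • X x) x =
      cutoff Ω u ε x * g.divergence X x + deriv (cutoffProfile ε) (u x) * g.inner x (g.grad u x) (X x) := by
  rw [divergence_smul g hX (h.contMDiffAt_cutoff hx), h.fieldDeriv_cutoff hx]

/-- The key quantity `τ'(u)|∇u|²`, concentrated near the boundary. In the form on the left it is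
continuous on `M`, and by the divergence theorem its integral is that of the cutoff, hence at most
`|Ω|`. -/
theorem divergence_cutoff_smul_grad (h : g.IsTorsionFunction Ω u l) {x : M} (hx : x ∈ Ω) :
    g.divergence (fun x => cutoff Ω u ε x • g.grad u x) x + cutoff Ω u ε x =
      deriv (cutoffProfile ε) (u x) * g.inner x (g.grad u x) (g.grad u x) := by
  rw [h.divergence_cutoff_smul hx (h.fieldC1At_grad hx), h.divergence_grad x hx]
  ring

theorem continuous_cutoff (h : g.IsTorsionFunction Ω u l) (hε : 0 < ε) : Continuous (cutoff Ω u ε) := by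
  refine continuous_iff_continuousAt.2 fun x => ?_
  by_cases hx : x ∈ Ω
  · exact (h.contMDiffAt_cutoff hx).continuousAt
  · refine (continuousAt_const (y := (0 : ℝ))).congr ?_
    filter_upwards [(h.isClosed_superlevel ε).isOpen_compl.mem_nhds fun hxK => hx (h.superlevel_subset hε hxK)] with z hz
    exact (cutoff_eq_zero hε hz).symm

theorem continuousOn_inner_gradWithin (h : g.IsTorsionFunction Ω u l) : ContinuousOn
    (fun x => g.inner x (g.gradWithin (closure Ω) u x) (g.gradWithin (closure Ω) u x)) (closure Ω) := fun x hx =>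
  continuousWithinAt_inner g hx (continuousOn_coordComp_gradWithin g h.domain h.contMDiffOn x)
    (continuousOn_coordComp_gradWithin g h.domain h.contMDiffOn x)

/-- The points of `closure Ω` with `|∇u| ≤ μ` form a compact set. It misses the frontier, where
`|∇u| = l > μ`, so `u` has a positive minimum on it. -/
theorem exists_forall_sq_le_inner_grad [CompactSpace M] (h : g.IsTorsionFunction Ω u l) {μ : ℝ} (hμ : 0 < μ)
    (hμl : μ < l) : ∃ ε₀ > 0, ∀ x ∈ Ω, u x ≤ ε₀ → μ ^ 2 ≤ g.inner x (g.grad u x) (g.grad u x) := by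
  set f : M → ℝ := fun x => g.inner x (g.gradWithin (closure Ω) u x) (g.gradWithin (closure Ω) u x) with hf
  have hC : IsClosed (closure Ω ∩ f ⁻¹' Set.Iic (μ ^ 2)) :=
    h.continuousOn_inner_gradWithin.preimage_isClosed_of_isClosed isClosed_closure isClosed_Iic
  have hCΩ : closure Ω ∩ f ⁻¹' Set.Iic (μ ^ 2) ⊆ Ω := by
    intro x ⟨hx, hxf⟩
    by_contra hxΩ
    have hfr : x ∈ frontier Ω := by rw [h.domain.isOpen.frontier_eq]; exact ⟨hx, hxΩ⟩
    have : l ^ 2 ≤ μ ^ 2 := by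
      rw [← h.inner_gradWithin_eq x hfr]; exact hxf
    exact not_le.2 hμl (le_of_sq_le_sq this hμ.le)
  have key : ∀ ε₀, (∀ z ∈ closure Ω ∩ f ⁻¹' Set.Iic (μ ^ 2), ε₀ < u z) →
      ∀ x ∈ Ω, u x ≤ ε₀ → μ ^ 2 ≤ g.inner x (g.grad u x) (g.grad u x) := by
    intro ε₀ hε₀ x hx hux
    by_contra! hlt
    refine not_lt.2 hux (hε₀ x ⟨subset_closure hx, ?_⟩)
    simp only [hf, Set.mem_preimage, Set.mem_Iic, gradWithin_closure_eq_grad g h.domain.isOpen u hx]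
    exact hlt.le
  rcases (closure Ω ∩ f ⁻¹' Set.Iic (μ ^ 2)).eq_empty_or_nonempty with he | hne
  · exact ⟨1, one_pos, key 1 (by simp [he])⟩
  · obtain ⟨z, hz, hzmin⟩ := hC.isCompact.exists_isMinOn hne (h.contMDiffOn.continuousOn.mono Set.inter_subset_left)
    have hz0 := h.pos z (hCΩ hz)
    -- Half of the minimum, so that the inequality for `u` on the compact set is strict.
    exact ⟨u z / 2, half_pos hz0, key _ fun w hw => lt_of_lt_of_le (half_lt_self hz0) (hzmin hw)⟩

variable [MeasurableSpace M] [BorelSpace M] [CompactSpace M]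

/-- Dominated convergence: as `u > 0` in `Ω`, at each point the cutoff is eventually equal to `1`.
-/
theorem tendsto_integral_cutoff_mul (h : g.IsTorsionFunction Ω u l) {A : Set M} (hA : NullMeasurableSet A g.vol)
    (hAΩ : A ⊆ Ω) {f : M → ℝ} (hf : Continuous f) :
    Filter.Tendsto (fun n : ℕ => ∫ x in A, cutoff Ω u (1 / (n + 1 : ℝ)) x * f x ∂g.vol) Filter.atTop
      (𝓝 (∫ x in A, f x ∂g.vol)) := by
  have hε : ∀ n : ℕ, (0 : ℝ) < 1 / (n + 1) := fun n => by positivity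
  refine tendsto_integral_of_dominated_convergence (fun x => ‖f x‖)
    (fun n => ((h.continuous_cutoff (hε n)).mul hf).aestronglyMeasurable)
    (integrable_of_continuous g hf).norm.restrict (fun n => Filter.Eventually.of_forall fun x => ?_) ?_
  · rw [norm_mul, Real.norm_of_nonneg (cutoff_nonneg Ω u _ x)]
    exact mul_le_of_le_one_left (norm_nonneg _) (cutoff_le_one Ω u _ x)
  · filter_upwards [ae_restrict_mem₀ hA] with x hx
    refine tendsto_const_nhds.congr' ?_
    have h1 : Filter.Tendsto (fun n : ℕ => 2 * (1 / (n + 1 : ℝ))) Filter.atTop (𝓝 (2 * 0)) :=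
      tendsto_one_div_add_atTop_nhds_zero_nat.const_mul 2
    rw [mul_zero] at h1
    filter_upwards [h1.eventually (gt_mem_nhds (h.pos x (hAΩ hx)))] with n hn
    rw [cutoff_eq_one (hε n) (hAΩ hx) hn.le, one_mul]

theorem integral_cutoff_le (h : g.IsTorsionFunction Ω u l) (hε : 0 < ε) :
    ∫ x, cutoff Ω u ε x ∂g.vol ≤ g.vol.real Ω := by
  have : IsFiniteMeasure g.vol := inferInstance
  rw [← integral_indicator_one h.domain.isOpen.measurableSet]
  refine integral_mono (integrable_of_continuous g (h.continuous_cutoff hε))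
    ((integrable_const 1).indicator h.domain.isOpen.measurableSet) fun x => ?_
  by_cases hx : x ∈ Ω
  · simpa [hx] using cutoff_le_one Ω u ε x
  · simp [cutoff, hx]

variable [T2Space M]

theorem integral_divergence_cutoff_add_le (h : g.IsTorsionFunction Ω u l) (hε : 0 < ε) :
    ∫ x, (g.divergence (fun x => cutoff Ω u ε x • g.grad u x) x + cutoff Ω u ε x) ∂g.vol ≤ g.vol.real Ω := by
  have hC2 := h.fieldC1At_cutoff_smul hε fun x hx => h.fieldC1At_grad hx
  rw [integral_add (integrable_of_continuous g (continuous_divergence g hC2))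
    (integrable_of_continuous g (h.continuous_cutoff hε)), integral_divergence_eq_zero g hC2, zero_add]
  exact h.integral_cutoff_le hε

/-- By the divergence theorem `∫ χ div ξ = -∫ τ'(u) g(∇u, ξ) ≤ ∫ τ'(u)|∇u|`. On the support of
`τ'(u)` the gradient is at least `μ`, so this is at most `∫ τ'(u)|∇u|² / μ ≤ |Ω| / μ`. -/
theorem integral_divergence_le (h : g.IsTorsionFunction Ω u l) {ξ : ∀ x : M, TangentSpace (𝓡 N) x}
    (hξ : ∀ x, FieldC1At ξ x) (hξ1 : ∀ x, g.inner x (ξ x) (ξ x) ≤ 1) {μ : ℝ} (hμ : 0 < μ) (hμl : μ < l) :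
    ∫ x in Ω, g.divergence ξ x ∂g.vol ≤ g.vol.real Ω / μ := by
  obtain ⟨ε₀, hε₀, hμv⟩ := h.exists_forall_sq_le_inner_grad hμ hμl
  have key : ∀ ε, 0 < ε → 2 * ε ≤ ε₀ → ∫ x in Ω, cutoff Ω u ε x * g.divergence ξ x ∂g.vol ≤ g.vol.real Ω / μ := by
    intro ε hε hεε₀
    have hC1 := h.fieldC1At_cutoff_smul hε fun x _ => hξ x
    have hC2 := h.fieldC1At_cutoff_smul hε fun x hx => h.fieldC1At_grad hx
    have i1 := integrable_of_continuous g (continuous_divergence g hC1)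
    have i2 := integrable_of_continuous g (continuous_divergence g hC2)
    have i3 := integrable_of_continuous g (h.continuous_cutoff hε)
    have i4 := integrable_of_continuous g ((h.continuous_cutoff hε).mul (continuous_divergence g hξ))
    have e : ∫ x in Ω, cutoff Ω u ε x * g.divergence ξ x ∂g.vol = ∫ x, cutoff Ω u ε x * g.divergence ξ x ∂g.vol := by
      refine setIntegral_eq_integral_of_forall_compl_eq_zero fun x hx => ?_
      rw [cutoff, Set.indicator_of_notMem hx, zero_mul]
    rw [e]
    -- A pointwise inequality between continuous functions on `M`; integrating it removes the first
    -- divergence on the right.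
    have hle : ∀ x, cutoff Ω u ε x * g.divergence ξ x ≤ g.divergence (fun x => cutoff Ω u ε x • ξ x) x +
        (g.divergence (fun x => cutoff Ω u ε x • g.grad u x) x + cutoff Ω u ε x) / μ := by
      intro x
      by_cases hx : x ∈ Ω
      · rw [h.divergence_cutoff_smul hx (hξ x), h.divergence_cutoff_smul_grad hx]
        have hτ : 0 ≤ deriv (cutoffProfile ε) (u x) := (monotone_cutoffProfile hε).deriv_nonneg
        rcases le_or_gt (u x) (2 * ε) with hux | hux
        · have hcs : (g.inner x (g.grad u x) (ξ x)) ^ 2 ≤ g.inner x (g.grad u x) (g.grad u x) :=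
            (sq_inner_le g _ _).trans (mul_le_of_le_one_right (inner_self_nonneg g _) (hξ1 x))
          have := abs_le_div_of_sq_le hμ hcs (hμv x hx (hux.trans hεε₀))
          have h2 := mul_le_mul_of_nonneg_left ((neg_le_abs _).trans this) hτ
          rw [mul_div_assoc]
          linarith
        · rw [deriv_cutoffProfile_eq_zero hε hux]
          simp
      · rw [h.divergence_cutoff_smul_of_notMem hε _ hx, h.divergence_cutoff_smul_of_notMem hε _ hx]
        simp [cutoff, hx]
    have i5 : Integrable (fun x => (g.divergence (fun x => cutoff Ω u ε x • g.grad u x) x + cutoff Ω u ε x) / μ) g.vol :=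
      (i2.add i3).div_const μ
    refine (integral_mono i4 (i1.add i5) hle).trans ?_
    simp only [Pi.add_apply]
    rw [integral_add i1 i5, integral_divergence_eq_zero g hC1, integral_div, zero_add]
    gcongr
    exact h.integral_divergence_cutoff_add_le hε
  have hΩm : NullMeasurableSet Ω g.vol := h.domain.isOpen.measurableSet.nullMeasurableSet
  refine le_of_tendsto (h.tendsto_integral_cutoff_mul hΩm subset_rfl (continuous_divergence g hξ)) ?_
  have h1 : Filter.Tendsto (fun n : ℕ => 2 * (1 / (n + 1 : ℝ))) Filter.atTop (𝓝 (2 * 0)) :=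
    tendsto_one_div_add_atTop_nhds_zero_nat.const_mul 2
  rw [mul_zero] at h1
  filter_upwards [h1.eventually (gt_mem_nhds hε₀)] with n hn
  exact key _ (by positivity) hn.le

/-- Let `μ` increase to `l` in `integral_divergence_le`. -/
theorem perimeter_le (h : g.IsTorsionFunction Ω u l) : g.perimeter Ω ≤ ENNReal.ofReal (g.vol.real Ω / l) := by
  refine iSup_le fun ξ => iSup_le fun hξ => iSup_le fun hξ1 => ENNReal.ofReal_le_ofReal ?_
  have hl := h.l_pos
  have ht : Filter.Tendsto (fun μ : ℝ => g.vol.real Ω / μ) (𝓝[<] l) (𝓝 (g.vol.real Ω / l)) :=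
    ((continuousAt_const.div continuousAt_id hl.ne').tendsto).mono_left nhdsWithin_le_nhds
  refine ge_of_tendsto ht ?_
  filter_upwards [self_mem_nhdsWithin, nhdsWithin_le_nhds (lt_mem_nhds hl)] with μ h1 h2
  exact h.integral_divergence_le (fun x => hξ x) hξ1 h2 h1

end IsTorsionFunction

end Cutoff

/-! ### Approximation of the calibrating field and comparison with the perimeter -/

theorem FieldC1At.const_smul {X : ∀ x : M, TangentSpace (𝓡 N) x} {x : M} (hX : FieldC1At X x) (a : ℝ) :
    FieldC1At (fun x => a • X x) x := hX.smul contMDiffAt_const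

theorem divergence_const_smul (g : SmoothMetric N M) {X : ∀ x : M, TangentSpace (𝓡 N) x} {x : M} (hX : FieldC1At X x)
    (a : ℝ) : g.divergence (fun x => a • X x) x = a * g.divergence X x := by
  rw [divergence_smul g hX (f := fun _ => a) contMDiffAt_const, fieldDeriv, mfderiv_const]
  exact add_zero _

theorem convex_inner_add_lt (g : SmoothMetric N M) {x : M} (w : TangentSpace (𝓡 N) x) (r : ℝ) :
    Convex ℝ {v : TangentSpace (𝓡 N) x | g.inner x (v + w) (v + w) < r} := by
  intro v hv v' hv' a b ha hb hab
  have e : a • v + b • v' + w = a • (v + w) + b • (v' + w) := by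
    rw [smul_add, smul_add, add_add_add_comm, ← add_smul, hab, one_smul]
  change g.inner x (a • v + b • v' + w) (a • v + b • v' + w) < r
  rw [e]
  refine (inner_convex_comb_le g ha hb hab _ _).trans_lt ?_
  have h1 : g.inner x (v + w) (v + w) < r := hv
  have h2 : g.inner x (v' + w) (v' + w) < r := hv'
  rcases ha.eq_or_lt with rfl | ha
  · have : b = 1 := by linarith
    subst this; simpa using h2
  · have h3 := mul_lt_mul_of_pos_left h1 ha
    have h4 := mul_le_mul_of_nonneg_left h2.le hb
    calc _ < a * r + b * r := by linarith
      _ = r := by rw [← add_mul, hab, one_mul]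

theorem inner_const_smul_self (g : SmoothMetric N M) {x : M} (a : ℝ) (v : TangentSpace (𝓡 N) x) :
    g.inner x (a • v) (a • v) = a ^ 2 * g.inner x v v := by
  have := inner_add_smul_self g a 0 v 0
  simpa using this

namespace IsTorsionFunction

variable {g : SmoothMetric N M} {Ω : Set M} {u : M → ℝ} {l ε : ℝ}

theorem inner_gradWithin_le (h : g.IsTorsionFunction Ω u l) {x : M} (hx : x ∈ closure Ω) :
    g.inner x (g.gradWithin (closure Ω) u x) (g.gradWithin (closure Ω) u x) ≤ l ^ 2 := by
  by_cases hxΩ : x ∈ Ω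
  · rw [gradWithin_closure_eq_grad g h.domain.isOpen u hxΩ]
    exact (h.inner_grad_lt x hxΩ).le
  · exact (h.inner_gradWithin_eq x (by rw [h.domain.isOpen.frontier_eq]; exact ⟨hx, hxΩ⟩)).le

/-- The field `-∇u / l` on `closure Ω` is uniformly approximated by `C¹` fields on `M` that are almost
bounded by `1`. -/
theorem exists_field_approx [CompactSpace M] [T2Space M] (h : g.IsTorsionFunction Ω u l) {δ : ℝ} (hδ : 0 < δ) :
    ∃ η : ∀ x : M, TangentSpace (𝓡 N) x, (∀ x, FieldC1At η x) ∧
      (∀ x ∈ Ω, g.inner x (η x + l⁻¹ • g.grad u x) (η x + l⁻¹ • g.grad u x) ≤ δ ^ 2) ∧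
      ∀ x, g.inner x (η x) (η x) ≤ (1 + δ) ^ 2 := by
  -- Both requirements on the value of `η` at a point are convex, so local solutions can be averaged
  -- by a partition of unity. The global length bound is imposed at every point of `M`, because
  -- competing fields must be admissible everywhere.
  let t : ∀ x : M, Set (TangentSpace (𝓡 N) x) := fun x =>
    {v | g.inner x (v + 0) (v + 0) < (1 + δ) ^ 2} ∩ {v | x ∈ closure Ω →
      g.inner x (v + l⁻¹ • g.gradWithin (closure Ω) u x) (v + l⁻¹ • g.gradWithin (closure Ω) u x) < δ ^ 2}
  have ht : ∀ x, Convex ℝ (t x) := by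
    intro x
    refine (convex_inner_add_lt g 0 _).inter ?_
    by_cases hx : x ∈ closure Ω
    · simpa [hx] using convex_inner_add_lt g (l⁻¹ • g.gradWithin (closure Ω) u x) (δ ^ 2)
    · simpa [hx] using convex_univ
  have hδ1 : (0 : ℝ) < (1 + δ) ^ 2 := by positivity
  obtain ⟨s, hs⟩ := exists_contMDiffSection_forall_mem_convex_of_local (n := 1) (𝓡 N)
      (F_fiber := EuclideanSpace ℝ (Fin N)) (fun x : M => TangentSpace (𝓡 N) x) t ht (by
    intro x₀
    by_cases hx₀ : x₀ ∈ closure Ω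
    -- Locally the field with constant coordinates that equals `-∇u / l` at `x₀` will do, by
    -- continuity of `∇u` up to the boundary and `|∇u| ≤ l`.
    · set a := (triv x₀).continuousLinearMapAt ℝ x₀ ((-l⁻¹) • g.gradWithin (closure Ω) u x₀) with ha
      have hs₀ := mem_extChartAt_source (I := 𝓡 N) x₀
      have ha0 : constField x₀ a x₀ = (-l⁻¹) • g.gradWithin (closure Ω) u x₀ := exists_constField_eq hs₀ _
      let D : ∀ x : M, TangentSpace (𝓡 N) x := fun x => constField x₀ a x + l⁻¹ • g.gradWithin (closure Ω) u x
      have hD : ∀ i, ContinuousOn (coordComp x₀ D i)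
          ((extChartAt (𝓡 N) x₀).target ∩ (extChartAt (𝓡 N) x₀).symm ⁻¹' closure Ω) := by
        intro i
        have := (continuousOn_const (c := a i)).add
          ((continuousOn_const (c := l⁻¹)).mul (continuousOn_coordComp_gradWithin g h.domain h.contMDiffOn x₀ i))
        refine this.congr fun y hy => ?_
        rw [coordComp_add hy.1, coordComp_constField hy.1, coordComp_smul hy.1 (fun _ => l⁻¹)]
        rfl
      have hDc := continuousWithinAt_inner g hx₀ hD hD
      have hD0 : D x₀ = 0 := by
        simp only [D, ha0, neg_smul, neg_add_cancel]
      have h1 : ∀ᶠ x in 𝓝[closure Ω] x₀, g.inner x (D x) (D x) < δ ^ 2 := by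
        refine hDc.eventually (gt_mem_nhds ?_)
        beta_reduce
        rw [hD0]
        simp only [map_zero]
        positivity
      have hcc := (contMDiffAt_inner g (contMDiffAt_constField hs₀ a 1) (contMDiffAt_constField hs₀ a 1)).continuousAt
      have h2 : ∀ᶠ x in 𝓝 x₀, g.inner x (constField x₀ a x) (constField x₀ a x) < (1 + δ) ^ 2 := by
        refine hcc.eventually (gt_mem_nhds ?_)
        beta_reduce
        rw [ha0, inner_const_smul_self]
        have h3 := h.inner_gradWithin_le hx₀
        have hl := h.l_pos
        have h4 : (-l⁻¹) ^ 2 * g.inner x₀ (g.gradWithin (closure Ω) u x₀) (g.gradWithin (closure Ω) u x₀) ≤ 1 := by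
          rw [neg_sq, inv_pow, inv_mul_le_iff₀ (by positivity), mul_one]
          exact h3
        nlinarith
      refine ⟨_, Filter.inter_mem (Filter.inter_mem (extChartAt_source_mem_nhds (I := 𝓡 N) x₀) h2)
        (eventually_nhdsWithin_iff.1 h1), constField x₀ a, fun x hx =>
        (contMDiffAt_constField hx.1.1 a 1).contMDiffWithinAt, fun x hx => ⟨?_, fun hxΩ => hx.2 hxΩ⟩⟩
      change g.inner x (_ + 0) (_ + 0) < _
      rw [add_zero]
      exact hx.1.2
    · refine ⟨(closure Ω)ᶜ, isClosed_closure.isOpen_compl.mem_nhds hx₀, fun x => 0,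
        fun x _ => (fieldC1At_zero x).contMDiffWithinAt, fun x hx => ⟨?_, fun hxΩ => absurd hxΩ hx⟩⟩
      change g.inner x (0 + 0) (0 + 0) < _
      simpa using hδ1)
  refine ⟨s, fun x => s.contMDiff x, fun x hx => ?_, fun x => ?_⟩
  · have := (hs x).2 (subset_closure hx)
    rw [gradWithin_closure_eq_grad g h.domain.isOpen u hx] at this
    exact this.le
  · have : g.inner x (s x + 0) (s x + 0) < (1 + δ) ^ 2 := (hs x).1
    rw [add_zero] at this
    exact this.le

variable [MeasurableSpace M] [BorelSpace M] [CompactSpace M]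

theorem _root_.SmoothMetric.integral_divergence_le_perimeter (g : SmoothMetric N M) {A : Set M}
    (hP : g.perimeter A ≠ ⊤) {ξ : ∀ x : M, TangentSpace (𝓡 N) x} (hξ : ∀ x, FieldC1At ξ x) {r : ℝ} (hr : 0 < r)
    (hξ1 : ∀ x, g.inner x (ξ x) (ξ x) ≤ r ^ 2) : ∫ x in A, g.divergence ξ x ∂g.vol ≤ r * (g.perimeter A).toReal := by
  have h1 : ENNReal.ofReal (∫ x in A, g.divergence (fun x => r⁻¹ • ξ x) x ∂g.vol) ≤ g.perimeter A := by
    refine le_iSup_of_le (fun x => r⁻¹ • ξ x) (le_iSup_of_le (fun x => (hξ x).const_smul r⁻¹)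
      (le_iSup_of_le (fun x => ?_) le_rfl))
    rw [inner_const_smul_self, inv_pow, inv_mul_le_iff₀ (by positivity), mul_one]
    exact hξ1 x
  simp only [divergence_const_smul g (hξ _), integral_const_mul] at h1
  have h2 := (ENNReal.ofReal_le_iff_le_toReal hP).1 h1
  rwa [inv_mul_le_iff₀ hr] at h2

variable [T2Space M]

/-- Comparison of the perimeter of `A ⊆ Ω` with the flux of the field `-∇u / l + Z`. -/
theorem volume_div_add_integral_le (h : g.IsTorsionFunction Ω u l) {A : Set M} (hA : NullMeasurableSet A g.vol)
    (hAΩ : A ⊆ Ω) (hP : g.perimeter A ≠ ⊤) {Z : ∀ x : M, TangentSpace (𝓡 N) x} (hZ : ∀ x, FieldC1At Z x)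
    {K : Set M} (hK : IsClosed K) (hKΩ : K ⊆ Ω) (hZ0 : ∀ x ∉ K, Z x = 0)
    (hZ1 : ∀ x ∈ Ω, g.inner x ((-l⁻¹) • g.grad u x + Z x) ((-l⁻¹) • g.grad u x + Z x) ≤ 1) :
    l⁻¹ * g.vol.real A + ∫ x in A, g.divergence Z x ∂g.vol ≤ (g.perimeter A).toReal := by
  have hl := h.l_pos
  have hfin : IsFiniteMeasure g.vol := inferInstance
  have main : ∀ δ > 0, l⁻¹ * g.vol.real A + ∫ x in A, g.divergence Z x ∂g.vol ≤
      (1 + δ) * (g.perimeter A).toReal + δ / (l / 2) * g.vol.real Ω := by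
    intro δ hδ
    obtain ⟨η, hη, hηΩ, hη1⟩ := h.exists_field_approx hδ
    obtain ⟨ε₀, hε₀, hμv⟩ := h.exists_forall_sq_le_inner_grad (half_pos hl) (half_lt_self hl)
    -- For `2ε ≤ m` the cutoff equals `1` on `K`, so the perturbation `Z` does not meet the
    -- transition layer.
    obtain ⟨m, hm, hmK⟩ : ∃ m > 0, ∀ x ∈ K, m ≤ u x := by
      rcases K.eq_empty_or_nonempty with he | hne
      · exact ⟨1, one_pos, by simp [he]⟩
      · obtain ⟨z, hz, hzmin⟩ := hK.isCompact.exists_isMinOn hne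
          (h.contMDiffOn.continuousOn.mono (hKΩ.trans subset_closure))
        exact ⟨u z, h.pos z (hKΩ hz), fun x hx => hzmin hx⟩
    -- `V` is the error of the approximation, of length at most `δ` on `Ω`; the cutoff is applied to
    -- it alone.
    let V : ∀ x : M, TangentSpace (𝓡 N) x := fun x => (-l⁻¹) • g.grad u x + (-1 : ℝ) • η x
    have hV : ∀ x ∈ Ω, FieldC1At V x := fun x hx =>
      ((h.fieldC1At_grad hx).const_smul _).add ((hη x).const_smul _)
    have key : ∀ ε, 0 < ε → 2 * ε ≤ ε₀ → 2 * ε ≤ m →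
        l⁻¹ * (∫ x in A, cutoff Ω u ε x * 1 ∂g.vol) + ((∫ x in A, g.divergence η x ∂g.vol) -
          ∫ x in A, cutoff Ω u ε x * g.divergence η x ∂g.vol) + ∫ x in A, g.divergence Z x ∂g.vol ≤
        (1 + δ) * (g.perimeter A).toReal + δ / (l / 2) * g.vol.real Ω := by
      intro ε hε hεε₀ hεm
      have hχV := h.fieldC1At_cutoff_smul hε hV
      -- The competitor: `-∇u / l + Z` on `K`, a convex combination of `-∇u / l` and `η` on the rest
      -- of `Ω`, and `η` outside `Ω`. Its length is at most `1 + δ` everywhere.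
      let ξ : ∀ x : M, TangentSpace (𝓡 N) x := fun x => cutoff Ω u ε x • V x + (η x + Z x)
      have hξ : ∀ x, FieldC1At ξ x := fun x => (hχV x).add ((hη x).add (hZ x))
      have hξ1 : ∀ x, g.inner x (ξ x) (ξ x) ≤ (1 + δ) ^ 2 := by
        intro x
        have h1δ : (1 : ℝ) ≤ (1 + δ) ^ 2 := by nlinarith
        by_cases hxK : x ∈ K
        · have e : ξ x = (-l⁻¹) • g.grad u x + Z x := by
            simp only [ξ, V, cutoff_eq_one hε (hKΩ hxK) (hεm.trans (hmK x hxK)), one_smul, neg_smul]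
            abel
          rw [e]
          exact (hZ1 x (hKΩ hxK)).trans h1δ
        · by_cases hxΩ : x ∈ Ω
          · have e : ξ x = cutoff Ω u ε x • ((-l⁻¹) • g.grad u x) + (1 - cutoff Ω u ε x) • η x := by
              simp only [ξ, V, hZ0 x hxK, add_zero]
              module
            rw [e]
            have hc0 := cutoff_nonneg Ω u ε x
            have hc1 := cutoff_le_one Ω u ε x
            refine (inner_convex_comb_le g hc0 (sub_nonneg.2 hc1) (by ring) _ _).trans ?_
            have h3 := (h.inner_grad_lt x hxΩ).le
            have h4 : g.inner x ((-l⁻¹) • g.grad u x) ((-l⁻¹) • g.grad u x) ≤ 1 := by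
              rw [inner_const_smul_self, neg_sq, inv_pow, inv_mul_le_iff₀ (by positivity), mul_one]
              exact h3
            have h5 := mul_le_mul_of_nonneg_left (h4.trans h1δ) hc0
            have h6 := mul_le_mul_of_nonneg_left (hη1 x) (sub_nonneg.2 hc1)
            linarith
          · have e : ξ x = η x := by
              simp only [ξ, hZ0 x hxK, cutoff, Set.indicator_of_notMem hxΩ, zero_smul, zero_add, add_zero]
            rw [e]
            exact hη1 x
      set Q : M → ℝ := fun x => g.divergence (fun x => cutoff Ω u ε x • g.grad u x) x + cutoff Ω u ε x with hQ
      have hτ : ∀ x, 0 ≤ deriv (cutoffProfile ε) (u x) := fun x => (monotone_cutoffProfile hε).deriv_nonneg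
      have hQ0 : ∀ x, 0 ≤ Q x := by
        intro x
        by_cases hx : x ∈ Ω
        · simp only [hQ]
          rw [h.divergence_cutoff_smul_grad hx]
          exact mul_nonneg (hτ x) (inner_self_nonneg g _)
        · simp only [hQ]
          rw [h.divergence_cutoff_smul_of_notMem hε _ hx, zero_add]
          exact cutoff_nonneg Ω u ε x
      -- The left side is the divergence of the competitor without the term in which the cutoff is
      -- differentiated. That term, `τ'(u) g(∇u, V)`, is at least `-(2δ/l) Q`, because `|V| ≤ δ` and
      -- `|∇u| ≥ l/2` in the transition layer.
      have hpt : ∀ x ∈ Ω, l⁻¹ * (cutoff Ω u ε x * 1) + (g.divergence η x - cutoff Ω u ε x * g.divergence η x) +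
          g.divergence Z x ≤ g.divergence ξ x + δ / (l / 2) * Q x := by
        intro x hx
        have e1 : g.divergence ξ x = cutoff Ω u ε x * (l⁻¹ - g.divergence η x) +
            deriv (cutoffProfile ε) (u x) * g.inner x (g.grad u x) (V x) + (g.divergence η x + g.divergence Z x) := by
          rw [divergence_add g (hχV x) ((hη x).add (hZ x)), divergence_add g (hη x) (hZ x),
            h.divergence_cutoff_smul hx (hV x hx),
            divergence_add g ((h.fieldC1At_grad hx).const_smul _) ((hη x).const_smul _),
            divergence_const_smul g (h.fieldC1At_grad hx), divergence_const_smul g (hη x), h.divergence_grad x hx]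
          ring
        have e2 : Q x = deriv (cutoffProfile ε) (u x) * g.inner x (g.grad u x) (g.grad u x) :=
          h.divergence_cutoff_smul_grad hx
        have e3 : 0 ≤ deriv (cutoffProfile ε) (u x) * g.inner x (g.grad u x) (V x) + δ / (l / 2) * Q x := by
          rcases le_or_gt (u x) (2 * ε) with hux | hux
          · have hVn : g.inner x (V x) (V x) ≤ δ ^ 2 := by
              have e4 : V x = (-1 : ℝ) • (η x + l⁻¹ • g.grad u x) := by
                simp only [V]; module
              rw [e4, inner_const_smul_self]
              simpa using hηΩ x hx
            have hcs : (g.inner x (g.grad u x) (V x) / δ) ^ 2 ≤ g.inner x (g.grad u x) (g.grad u x) := by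
              rw [div_pow, div_le_iff₀ (by positivity)]
              exact (sq_inner_le g _ _).trans (mul_le_mul_of_nonneg_left hVn (inner_self_nonneg g _))
            have h7 := abs_le_div_of_sq_le (half_pos hl) hcs (hμv x hx (hux.trans hεε₀))
            have h8 := (neg_le_abs _).trans h7
            have h9 : 0 ≤ g.inner x (g.grad u x) (V x) + δ * (g.inner x (g.grad u x) (g.grad u x) / (l / 2)) := by
              have := mul_le_mul_of_nonneg_left h8 hδ.le
              have e5 : δ * -(g.inner x (g.grad u x) (V x) / δ) = - g.inner x (g.grad u x) (V x) := by
                field_simp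
              rw [e5] at this
              linarith
            rw [e2]
            have := mul_nonneg (hτ x) h9
            refine this.trans_eq ?_
            ring
          · rw [e2, deriv_cutoffProfile_eq_zero hε hux]
            simp
        rw [e1]
        linarith
      have i1 : IntegrableOn (fun x => l⁻¹ * (cutoff Ω u ε x * 1)) A g.vol :=
        (integrable_of_continuous g (continuous_const.mul ((h.continuous_cutoff hε).mul continuous_const))).integrableOn
      have i2 : IntegrableOn (g.divergence η) A g.vol :=
        (integrable_of_continuous g (continuous_divergence g hη)).integrableOn
      have i3 : IntegrableOn (fun x => cutoff Ω u ε x * g.divergence η x) A g.vol :=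
        (integrable_of_continuous g ((h.continuous_cutoff hε).mul (continuous_divergence g hη))).integrableOn
      have i4 : IntegrableOn (g.divergence Z) A g.vol :=
        (integrable_of_continuous g (continuous_divergence g hZ)).integrableOn
      have i5 : IntegrableOn (g.divergence ξ) A g.vol :=
        (integrable_of_continuous g (continuous_divergence g hξ)).integrableOn
      have i6' : Integrable Q g.vol :=
        (integrable_of_continuous g (continuous_divergence g (h.fieldC1At_cutoff_smul hε fun x hx => h.fieldC1At_grad hx))).add
          (integrable_of_continuous g (h.continuous_cutoff hε))
      have i6 : IntegrableOn Q A g.vol := i6'.integrableOn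
      have i23 : IntegrableOn (fun x => g.divergence η x - cutoff Ω u ε x * g.divergence η x) A g.vol := i2.sub i3
      have i123 : IntegrableOn (fun x => l⁻¹ * (cutoff Ω u ε x * 1) +
        (g.divergence η x - cutoff Ω u ε x * g.divergence η x)) A g.vol := i1.add i23
      have hle : ∫ x in A, (l⁻¹ * (cutoff Ω u ε x * 1) + (g.divergence η x - cutoff Ω u ε x * g.divergence η x) +
          g.divergence Z x) ∂g.vol ≤ ∫ x in A, (g.divergence ξ x + δ / (l / 2) * Q x) ∂g.vol := by
        refine integral_mono_ae (i123.add i4) (i5.add (i6.const_mul _)) ?_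
        filter_upwards [ae_restrict_mem₀ hA] with x hx using hpt x (hAΩ hx)
      rw [integral_add i123 i4, integral_add i1 i23, integral_sub i2 i3, integral_const_mul,
        integral_add i5 (i6.const_mul _), integral_const_mul] at hle
      refine hle.trans (add_le_add (integral_divergence_le_perimeter g hP hξ (by positivity) hξ1) ?_)
      refine mul_le_mul_of_nonneg_left ?_ (by positivity)
      exact (setIntegral_le_integral i6' (Filter.Eventually.of_forall hQ0)).trans (h.integral_divergence_cutoff_add_le hε)
    have t1 := h.tendsto_integral_cutoff_mul hA hAΩ (continuous_const (y := (1 : ℝ)))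
    have t2 := h.tendsto_integral_cutoff_mul hA hAΩ (continuous_divergence g hη)
    have t3 := ((t1.const_mul l⁻¹).add (t2.const_sub (∫ x in A, g.divergence η x ∂g.vol))).add_const
      (∫ x in A, g.divergence Z x ∂g.vol)
    have h1 : Filter.Tendsto (fun n : ℕ => 2 * (1 / (n + 1 : ℝ))) Filter.atTop (𝓝 (2 * 0)) :=
      tendsto_one_div_add_atTop_nhds_zero_nat.const_mul 2
    rw [mul_zero] at h1
    -- As `ε → 0` the two integrals of `div η` cancel and the cutoff tends to `1` on `A`. Only then
    -- is `δ` sent to `0`.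
    have := le_of_tendsto t3 (b := (1 + δ) * (g.perimeter A).toReal + δ / (l / 2) * g.vol.real Ω) (by
      filter_upwards [h1.eventually (gt_mem_nhds hε₀), h1.eventually (gt_mem_nhds hm)] with n hn hn'
      exact key _ (by positivity) hn.le hn'.le)
    simpa using this
  have ht : Filter.Tendsto (fun δ : ℝ => (1 + δ) * (g.perimeter A).toReal + δ / (l / 2) * g.vol.real Ω) (𝓝[>] 0)
      (𝓝 ((1 + 0) * (g.perimeter A).toReal + 0 / (l / 2) * g.vol.real Ω)) := by
    refine Filter.Tendsto.mono_left (Continuous.tendsto ?_ 0) nhdsWithin_le_nhds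
    fun_prop
  have := ge_of_tendsto ht (b := l⁻¹ * g.vol.real A + ∫ x in A, g.divergence Z x ∂g.vol) (by
    filter_upwards [self_mem_nhdsWithin] with δ hδ using main δ hδ)
  simpa using this

end IsTorsionFunction

end SmoothMetric

/-! ### Functions with vanishing weak derivatives -/

section Euclidean

open scoped Convolution

variable {N : ℕ} {f : EuclideanSpace ℝ (Fin N) → ℝ}

theorem partialDeriv_sub_left {φ : EuclideanSpace ℝ (Fin N) → ℝ} {x y : EuclideanSpace ℝ (Fin N)}
    (hφ : DifferentiableAt ℝ φ (x - y)) (i : Fin N) :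
    partialDeriv i (fun t => φ (x - t)) y = -partialDeriv i φ (x - y) := by
  have h1 : HasFDerivAt (fun t => x - t) (-ContinuousLinearMap.id ℝ (EuclideanSpace ℝ (Fin N))) y :=
    (hasFDerivAt_id y).const_sub x
  have h2 := (hφ.hasFDerivAt.comp y h1).fderiv
  change fderiv ℝ (φ ∘ fun t => x - t) y _ = _
  rw [h2]
  simp [partialDeriv]

/-- The derivative of the mollification is `f` paired with the gradient of a reflected translate of
`φ`. For `x` in the half-size ball that translate is an admissible test function. -/
theorem hasFDerivAt_convolution_zero (hf : LocallyIntegrable f) {y₀ x : EuclideanSpace ℝ (Fin N)} {R : ℝ}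
    (h : ∀ φ : EuclideanSpace ℝ (Fin N) → ℝ, ContDiff ℝ 1 φ → (∀ y ∉ Metric.closedBall y₀ R, φ y = 0) →
      ∀ i, ∫ y, f y * partialDeriv i φ y = 0)
    {φ : EuclideanSpace ℝ (Fin N) → ℝ} (hφ : ContDiff ℝ 1 φ) (hφc : HasCompactSupport φ)
    (hφ0 : ∀ y ∉ Metric.ball 0 (R / 2), φ y = 0) (hx : x ∈ Metric.ball y₀ (R / 2)) :
    HasFDerivAt (φ ⋆[ContinuousLinearMap.lsmul ℝ ℝ, volume] f) (0 : EuclideanSpace ℝ (Fin N) →L[ℝ] ℝ) x := by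
  rw [← convolution_flip]
  have h1 := hφc.hasFDerivAt_convolution_right (ContinuousLinearMap.lsmul ℝ ℝ : ℝ →L[ℝ] ℝ →L[ℝ] ℝ).flip hf hφ x
  refine h1.congr_fderiv (ContinuousLinearMap.coe_inj.1 ?_)
  refine (EuclideanSpace.basisFun (Fin N) ℝ).toBasis.ext fun i => ?_
  have h2 := convolution_precompR_apply (ContinuousLinearMap.lsmul ℝ ℝ : ℝ →L[ℝ] ℝ →L[ℝ] ℝ).flip hf (hφc.fderiv (𝕜 := ℝ))
    (hφ.continuous_fderiv one_ne_zero) x (EuclideanSpace.single i 1)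
  have h3 := h (fun t => φ (x - t)) (hφ.comp (contDiff_const.sub contDiff_id)) (fun t ht => hφ0 _ fun h4 => ht (by
    rw [mem_ball_zero_iff] at h4
    rw [Metric.mem_ball, dist_eq_norm] at hx
    rw [Metric.mem_closedBall, dist_eq_norm]
    have : t - y₀ = (x - y₀) - (x - t) := by abel
    rw [this]
    exact (norm_sub_le _ _).trans (by linarith))) i
  simp only [partialDeriv_sub_left (hφ.differentiable one_ne_zero _), mul_neg, integral_neg, neg_eq_zero] at h3
  simp only [OrthonormalBasis.coe_toBasis, EuclideanSpace.basisFun_apply, ContinuousLinearMap.coe_coe]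
  rw [h2, convolution_def]
  refine Eq.trans (integral_congr_ae (Filter.Eventually.of_forall fun t => ?_)) h3
  simp [partialDeriv, mul_comm]

/-- A function whose weak derivatives vanish on a ball is almost everywhere constant on the concentric ball of half the
radius. -/
theorem exists_ae_eq_const_of_weakDeriv_eq_zero (hf : LocallyIntegrable f) {y₀ : EuclideanSpace ℝ (Fin N)} {R : ℝ}
    (hR : 0 < R) (h : ∀ φ : EuclideanSpace ℝ (Fin N) → ℝ, ContDiff ℝ 1 φ → (∀ y ∉ Metric.closedBall y₀ R, φ y = 0) →
      ∀ i, ∫ y, f y * partialDeriv i φ y = 0) :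
    ∃ z, ∀ᵐ y, y ∈ Metric.ball y₀ (R / 2) → f y = f z := by
  let φ : ℕ → ContDiffBump (0 : EuclideanSpace ℝ (Fin N)) := fun n =>
    ⟨R / 2 / (n + 2) / 2, R / 2 / (n + 2), by positivity, half_lt_self (by positivity)⟩
  have hφ : Filter.Tendsto (fun n => (φ n).rOut) Filter.atTop (𝓝 0) :=
    tendsto_const_nhds.div_atTop (Filter.tendsto_atTop_add_const_right _ _ tendsto_natCast_atTop_atTop)
  -- The outer radius is exactly twice the inner one; this bounded ratio gives almost everywhere
  -- convergence of the mollifications for a merely locally integrable `f`.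
  have hae := ContDiffBump.ae_convolution_tendsto_right_of_locallyIntegrable (K := 2) hφ
    (Filter.Eventually.of_forall fun n => (by change R / 2 / (n + 2) ≤ 2 * (R / 2 / (n + 2) / 2); linarith)) hf
  have hconst : ∀ n, ∀ x ∈ Metric.ball y₀ (R / 2), ∀ y ∈ Metric.ball y₀ (R / 2),
      ((φ n).normed volume ⋆[ContinuousLinearMap.lsmul ℝ ℝ, volume] f) x =
        ((φ n).normed volume ⋆[ContinuousLinearMap.lsmul ℝ ℝ, volume] f) y := by
    intro n x hx y hy
    have hd : ∀ z ∈ Metric.ball y₀ (R / 2),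
        HasFDerivAt ((φ n).normed volume ⋆[ContinuousLinearMap.lsmul ℝ ℝ, volume] f) (0 : EuclideanSpace ℝ (Fin N) →L[ℝ] ℝ) z := fun z hz =>
      hasFDerivAt_convolution_zero hf h (φ n).contDiff_normed (φ n).hasCompactSupport_normed (fun w hw => by
        have hs := (φ n).support_normed_eq (μ := volume)
        by_contra hne
        have : w ∈ Metric.ball 0 (φ n).rOut := hs ▸ hne
        refine hw (Metric.ball_subset_ball ?_ this)
        change R / 2 / (n + 2) ≤ R / 2
        exact div_le_self (by positivity) (by linarith [n.cast_nonneg (α := ℝ)])) hz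
    exact Metric.isOpen_ball.is_const_of_fderiv_eq_zero (convex_ball y₀ (R / 2)).isPreconnected
      (fun z hz => (hd z hz).differentiableAt.differentiableWithinAt) (fun z hz => (hd z hz).fderiv) hx hy
  -- Convergence holds on a set of full measure, which is dense and so meets the ball. The limit at
  -- this one point identifies the constant.
  have hex : ∃ z ∈ Metric.ball y₀ (R / 2), Filter.Tendsto
      (fun n => ((φ n).normed volume ⋆[ContinuousLinearMap.lsmul ℝ ℝ, volume] f) z) Filter.atTop (𝓝 (f z)) := by
    obtain ⟨z, hz, hz'⟩ := (Measure.dense_of_ae hae).exists_mem_open Metric.isOpen_ball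
      ⟨y₀, Metric.mem_ball_self (half_pos hR)⟩
    exact ⟨z, hz', hz⟩
  obtain ⟨z, hz, hzt⟩ := hex
  refine ⟨z, ?_⟩
  filter_upwards [hae] with y hy hyb
  exact tendsto_nhds_unique (hy.congr fun n => hconst n y hyb z hz) hzt

end Euclidean

/-! ### Rigidity in the equality case -/

namespace SmoothMetric

variable {N : ℕ} {M : Type*} [TopologicalSpace M]
  [ChartedSpace (EuclideanSpace ℝ (Fin N)) M] [IsManifold (𝓡 N) ∞ M]

section Calibration

variable [MeasurableSpace M] [BorelSpace M] [CompactSpace M] [T2Space M]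
  {g : SmoothMetric N M} {Ω A K : Set M} {u : M → ℝ} {l : ℝ}

/-- The room needed for a perturbation `t w`: the cross term costs at most `2|t| C` and the
quadratic term at most `|t| C`, which explains the factor `3`. -/
theorem inner_add_const_smul_le (g : SmoothMetric N M) {x : M} {v w : TangentSpace (𝓡 N) x} {a C t : ℝ}
    (hv : g.inner x v v ≤ a) (hw : g.inner x w w ≤ C) (ha : a ≤ 1) (hC : 1 ≤ C) (ht : |t| ≤ 1)
    (htC : 3 * |t| * C ≤ 1 - a) : g.inner x (v + t • w) (v + t • w) ≤ 1 := by
  have h1 := inner_add_smul_self g 1 t v w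
  rw [one_smul] at h1
  rw [h1]
  have h2 := sq_inner_le g v w
  have h3 := inner_self_nonneg g v
  have h4 := inner_self_nonneg g w
  have h5 : |g.inner x v w| ≤ C := by
    refine abs_le_of_sq_le_sq (h2.trans ?_) (by linarith)
    calc _ ≤ 1 * C := mul_le_mul (hv.trans ha) hw h4 zero_le_one
      _ ≤ C ^ 2 := by nlinarith
  have h6 : t * g.inner x v w ≤ |t| * C := by
    refine (le_abs_self _).trans ?_
    rw [abs_mul]
    exact mul_le_mul_of_nonneg_left h5 (abs_nonneg t)
  have h7 : t ^ 2 * g.inner x w w ≤ |t| * C := by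
    refine mul_le_mul ?_ hw h4 (abs_nonneg t)
    rw [← sq_abs]
    nlinarith [abs_nonneg t]
  linarith

/-- If `-∇u / l` calibrates `A` exactly, then the characteristic function of `A` has no weak derivative in `Ω`. -/
theorem IsTorsionFunction.setIntegral_divergence_eq_zero (h : g.IsTorsionFunction Ω u l)
    (hA : NullMeasurableSet A g.vol) (hAΩ : A ⊆ Ω) (hP : g.perimeter A ≠ ⊤)
    (heq : (g.perimeter A).toReal = l⁻¹ * g.vol.real A) {Z : ∀ x : M, TangentSpace (𝓡 N) x}
    (hZ : ∀ x, FieldC1At Z x) (hK : IsClosed K) (hKΩ : K ⊆ Ω) (hZ0 : ∀ x ∉ K, Z x = 0) :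
    ∫ x in A, g.divergence Z x ∂g.vol = 0 := by
  have hl := h.l_pos
  rcases K.eq_empty_or_nonempty with rfl | hne
  · have : ∀ x, g.divergence Z x = 0 := fun x => divergence_eq_zero_of_notMem g hK hZ0 (Set.notMem_empty x)
    simp [this]
  have hcont : ContinuousOn (fun x => g.inner x (g.gradWithin (closure Ω) u x) (g.gradWithin (closure Ω) u x)) K :=
    h.continuousOn_inner_gradWithin.mono (hKΩ.trans subset_closure)
  obtain ⟨m, hm, hmax⟩ := hK.isCompact.exists_isMaxOn hne hcont
  have hZc : Continuous fun x => g.inner x (Z x) (Z x) :=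
    continuous_iff_continuousAt.2 fun x => (contMDiffAt_inner g (hZ x) (hZ x)).continuousAt
  obtain ⟨C, hC⟩ := (isCompact_univ.bddAbove_image hZc.continuousOn)
  set D := max C 1 with hD
  -- The maximum over `K` of the squared length of the calibrating field; it is less than `1` by the
  -- strict gradient bound.
  set a := l⁻¹ ^ 2 * g.inner m (g.grad u m) (g.grad u m) with ha
  have ha1 : a < 1 := by
    rw [ha, inv_pow, inv_mul_lt_iff₀ (by positivity), mul_one]
    exact h.inner_grad_lt m (hKΩ hm)
  have hD1 : 1 ≤ D := le_max_right _ _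
  set t := min 1 ((1 - a) / (3 * D)) with ht
  have htpos : 0 < t := lt_min one_pos (div_pos (by linarith) (by linarith))
  have ht1 : t ≤ 1 := min_le_left _ _
  have ht2 : 3 * t * D ≤ 1 - a := by
    have := (le_div_iff₀ (by linarith : (0 : ℝ) < 3 * D)).1 (min_le_right 1 ((1 - a) / (3 * D)))
    rw [← ht] at this
    linarith
  -- The fields `-∇u / l + sZ` with `s = t` and `s = -t` both have length at most `1`. The
  -- comparison with the perimeter, an equality for `s = 0`, then gives both signs of the integral.
  have key : ∀ s : ℝ, |s| = t → s * ∫ x in A, g.divergence Z x ∂g.vol ≤ 0 := by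
    intro s hs
    have h1 := h.volume_div_add_integral_le hA hAΩ hP (Z := fun x => s • Z x) (fun x => (hZ x).const_smul s) hK hKΩ
      (fun x hx => by rw [hZ0 x hx, smul_zero]) (fun x hx => by
        by_cases hxK : x ∈ K
        · refine inner_add_const_smul_le g (a := a) (C := D) ?_ ?_ ha1.le hD1 (hs ▸ ht1) (by rw [hs]; exact ht2)
          · rw [inner_const_smul_self, neg_sq]
            refine mul_le_mul_of_nonneg_left ?_ (by positivity)
            have := hmax hxK
            simp only [Set.mem_ofPred_eq] at this
            rwa [gradWithin_closure_eq_grad g h.domain.isOpen u hx,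
              gradWithin_closure_eq_grad g h.domain.isOpen u (hKΩ hm)] at this
          · exact (hC ⟨x, trivial, rfl⟩).trans (le_max_left _ _)
        · rw [hZ0 x hxK, smul_zero, add_zero, inner_const_smul_self, neg_sq, inv_pow,
            inv_mul_le_iff₀ (by positivity), mul_one]
          exact (h.inner_grad_lt x hx).le)
    rw [heq] at h1
    simp only [divergence_const_smul g (hZ _), integral_const_mul] at h1
    linarith
  have h1 := key t (abs_of_pos htpos)
  have h2 := key (-t) (by rw [abs_neg, abs_of_pos htpos])
  nlinarith

end Calibration

section Volume

variable [MeasurableSpace M] [BorelSpace M] [CompactSpace M] [T2Space M] {A Ω : Set M}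

/-- Division by the density makes the Riemannian divergence of a coordinate field, times the
density, a plain partial derivative. Thus fields on `M` produce all Euclidean test functions. -/
theorem volDensity_mul_divergence_chartField (g : SmoothMetric N M) {c : M} {φ : EuclideanSpace ℝ (Fin N) → ℝ}
    (hφ : ContDiff ℝ 1 φ) (i : Fin N) {y : EuclideanSpace ℝ (Fin N)} (hy : y ∈ (extChartAt (𝓡 N) c).target) :
    g.volDensity c y * g.divergence (chartField c fun y => (φ y / g.volDensity c y) • EuclideanSpace.single i 1)
      ((extChartAt (𝓡 N) c).symm y) = partialDeriv i φ y := by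
  have hC : FieldC1At (chartField c fun y => (φ y / g.volDensity c y) • EuclideanSpace.single i (1 : ℝ))
      ((extChartAt (𝓡 N) c).symm y) := by
    refine fieldC1At_chartField ((extChartAt (𝓡 N) c).map_target hy) ?_
    rw [(extChartAt (𝓡 N) c).right_inv hy]
    exact (hφ.contDiffAt.div (contDiffAt_volDensity g hy 1) (volDensity_pos g hy).ne').smul contDiffAt_const
  have hev : ∀ j, (fun y => g.volDensity c y * coordComp c
      (chartField c fun y => (φ y / g.volDensity c y) • EuclideanSpace.single i (1 : ℝ)) j y) =ᶠ[𝓝 y]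
      fun y => if j = i then φ y else 0 := by
    intro j
    filter_upwards [(isOpen_target c).mem_nhds hy] with z hz
    rw [coordComp_chartField hz]
    have := (volDensity_pos g hz).ne'
    by_cases hj : j = i
    · subst hj
      simp only [PiLp.smul_apply, PiLp.single_apply, if_true, smul_eq_mul, mul_one]
      field_simp
    · simp [hj]
  rw [volDensity_mul_divergence g hy hC]
  simp only [(hev _).partialDeriv_eq]
  rw [Finset.sum_eq_single i]
  · simp
  · intro j _ hj
    simp [hj, partialDeriv]
  · simp

/-- A set whose characteristic function has no weak derivative in `Ω` is locally null or conull. -/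
theorem exists_mem_nhds_inter_null_or_diff_null (g : SmoothMetric N M) (hΩ : IsOpen Ω) (hA : MeasurableSet A)
    (hdiv : ∀ (Z : ∀ x : M, TangentSpace (𝓡 N) x) (K : Set M), (∀ x, FieldC1At Z x) → IsClosed K → K ⊆ Ω →
      (∀ x ∉ K, Z x = 0) → ∫ x in A, g.divergence Z x ∂g.vol = 0) {x₀ : M} (hx₀ : x₀ ∈ Ω) :
    ∃ U ∈ 𝓝 x₀, g.vol (U ∩ A) = 0 ∨ g.vol (U \ A) = 0 := by
  obtain ⟨R, hR, hball⟩ := exists_closedBall_chart (N := N) (hΩ.mem_nhds hx₀)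
  set e := extChartAt (𝓡 N) x₀ with he
  set T := e.target ∩ e.symm ⁻¹' A with hT
  have hTm : MeasurableSet T := measurableSet_target_inter_preimage x₀ hA
  have hloc : LocallyIntegrable (T.indicator (1 : EuclideanSpace ℝ (Fin N) → ℝ)) :=
    (locallyIntegrable_const 1).indicator hTm
  have hsub : Metric.closedBall (e x₀) R ⊆ e.target := fun y hy => (hball y hy).1
  -- The characteristic function of `A` in the chart has zero weak derivatives on the ball, hence
  -- equals its value at some `z` almost everywhere on the half-size ball. Whether `z` lies in `T`
  -- decides between conull and null.
  obtain ⟨z, hz⟩ := exists_ae_eq_const_of_weakDeriv_eq_zero hloc hR (y₀ := e x₀) (by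
    intro φ hφ hφ0 i
    set K := e.symm '' Metric.closedBall (e x₀) R with hK
    have hKc : IsClosed K := ((isCompact_closedBall _ _).image_of_continuousOn
      ((continuousOn_extChartAt_symm x₀).mono hsub)).isClosed
    have hKs : K ⊆ e.source := by
      rintro _ ⟨y, hy, rfl⟩
      exact e.map_target (hsub hy)
    have hKΩ : K ⊆ Ω := by
      rintro _ ⟨y, hy, rfl⟩
      exact (hball y hy).2
    set Z : ∀ x : M, TangentSpace (𝓡 N) x :=
      chartField x₀ fun y => (φ y / g.volDensity x₀ y) • EuclideanSpace.single i (1 : ℝ) with hZdef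
    have hZ0 : ∀ x ∉ K, Z x = 0 := fun x hx =>
      chartField_eq_zero (fun y hy => by rw [hφ0 y hy, zero_div, zero_smul]) hx
    have hZ : ∀ x, FieldC1At Z x := by
      intro x
      by_cases hx : x ∈ e.source
      · exact fieldC1At_chartField hx ((hφ.contDiffAt.div (contDiffAt_volDensity g (e.map_source hx) 1)
          (volDensity_pos g (e.map_source hx)).ne').smul contDiffAt_const)
      · exact fieldC1At_of_notMem hKc hZ0 fun h => hx (hKs h)
    have h1 := hdiv Z K hZ hKc hKΩ hZ0
    rw [← integral_indicator hA, integral_vol_eq g x₀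
      ((continuous_divergence g hZ).aestronglyMeasurable.indicator hA) (fun x hx => by
        exact Set.indicator_apply_eq_zero.2 fun _ => divergence_eq_zero_of_notMem g hKc hZ0 fun h => hx (hKs h))] at h1
    rw [← h1, ← setIntegral_eq_integral_of_forall_compl_eq_zero (s := e.target) (fun y hy => by
      rw [Set.indicator_of_notMem fun h => hy h.1, zero_mul])]
    refine setIntegral_congr_fun (isOpen_target x₀).measurableSet fun y hy => ?_
    rw [← volDensity_mul_divergence_chartField g hφ i hy, ← hZdef]
    by_cases hyA : e.symm y ∈ A
    · have hyT : y ∈ T := ⟨hy, hyA⟩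
      rw [Set.indicator_of_mem hyT, Set.indicator_of_mem hyA, Pi.one_apply, one_mul]
    · have hyT : y ∉ T := fun h => hyA h.2
      rw [Set.indicator_of_notMem hyT, Set.indicator_of_notMem hyA, zero_mul, mul_zero])
  have hUo : IsOpen (e.source ∩ e ⁻¹' Metric.ball (e x₀) (R / 2)) :=
    (continuousOn_extChartAt x₀).isOpen_inter_preimage (isOpen_extChartAt_source x₀) Metric.isOpen_ball
  refine ⟨_, hUo.mem_nhds ⟨mem_extChartAt_source x₀, Metric.mem_ball_self (half_pos hR)⟩, ?_⟩
  have hnull : ∀ B : Set M, MeasurableSet B → (∀ y ∈ e.target, e.symm y ∈ B →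
      T.indicator (1 : EuclideanSpace ℝ (Fin N) → ℝ) y ≠ T.indicator (1 : EuclideanSpace ℝ (Fin N) → ℝ) z) →
      g.vol ((e.source ∩ e ⁻¹' Metric.ball (e x₀) (R / 2)) ∩ B) = 0 := by
    intro B hB hne
    rw [vol_eq_chartVolume g (hUo.measurableSet.inter hB) (c := x₀) fun x hx => hx.1.1,
      chartVolume_apply g x₀ (hUo.measurableSet.inter hB)]
    refine setLIntegral_measure_zero _ _ (measure_mono_null (fun y hy => ?_) hz)
    intro hmem
    refine hne y hy.1 hy.2.2 (hmem ?_)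
    have := hy.2.1.2
    rwa [Set.mem_preimage, e.right_inv hy.1] at this
  by_cases hzT : z ∈ T
  · right
    rw [Set.sdiff_eq]
    refine hnull _ hA.compl fun y hy hyB => ?_
    rw [Set.indicator_of_mem hzT, Set.indicator_of_notMem fun h => hyB h.2]
    exact zero_ne_one
  · left
    refine hnull _ hA fun y hy hyB => ?_
    have hyT : y ∈ T := ⟨hy, hyB⟩
    rw [Set.indicator_of_notMem hzT, Set.indicator_of_mem hyT]
    exact one_ne_zero

/-- The points near which `A` is null and those near which it is conull form open sets that cover
`Ω`. They are disjoint because open sets have positive volume, so connectedness puts `Ω` in one of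
them; the first would make `A` null. -/
theorem ae_eq_of_locally_null_or_conull (g : SmoothMetric N M) (hΩc : IsPreconnected Ω)
    (hAΩ : A ⊆ Ω) (hA0 : g.vol A ≠ 0)
    (hloc : ∀ x ∈ Ω, ∃ U ∈ 𝓝 x, g.vol (U ∩ A) = 0 ∨ g.vol (U \ A) = 0) : g.vol (Ω \ A) = 0 := by
  have : SecondCountableTopology M := ChartedSpace.secondCountable_of_sigmaCompact (EuclideanSpace ℝ (Fin N)) M
  have hopen : ∀ B : Set M, IsOpen {x | ∃ U ∈ 𝓝 x, g.vol (U ∩ B) = 0} := by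
    intro B
    refine isOpen_iff_mem_nhds.2 fun x ⟨U, hU, hU0⟩ => ?_
    filter_upwards [eventually_mem_nhds_iff.2 hU] with y hy using ⟨U, hy, hU0⟩
  have hnull : ∀ B : Set M, B ⊆ {x | ∃ U ∈ 𝓝 x, g.vol (U ∩ B) = 0} → g.vol B = 0 := by
    intro B hB
    refine measure_null_of_locally_null B fun x hx => ?_
    obtain ⟨U, hU, hU0⟩ := hB hx
    exact ⟨U ∩ B, Filter.inter_mem (mem_nhdsWithin_of_mem_nhds hU) self_mem_nhdsWithin, hU0⟩
  have hdisj : Disjoint {x | ∃ U ∈ 𝓝 x, g.vol (U ∩ A) = 0} {x | ∃ U ∈ 𝓝 x, g.vol (U ∩ Aᶜ) = 0} := by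
    rw [Set.disjoint_left]
    rintro x ⟨U, hU, hU0⟩ ⟨V, hV, hV0⟩
    have h0 : g.vol (U ∩ V) = 0 := by
      refine measure_mono_null (fun y hy => ?_) (measure_union_null hU0 hV0)
      by_cases hyA : y ∈ A
      exacts [Or.inl ⟨hy.1, hyA⟩, Or.inr ⟨hy.2, hyA⟩]
    exact (Measure.measure_pos_of_mem_nhds g.vol (Filter.inter_mem hU hV)).ne' h0
  rcases hΩc.subset_or_subset (hopen A) (hopen Aᶜ) hdisj (fun x hx => by
    obtain ⟨U, hU, h | h⟩ := hloc x hx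
    exacts [Or.inl ⟨U, hU, h⟩, Or.inr ⟨U, hU, h⟩]) with h | h
  · exact absurd (hnull A (hAΩ.trans h)) hA0
  · refine hnull _ fun x hx => ?_
    obtain ⟨U, hU, hU0⟩ := h hx.1
    exact ⟨U, hU, measure_mono_null (t := U ∩ Aᶜ) (fun y hy => ⟨hy.1, hy.2.2⟩) hU0⟩

end Volume

/-! ### The Cheeger constant and uniqueness of the Cheeger set -/

namespace IsTorsionFunction

variable [MeasurableSpace M] [BorelSpace M] [CompactSpace M] [T2Space M]
  {g : SmoothMetric N M} {Ω A : Set M} {u : M → ℝ} {l : ℝ}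

/-- The unperturbed calibration, `Z = 0`. -/
theorem volume_div_le_perimeter (h : g.IsTorsionFunction Ω u l) (hA : g.IsCheegerCompetitor Ω A) :
    l⁻¹ * g.vol.real A ≤ (g.perimeter A).toReal := by
  have hl := h.l_pos
  have h1 := h.volume_div_add_integral_le hA.nullMeasurable hA.subset hA.perimeter_ne_top
    (Z := fun x => (0 : TangentSpace (𝓡 N) x)) fieldC1At_zero isClosed_empty (Set.empty_subset Ω) (fun _ _ => rfl)
    (fun x hx => by
      rw [add_zero, inner_const_smul_self, neg_sq, inv_pow, inv_mul_le_iff₀ (by positivity), mul_one]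
      exact (h.inner_grad_lt x hx).le)
  simpa [divergence_zero] using h1

theorem ofReal_inv_mul_vol (h : g.IsTorsionFunction Ω u l) :
    ENNReal.ofReal (1 / l) * g.vol A = ENNReal.ofReal (l⁻¹ * g.vol.real A) := by
  rw [one_div, ENNReal.ofReal_mul (inv_nonneg.2 h.l_pos.le), Measure.real, ENNReal.ofReal_toReal (measure_ne_top _ _)]

theorem le_perimeter_div_vol (h : g.IsTorsionFunction Ω u l) (hA : g.IsCheegerCompetitor Ω A) :
    ENNReal.ofReal (1 / l) ≤ g.perimeter A / g.vol A := by
  rw [ENNReal.le_div_iff_mul_le (Or.inl hA.vol_ne_zero) (Or.inl (measure_ne_top _ _)), h.ofReal_inv_mul_vol]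
  exact ENNReal.ofReal_le_of_le_toReal (h.volume_div_le_perimeter hA)

theorem isCheegerCompetitor_self (h : g.IsTorsionFunction Ω u l) : g.IsCheegerCompetitor Ω Ω where
  subset := subset_rfl
  nullMeasurable := h.domain.isOpen.measurableSet.nullMeasurableSet
  perimeter_ne_top := (h.perimeter_le.trans_lt ENNReal.ofReal_lt_top).ne
  vol_ne_zero := (h.domain.isOpen.measure_pos g.vol h.domain.isConnected.nonempty).ne'

theorem perimeter_div_vol_eq (h : g.IsTorsionFunction Ω u l) : g.perimeter Ω / g.vol Ω = ENNReal.ofReal (1 / l) := by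
  refine le_antisymm (ENNReal.div_le_of_le_mul ?_) (h.le_perimeter_div_vol h.isCheegerCompetitor_self)
  rw [h.ofReal_inv_mul_vol, ← div_eq_inv_mul]
  exact h.perimeter_le

theorem cheegerConstant_eq (h : g.IsTorsionFunction Ω u l) : g.cheegerConstant Ω = ENNReal.ofReal (1 / l) :=
  le_antisymm ((iInf₂_le Ω h.isCheegerCompetitor_self).trans_eq h.perimeter_div_vol_eq)
    (le_iInf₂ fun _ hA => h.le_perimeter_div_vol hA)

/-- A Cheeger set attains equality in the calibration inequality, so its characteristic function has
zero weak derivative in `Ω`. -/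
theorem ae_eq_of_isCheegerSet (h : g.IsTorsionFunction Ω u l) (hA : g.IsCheegerSet Ω A) : A =ᵐ[g.vol] Ω := by
  obtain ⟨hA, hAe⟩ := hA
  have heq : (g.perimeter A).toReal = l⁻¹ * g.vol.real A := by
    have h0 : 0 ≤ l⁻¹ * g.vol.real A := mul_nonneg (inv_nonneg.2 h.l_pos.le) measureReal_nonneg
    rw [← ENNReal.div_mul_cancel (a := g.vol A) (b := g.perimeter A) hA.vol_ne_zero (measure_ne_top _ _), hAe,
      h.cheegerConstant_eq, h.ofReal_inv_mul_vol, ENNReal.toReal_ofReal h0]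
  -- Competitors are only null measurable, while the argument in charts needs a measurable set. A
  -- measurable subset of full measure has the same integrals.
  obtain ⟨B, hBA, hB, hBe⟩ := hA.nullMeasurable.exists_measurable_subset_ae_eq
  have hBΩ := hBA.trans hA.subset
  have hB0 : g.vol B ≠ 0 := by
    rw [measure_congr hBe]
    exact hA.vol_ne_zero
  have hnull := ae_eq_of_locally_null_or_conull g h.domain.isConnected.isPreconnected hBΩ hB0
    fun x hx => exists_mem_nhds_inter_null_or_diff_null g h.domain.isOpen hB (fun Z K hZ hK hKΩ hZ0 => by
      rw [setIntegral_congr_set hBe]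
      exact h.setIntegral_divergence_eq_zero hA.nullMeasurable hA.subset hA.perimeter_ne_top heq hZ hK hKΩ hZ0) hx
  exact hBe.symm.trans (hBΩ.eventuallyLE.antisymm (ae_le_set.2 hnull))

end IsTorsionFunction

end SmoothMetric

theorem theorem1p2 {N : ℕ} (hN : 2 ≤ N)
    {M : Type*} [TopologicalSpace M] [ChartedSpace (EuclideanSpace ℝ (Fin N)) M]
    [IsManifold (𝓡 N) ∞ M] [CompactSpace M] [T2Space M]
    [MeasurableSpace M] [BorelSpace M]
    (g : SmoothMetric N M) (Ω : Set M) (hΩ : IsSmoothDomain N Ω)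
    (u : M → ℝ) (hu : ContMDiffOn (𝓡 N) 𝓘(ℝ, ℝ) 2 u (closure Ω))
    (l : ℝ) (hl : 0 < l)
    (h_eq : ∀ x ∈ Ω, -g.laplacian u x = 1)
    (h_dirichlet : ∀ p ∈ frontier Ω, u p = 0)
    (h_neumann : ∀ p ∈ frontier Ω, ∀ η : TangentSpace (𝓡 N) p, IsUnitOuterNormal g Ω p η →
      g.inner p (g.gradWithin (closure Ω) u p) η = -l)
    (h_ric : ∀ x ∈ Ω, g.ricci (g.grad u) x > -1 / (N : ℝ)) :
    g.IsUniquelySelfCheeger Ω ∧ g.cheegerConstant Ω = ENNReal.ofReal (1 / l) := by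
  have h := SmoothMetric.isTorsionFunction_of_overdetermined hN g hΩ hu hl h_eq h_dirichlet h_neumann h_ric
  exact ⟨⟨⟨h.isCheegerCompetitor_self, h.perimeter_div_vol_eq.trans h.cheegerConstant_eq.symm⟩,
    fun _ hA => h.ae_eq_of_isCheegerSet hA⟩, h.cheegerConstant_eq⟩
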